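/- **Theorem 3.1 (Scattering criterion).** Let $d\ge 3$ and consider the focusing nonlinear Schrödinger equation $$(i\partial_t+\Delta)u=-|u|^{\frac{4}{d-1}}u,\qquad u(0)=u_0\in H^1(\mathbb{R}^d).$$ A global solution is a function $u\in C(\mathbb{R};H^1(\mathbb{R}^d))$ satisfying $$u(t)=e^{it\Delta}u_0+i\int_0^t e^{i(t-s)\Delta}\bigl(|u|^{\frac4{d-1}}u\bigr)(s)\,ds\qquad\text{for all }t\in\mathbb{R},$$ the formula being understood in the sense of tempered distributions on $\mathbb{R}^d$. Write $$M(f)=\int_{\mathbb{R}^d}|f|^2\,dx,\qquad E(f)=\int_{\mathbb{R}^d}\tfrac12|\nabla f|^2-\tfrac{d-1}{2(d+1)}|f|^{\frac{2(d+1)}{d-1}}\,dx,\qquad \|f\|_{H^1}^2=\|f\|_{L^2}^2+\|\nabla f\|_{L^2}^2 .$$ For all $E_0\in\mathbb{R}$ and $C_1,C_2>0$ there is $\varepsilon_0=\varepsilon_0(d,E_0,C_1,C_2)>0$ such that for every $\varepsilon\in(0,\varepsilon_0]$ there is $T_{\min}=T_{\min}(d,\varepsilon,E_0,C_1,C_2)>0$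 such that the following holds for every $T_0\ge T_{\min}$. Let $u$ be a global solution with $$M(u_0)=E(u_0)=E_0\qquad\text{and}\qquad \sup_{t\in\mathbb{R}}\|u(t)\|_{H^1}^2\le C_1E_0,$$ and suppose that for every $a\in\mathbb{R}$ there is $t_0\in(a,a+T_0)$ with $$\|u\|_{L^{\frac{2(d+2)}{d-1}}_{t,x}([t_0-T_0^{1/3},\,t_0]\times\mathbb{R}^d)}\le C_2\,\varepsilon .$$ Then $u$ scatters forward in time: there is $u_+\in H^1(\mathbb{R}^d)$ with $$\lim_{t\to+\infty}\|u(t)-e^{it\Delta}u_+\|_{H^1(\mathbb{R}^d)}=0 .$$ -/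

import Mathlib

open MeasureTheory FourierTransform TemperedDistribution Filter Topology
open scoped ContDiff SchwartzMap LineDeriv ENNReal Real

noncomputable section

namespace NLS

/-- The physical space `ℝ^d`. -/
abbrev Space (d : ℕ) : Type := EuclideanSpace ℝ (Fin d)

/-- Complex-valued square integrable functions on `ℝ^d`. -/
abbrev L2 (d : ℕ) : Type := Lp ℂ 2 (volume : Measure (Space d))

/-- The Sobolev space `H¹(ℝ^d)`, realised as the graph of the weak gradient: pairs `(f, g)` with
`f, g 0, …, g (d-1)` in `L²` such that `g j` is the distributional derivative `∂_j f`. Since `g` is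
determined by `f`, this is the space of `L²` functions with weak gradient in `L²`, and the norm
inherited from the Hilbert sum is `‖f‖_{H¹}² = ‖f‖_{L²}² + ∑ j, ‖∂_j f‖_{L²}²`. -/
def sobolevH1 (d : ℕ) : Submodule ℂ (WithLp 2 (L2 d × PiLp 2 (fun _ : Fin d => L2 d))) where
  carrier := {w | ∀ j : Fin d,
    ∂_{EuclideanSpace.single j (1 : ℝ)} (w.fst : 𝓢'(Space d, ℂ)) = (w.snd j : 𝓢'(Space d, ℂ))}
  zero_mem' := by
    intro j
    change ∂_{EuclideanSpace.single j (1 : ℝ)} (Lp.toTemperedDistributionCLM ℂ volume 2 (0 : L2 d)) =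
      Lp.toTemperedDistributionCLM ℂ volume 2 (0 : L2 d)
    rw [map_zero]
    exact map_zero (LineDeriv.lineDerivOpCLM ℂ 𝓢'(Space d, ℂ) (EuclideanSpace.single j (1 : ℝ)))
  add_mem' := by
    intro v w hv hw j
    change ∂_{EuclideanSpace.single j (1 : ℝ)}
        (Lp.toTemperedDistributionCLM ℂ volume 2 (v.fst + w.fst)) =
      Lp.toTemperedDistributionCLM ℂ volume 2 (v.snd j + w.snd j)
    rw [map_add, map_add, LineDeriv.lineDerivOp_add]
    exact congrArg₂ (· + ·) (hv j) (hw j)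
  smul_mem' := by
    intro c w hw j
    change ∂_{EuclideanSpace.single j (1 : ℝ)}
        (Lp.toTemperedDistributionCLM ℂ volume 2 (c • w.fst)) =
      Lp.toTemperedDistributionCLM ℂ volume 2 (c • w.snd j)
    rw [map_smul, map_smul, LineDeriv.lineDerivOp_smul]
    exact congrArg (c • ·) (hw j)

/-- `H¹(ℝ^d)` as a normed space. -/
abbrev H1 (d : ℕ) : Type := sobolevH1 d

namespace H1

variable {d : ℕ}

/-- The underlying `L²` function. -/
def fn (f : H1 d) : L2 d := (f : WithLp 2 (L2 d × PiLp 2 (fun _ : Fin d => L2 d))).fst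

/-- The weak partial derivative `∂_j f`. -/
def partialDeriv (f : H1 d) (j : Fin d) : L2 d :=
  (f : WithLp 2 (L2 d × PiLp 2 (fun _ : Fin d => L2 d))).snd j

theorem lineDeriv_fn (f : H1 d) (j : Fin d) :
    ∂_{EuclideanSpace.single j (1 : ℝ)} (f.fn : 𝓢'(Space d, ℂ)) =
      (f.partialDeriv j : 𝓢'(Space d, ℂ)) := f.2 j

theorem norm_sq (f : H1 d) : ‖f‖ ^ 2 = ‖f.fn‖ ^ 2 + ∑ j, ‖f.partialDeriv j‖ ^ 2 := by
  change ‖(f : WithLp 2 (L2 d × PiLp 2 (fun _ : Fin d => L2 d)))‖ ^ 2 = _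
  rw [WithLp.prod_norm_sq_eq_of_L2, PiLp.norm_sq_eq_of_L2]
  rfl

end H1

/-- The symbol of `e^{itΔ}`. With `𝓕 f (ξ) = ∫ e^{-2πi x·ξ} f(x) dx`, the Laplacian has symbol
`-4π²|ξ|²`, so `e^{itΔ}` has symbol `e^{-4π²it|ξ|²}`. -/
def symbol (d : ℕ) (t : ℝ) (ξ : Space d) : ℂ :=
  Complex.exp (((-(4 * π ^ 2 * t * ‖ξ‖ ^ 2) : ℝ) : ℂ) * Complex.I)

theorem norm_symbol (d : ℕ) (t : ℝ) (ξ : Space d) : ‖symbol d t ξ‖ = 1 :=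
  Complex.norm_exp_ofReal_mul_I _

theorem iteratedDeriv_exp_mul_I (n : ℕ) :
    iteratedDeriv n (fun x : ℝ => Complex.exp ((x : ℂ) * Complex.I)) =
      fun x : ℝ => Complex.I ^ n * Complex.exp ((x : ℂ) * Complex.I) := by
  induction n with
  | zero => simp
  | succ n ih =>
    rw [iteratedDeriv_succ, ih]
    funext x
    have h1 : HasDerivAt (fun y : ℝ => (y : ℂ) * Complex.I) Complex.I x := by
      simpa using (Complex.ofRealCLM.hasDerivAt (x := x)).mul_const Complex.I
    have h := (h1.cexp).const_mul (Complex.I ^ n)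
    rw [h.deriv]
    ring

theorem hasTemperateGrowth_exp_mul_I :
    (fun x : ℝ => Complex.exp ((x : ℂ) * Complex.I)).HasTemperateGrowth := by
  have hc : ContDiff ℝ ∞ (fun x : ℝ => Complex.exp ((x : ℂ) * Complex.I)) :=
    (Complex.ofRealCLM.contDiff.mul contDiff_const).cexp
  refine ⟨hc, fun n => ⟨0, 1, fun x => ?_⟩⟩
  rw [norm_iteratedFDeriv_eq_norm_iteratedDeriv, iteratedDeriv_exp_mul_I]
  simp [Complex.norm_exp_ofReal_mul_I]

theorem hasTemperateGrowth_symbol (d : ℕ) (t : ℝ) : (symbol d t).HasTemperateGrowth := by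
  have h : (fun ξ : Space d => -(4 * π ^ 2 * t * ‖ξ‖ ^ 2)).HasTemperateGrowth := by fun_prop
  exact hasTemperateGrowth_exp_mul_I.comp h

theorem memLp_symbol (d : ℕ) (t : ℝ) :
    MemLp (symbol d t) ∞ (volume : Measure (Space d)) :=
  memLp_top_of_bound (hasTemperateGrowth_symbol d t).1.continuous.aestronglyMeasurable 1
    (ae_of_all _ fun ξ => (norm_symbol d t ξ).le)

/-- The Schrödinger group `e^{itΔ}` on Schwartz functions. -/
def schrodingerSchwartz {d : ℕ} (t : ℝ) : 𝓢(Space d, ℂ) →L[ℂ] 𝓢(Space d, ℂ) :=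
  SchwartzMap.fourierMultiplierCLM ℂ (symbol d t)

/-- The Schrödinger group `e^{itΔ}` on `L²`. -/
def schrodingerL2 {d : ℕ} (t : ℝ) (f : L2 d) : L2 d :=
  𝓕⁻ (((memLp_symbol d t).toLp (symbol d t) • 𝓕 f : L2 d))

theorem schrodingerL2_eq {d : ℕ} (t : ℝ) (f : L2 d) :
    (schrodingerL2 t f : 𝓢'(Space d, ℂ)) =
      TemperedDistribution.fourierMultiplierCLM ℂ (symbol d t) (f : 𝓢'(Space d, ℂ)) := by
  rw [schrodingerL2, ← Lp.fourierInv_toTemperedDistribution_eq,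
    Lp.toTemperedDistribution_smul_eq (hasTemperateGrowth_symbol d t),
    ← Lp.fourier_toTemperedDistribution_eq, TemperedDistribution.fourierMultiplierCLM_apply]

theorem lineDeriv_fourierMultiplier {d : ℕ} (t : ℝ) (m : Space d) (f : 𝓢'(Space d, ℂ)) :
    ∂_{m} (TemperedDistribution.fourierMultiplierCLM ℂ (symbol d t) f) =
      TemperedDistribution.fourierMultiplierCLM ℂ (symbol d t) (∂_{m} f) := by
  have hm : (fun x : Space d => ((inner ℝ x m : ℝ) : ℂ)).HasTemperateGrowth := by fun_prop
  have hs := hasTemperateGrowth_symbol d t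
  rw [TemperedDistribution.lineDeriv_eq_fourierMultiplierCLM,
    TemperedDistribution.lineDeriv_eq_fourierMultiplierCLM, map_smul,
    TemperedDistribution.fourierMultiplierCLM_fourierMultiplierCLM_apply hs hm,
    TemperedDistribution.fourierMultiplierCLM_fourierMultiplierCLM_apply hm hs,
    mul_comm (symbol d t)]

/-- The Schrödinger group `e^{itΔ}` on `H¹`; it acts on the function and on its weak gradient. -/
def schrodingerH1 {d : ℕ} (t : ℝ) (f : H1 d) : H1 d :=
  ⟨WithLp.toLp 2 (schrodingerL2 t f.fn,
      WithLp.toLp 2 (fun j => schrodingerL2 t (f.partialDeriv j))), by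
    intro j
    change ∂_{EuclideanSpace.single j (1 : ℝ)} (schrodingerL2 t f.fn : 𝓢'(Space d, ℂ)) =
      (schrodingerL2 t (f.partialDeriv j) : 𝓢'(Space d, ℂ))
    rw [schrodingerL2_eq, schrodingerL2_eq, lineDeriv_fourierMultiplier, H1.lineDeriv_fn]⟩

/-- The nonlinearity `|z|^{4/(d-1)} z`. -/
def nonlinearity (d : ℕ) (z : ℂ) : ℂ := ((‖z‖ ^ (4 / ((d : ℝ) - 1)) : ℝ) : ℂ) * z

/-- The mass `M(f) = ∫ |f|²`. -/
def mass {d : ℕ} (f : H1 d) : ℝ := ∫ x, ‖f.fn x‖ ^ 2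

/-- The energy `E(f) = ∫ ½|∇f|² - (d-1)/(2(d+1)) |f|^{2(d+1)/(d-1)}`. -/
def energy {d : ℕ} (f : H1 d) : ℝ :=
  ∫ x, (1 / 2 * ∑ j, ‖f.partialDeriv j x‖ ^ 2
    - ((d : ℝ) - 1) / (2 * ((d : ℝ) + 1)) * ‖f.fn x‖ ^ (2 * ((d : ℝ) + 1) / ((d : ℝ) - 1)))

/-- `u ∈ C(ℝ; H¹(ℝ^d))` is a global solution of `(i∂_t + Δ)u = -|u|^{4/(d-1)} u` (with initial value
`u 0`): the Duhamel formula
`u(t) = e^{itΔ}u(0) + i ∫_0^t e^{i(t-s)Δ} (|u|^{4/(d-1)}u)(s) ds` holds for all `t`.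
For `d ≥ 4` the nonlinearity is in general not square integrable in space, so the formula is read in
the space of tempered distributions: both sides are tested against an arbitrary Schwartz function
`φ`, with `⟨e^{iτΔ}F, φ⟩ = ⟨F, e^{iτΔ}φ⟩` and `⟨F, ψ⟩ = ∫ F ψ dx`. -/
structure IsGlobalSolution {d : ℕ} (u : ℝ → H1 d) : Prop where
  continuous : Continuous u
  duhamel : ∀ (t : ℝ) (φ : 𝓢(Space d, ℂ)),
    ∫ x, (u t).fn x * φ x =
      (∫ x, (schrodingerH1 t (u 0)).fn x * φ x) +
        Complex.I * ∫ s in (0 : ℝ)..t,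
          ∫ x, nonlinearity d ((u s).fn x) * schrodingerSchwartz (t - s) φ x

/-- The space-time norm `‖u‖_{L^q_{t,x}(I × ℝ^d)}`, with values in `[0, ∞]`. -/
def spacetimeNorm {d : ℕ} (q : ℝ) (I : Set ℝ) (u : ℝ → H1 d) : ℝ≥0∞ :=
  (∫⁻ t in I, ∫⁻ x, ‖(u t).fn x‖ₑ ^ q) ^ (1 / q)

/-- `u` scatters in `H¹` forward in time. -/
def ScattersForward {d : ℕ} (u : ℝ → H1 d) : Prop :=
  ∃ uplus : H1 d, Tendsto (fun t : ℝ => ‖u t - schrodingerH1 t uplus‖) atTop (𝓝 0)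

end NLS

end

open MeasureTheory FourierTransform TemperedDistribution Filter Topology
open scoped ContDiff SchwartzMap LineDeriv ENNReal Real

noncomputable section

namespace NLS

variable {d : ℕ}

/-! The power p = 4/(d-1) makes the equation critical for the homogeneous Sobolev space of order
1/2, strictly between mass and energy. Space is always measured in L^{p+2}: the nonlinearity maps
this space to its dual, and the free flow decays there like |t|^{-d/(d+1)}. Time is measured in the
scale-invariant exponent a = 4(d+1)/(d-1) (`criticalExp`). The identity that drives everything is
p/a = 1/(d+1) = 1 - d/(d+1): the time integrability spent by Hölder on p factors in L^a is exactly
what Hardy–Littlewood–Sobolev regains from the kernel |t|^{-d/(d+1)}. Hence a Duhamel term is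
bounded in L^b_t L^{p+2} by the p-th power of the critical norm times the same L^b norm, both for b
= a and for the admissible b = 2(d+1)/d (`exists_timeNorm_sub_le`).

Small data. If the free evolution of u(t₀) has small critical norm on (t₀, ∞), a continuity argument
keeps the critical norm of u small there (`exists_bootstrap`). Strichartz and its dual then make
e^{-itΔ}u(t) Cauchy in L², with a Lipschitz bound for the difference of two solutions
(`exists_lipschitz`). The gradient is reached without differentiating the nonlinearity: a translate
of a solution is a solution, so the Lipschitz bound applied to u and its translate controls
difference quotients of the profile (`exists_profile_lipschitz`).

The criterion. It remains to find t₀ (`exists_small_linear_evolution`). With b = t₀ - T₀^{1/3}, the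
evolution of u(t₀) is that of u(0), plus the Duhamel integral over [0, b], plus the one over [b,
t₀]. The free part is small once t₀ is late. The recent part is small because the assumed space-time
norm, interpolated with Sobolev, makes the critical norm small on [b, t₀]
(`exists_timeNorm_recent_le`, `exists_timeNorm_le_spacetimeNorm`). The remote part is a difference
of two free evolutions, hence bounded in L², and decays in a higher Lebesgue norm by dispersion;
interpolating gives a negative power of T₀ (`exists_timeNorm_remote_le`).

The linear tools come from one real-interpolation principle, `lintegral_rpow_le_of_meas_lt_le`,
applied to the Riesz potential, to the Schrödinger group and to the Fourier transform. As Duhamel's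
formula is only distributional, norms of Duhamel terms are obtained by testing against Schwartz
functions. -/

/-! ### Real interpolation: from truncated weak-type bounds to strong-type bounds. -/

theorem setLIntegral_Ioc_rpow {s L : ℝ} (hs : 0 < s) (hL : 0 ≤ L) :
    ∫⁻ t in Set.Ioc 0 L, ENNReal.ofReal (t ^ (s - 1)) = ENNReal.ofReal (L ^ s / s) := by
  have hi : IntervalIntegrable (fun t : ℝ => t ^ (s - 1)) volume 0 L :=
    intervalIntegral.intervalIntegrable_rpow' (by linarith)
  have h := integral_rpow (a := 0) (b := L) (r := s - 1) (Or.inl (by linarith))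
  rw [sub_add_cancel, Real.zero_rpow hs.ne', sub_zero,
    intervalIntegral.integral_of_le hL] at h
  rw [← h, ofReal_integral_eq_lintegral_ofReal]
  · exact (intervalIntegrable_iff_integrableOn_Ioc_of_le hL).1 hi
  · filter_upwards [ae_restrict_mem measurableSet_Ioc] with t ht
    exact Real.rpow_nonneg ht.1.le _

/-- By the layer-cake formula, multiply the hypothesis by r l^{r-1}, integrate in l and apply
Tonelli. For fixed x the level runs over (0, B f(x)^e], and l^{r-m-1} is integrable at 0 because m <
r; this produces the extra power f^{e(r-m)}. -/
theorem lintegral_rpow_le_of_meas_lt_le_real {X Y : Type*} [MeasurableSpace X] [MeasurableSpace Y]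
    {μ : Measure X} [SFinite μ] {ν : Measure Y} {g : Y → ℝ} (hg : AEMeasurable g ν)
    (hg0 : ∀ y, 0 ≤ g y)
    {f : X → ℝ} (hf : Measurable f) (hf0 : ∀ x, 0 ≤ f x) {r m k e A B : ℝ} (hr : 0 < r)
    (hmr : m < r) (hk : 0 < k) (hA : 0 ≤ A) (hB : 0 < B)
    (h : ∀ l : ℝ, 0 < l → ν {y | l < g y} ≤
      ENNReal.ofReal (A * l ^ (-m)) * ∫⁻ x in {x | l ≤ B * f x ^ e}, ENNReal.ofReal (f x ^ k) ∂μ) :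
    ∫⁻ y, ENNReal.ofReal (g y ^ r) ∂ν ≤
      ENNReal.ofReal (r * A * B ^ (r - m) / (r - m)) *
        ∫⁻ x, ENNReal.ofReal (f x ^ (k + e * (r - m))) ∂μ := by
  have hset : ∀ l : ℝ, MeasurableSet {x | l ≤ B * f x ^ e} := fun l =>
    measurableSet_le measurable_const ((hf.pow_const e).const_mul B)
  rw [lintegral_rpow_eq_lintegral_meas_lt_mul ν (ae_of_all _ hg0) hg hr]
  calc ENNReal.ofReal r * ∫⁻ t in Set.Ioi 0, ν {a | t < g a} * ENNReal.ofReal (t ^ (r - 1))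
      ≤ ENNReal.ofReal r * ∫⁻ t in Set.Ioi (0 : ℝ), ∫⁻ x,
          (Set.Ioc 0 (B * f x ^ e)).indicator (fun t => ENNReal.ofReal (t ^ (r - m - 1))) t *
            ENNReal.ofReal (A * f x ^ k) ∂μ := by
        gcongr 1
        refine setLIntegral_mono' measurableSet_Ioi fun t ht => ?_
        have ht : 0 < t := ht
        calc ν {a | t < g a} * ENNReal.ofReal (t ^ (r - 1))
            ≤ (ENNReal.ofReal (A * t ^ (-m)) *
                ∫⁻ x in {x | t ≤ B * f x ^ e}, ENNReal.ofReal (f x ^ k) ∂μ) *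
                ENNReal.ofReal (t ^ (r - 1)) := by gcongr; exact h t ht
          _ = (ENNReal.ofReal (A * t ^ (-m)) * ENNReal.ofReal (t ^ (r - 1))) *
                ∫⁻ x in {x | t ≤ B * f x ^ e}, ENNReal.ofReal (f x ^ k) ∂μ := by ring
          _ = ∫⁻ x in {x | t ≤ B * f x ^ e},
                (ENNReal.ofReal (A * t ^ (-m)) * ENNReal.ofReal (t ^ (r - 1))) *
                ENNReal.ofReal (f x ^ k) ∂μ := by
              rw [lintegral_const_mul _ (hf.pow_const k).ennreal_ofReal]
          _ = _ := by
              rw [← lintegral_indicator (hset t)]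
              congr 1
              funext x
              by_cases hx : t ≤ B * f x ^ e
              · rw [Set.indicator_of_mem (show x ∈ {x | t ≤ B * f x ^ e} from hx),
                  Set.indicator_of_mem (show t ∈ Set.Ioc 0 (B * f x ^ e) from ⟨ht, hx⟩),
                  ← ENNReal.ofReal_mul (by positivity), ← ENNReal.ofReal_mul (by positivity),
                  ← ENNReal.ofReal_mul (by positivity)]
                congr 1
                have : t ^ (r - m - 1) = t ^ (-m) * t ^ (r - 1) := by
                  rw [← Real.rpow_add ht]; congr 1; ring
                rw [this]; ring
              · rw [Set.indicator_of_notMem (show x ∉ {x | t ≤ B * f x ^ e} from hx),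
                  Set.indicator_of_notMem (fun h' => hx h'.2), zero_mul]
    _ = ENNReal.ofReal r * ∫⁻ x, (∫⁻ t in Set.Ioi (0 : ℝ),
          (Set.Ioc 0 (B * f x ^ e)).indicator (fun t => ENNReal.ofReal (t ^ (r - m - 1))) t) *
            ENNReal.ofReal (A * f x ^ k) ∂μ := by
        rw [lintegral_lintegral_swap]
        · congr 2
          funext x
          rw [lintegral_mul_const]
          exact Measurable.indicator (by fun_prop) measurableSet_Ioc
        · refine Measurable.aemeasurable (Measurable.mul ?_ (by fun_prop))
          have hS : MeasurableSet {z : ℝ × X | 0 < z.1 ∧ z.1 ≤ B * f z.2 ^ e} := by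
            apply MeasurableSet.inter
            · exact measurableSet_lt measurable_const measurable_fst
            · exact measurableSet_le measurable_fst (by fun_prop)
          exact Measurable.indicator (f := fun z : ℝ × X => ENNReal.ofReal (z.1 ^ (r - m - 1)))
            (by fun_prop) hS
    _ ≤ ENNReal.ofReal r * ∫⁻ x, ENNReal.ofReal (A * B ^ (r - m) / (r - m)) *
          ENNReal.ofReal (f x ^ (k + e * (r - m))) ∂μ := by
        gcongr ENNReal.ofReal r * ?_
        refine lintegral_mono fun x => ?_
        have hfx := hf0 x
        rw [lintegral_indicator measurableSet_Ioc, Measure.restrict_restrict measurableSet_Ioc,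
          Set.inter_eq_left.2 (fun t ht => ht.1), setLIntegral_Ioc_rpow (by linarith) (by positivity)]
        have hrm : 0 < r - m := by linarith
        rw [← ENNReal.ofReal_mul (by positivity), ← ENNReal.ofReal_mul (by positivity)]
        apply ENNReal.ofReal_le_ofReal
        -- At a zero of f the factor `f x ^ k` vanishes, so the conventional value of `0 ^ e` for
        -- negative e is harmless.
        rcases hfx.eq_or_lt with h0 | h0
        · rw [← h0, Real.zero_rpow hk.ne', mul_zero, mul_zero]; positivity
        · rw [Real.mul_rpow hB.le (by positivity), ← Real.rpow_mul h0.le, Real.rpow_add h0]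
          apply le_of_eq; ring
    _ = _ := by
        rw [lintegral_const_mul _ (by fun_prop), ← mul_assoc, ← ENNReal.ofReal_mul hr.le]
        congr 2; ring

/-- A weak-type bound with a level-dependent truncation integrates to a strong-type bound. -/
theorem lintegral_rpow_le_of_meas_lt_le {X Y : Type*} [MeasurableSpace X] [MeasurableSpace Y]
    {μ : Measure X} [SFinite μ] {ν : Measure Y} {g : Y → ℝ≥0∞} (hg : AEMeasurable g ν)
    {f : X → ℝ} (hf : Measurable f) (hf0 : ∀ x, 0 ≤ f x) {r m k e A B : ℝ} (hr : 0 < r)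
    (hmr : m < r) (hk : 0 < k) (hA : 0 ≤ A) (hB : 0 < B)
    (h : ∀ l : ℝ, 0 < l → ν {y | ENNReal.ofReal l < g y} ≤
      ENNReal.ofReal (A * l ^ (-m)) * ∫⁻ x in {x | l ≤ B * f x ^ e}, ENNReal.ofReal (f x ^ k) ∂μ) :
    ∫⁻ y, g y ^ r ∂ν ≤
      ENNReal.ofReal (r * A * B ^ (r - m) / (r - m)) *
        ∫⁻ x, ENNReal.ofReal (f x ^ (k + e * (r - m))) ∂μ := by
  -- Truncation at height n makes g real-valued and only shrinks its superlevel sets, so the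
  -- hypothesis survives; monotone convergence then removes the truncation.
  have hsup : ∀ y, g y ^ r = ⨆ n : ℕ, (min (g y) n) ^ r := fun y => by
    have h1 : Tendsto (fun n : ℕ => (min (g y) n) ^ r) atTop (𝓝 (g y ^ r)) := by
      refine (ENNReal.continuous_rpow_const.tendsto _).comp ?_
      have : Tendsto (fun n : ℕ => min (g y) (n : ℝ≥0∞)) atTop (𝓝 (min (g y) ⊤)) :=
        tendsto_const_nhds.min ENNReal.tendsto_nat_nhds_top
      simpa using this
    refine tendsto_nhds_unique h1 (tendsto_atTop_iSup fun m n hmn => ?_)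
    have : (m : ℝ≥0∞) ≤ n := by exact_mod_cast hmn
    gcongr
  simp_rw [hsup]
  rw [lintegral_iSup']
  · refine iSup_le fun n => ?_
    have hne : ∀ y, min (g y) (n : ℝ≥0∞) ≠ ⊤ := fun y =>
      ((min_le_right _ _).trans_lt (ENNReal.natCast_lt_top n)).ne
    have hb := lintegral_rpow_le_of_meas_lt_le_real (ν := ν)
      (g := fun y => (min (g y) n).toReal)
      (hg.min aemeasurable_const).ennreal_toReal (fun y => ENNReal.toReal_nonneg)
      hf hf0 hr hmr hk hA hB
      (fun l hl => (measure_mono fun y hy => ?_).trans (h l hl))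
    · refine le_trans (le_of_eq ?_) hb
      congr 1; funext y
      rw [← ENNReal.ofReal_rpow_of_nonneg ENNReal.toReal_nonneg hr.le, ENNReal.ofReal_toReal (hne y)]
    · have hy : l < (min (g y) n).toReal := hy
      exact ((ENNReal.ofReal_lt_iff_lt_toReal hl.le (hne y)).2 hy).trans_le (min_le_left _ _)
  · exact fun n => (hg.min aemeasurable_const).pow_const r
  · refine ae_of_all _ fun y m n hmn => ?_
    have : (m : ℝ≥0∞) ≤ n := by exact_mod_cast hmn
    simp only; gcongr

/-! ### The Hardy–Littlewood–Sobolev inequality in one dimension. -/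

theorem lintegral_comp_abs (F : ℝ → ℝ≥0∞) :
    ∫⁻ s : ℝ, F |s| = 2 * ∫⁻ s in Set.Ioi 0, F s := by
  have h1 : ∫⁻ s in Set.Ioi (0 : ℝ), F |s| = ∫⁻ s in Set.Ioi 0, F s :=
    setLIntegral_congr_fun measurableSet_Ioi fun s hs => by rw [abs_of_pos hs]
  have h2 : ∫⁻ s in (Set.Ioi (0 : ℝ))ᶜ, F |s| = ∫⁻ s in Set.Ioi 0, F s := by
    rw [← h1, Set.compl_Ioi, ← lintegral_indicator measurableSet_Iic,
      ← lintegral_neg_eq_self, setLIntegral_congr Ioi_ae_eq_Ici,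
      ← lintegral_indicator measurableSet_Ici]
    congr 1; funext s
    by_cases hs : 0 ≤ s
    · rw [Set.indicator_of_mem (show -s ∈ Set.Iic 0 by simpa using hs),
        Set.indicator_of_mem (show s ∈ Set.Ici 0 from hs), abs_neg]
    · rw [Set.indicator_of_notMem (show -s ∉ Set.Iic 0 by simpa using hs),
        Set.indicator_of_notMem (show s ∉ Set.Ici 0 from hs)]
  rw [← lintegral_add_compl _ measurableSet_Ioi, h1, h2, two_mul]

theorem lintegral_near_kernel {δ R : ℝ} (hδ : δ < 1) (hR : 0 < R) :
    ∫⁻ s : ℝ, {s : ℝ | |s| ≤ R}.indicator (fun s => ENNReal.ofReal (|s| ^ (-δ))) s =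
      ENNReal.ofReal (2 / (1 - δ) * R ^ (1 - δ)) := by
  have h := lintegral_comp_abs (fun x => {x : ℝ | x ≤ R}.indicator
    (fun s => ENNReal.ofReal (s ^ (-δ))) x)
  have e : ∀ s : ℝ, {s : ℝ | |s| ≤ R}.indicator (fun s => ENNReal.ofReal (|s| ^ (-δ))) s =
      {x : ℝ | x ≤ R}.indicator (fun s => ENNReal.ofReal (s ^ (-δ))) |s| := fun s => by
    simp [Set.indicator_apply]
  simp_rw [e]
  have hms : MeasurableSet {x : ℝ | x ≤ R} := measurableSet_Iic
  rw [h, setLIntegral_indicator hms]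
  have : {x : ℝ | x ≤ R} ∩ Set.Ioi 0 = Set.Ioc 0 R := by ext; simp [and_comm]
  have h3 := setLIntegral_Ioc_rpow (s := 1 - δ) (L := R) (by linarith) hR.le
  rw [show 1 - δ - 1 = -δ by ring] at h3
  rw [this, h3, ← ENNReal.ofReal_ofNat 2, ← ENNReal.ofReal_mul (by norm_num)]
  congr 1; ring

theorem lintegral_far_kernel {κ R : ℝ} (hκ : 1 < κ) (hR : 0 < R) :
    ∫⁻ s : ℝ, {s : ℝ | R < |s|}.indicator (fun s => ENNReal.ofReal (|s| ^ (-κ))) s =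
      ENNReal.ofReal (2 / (κ - 1) * R ^ (1 - κ)) := by
  have h := lintegral_comp_abs (fun x => {x : ℝ | R < x}.indicator
    (fun s => ENNReal.ofReal (s ^ (-κ))) x)
  have e : ∀ s : ℝ, {s : ℝ | R < |s|}.indicator (fun s => ENNReal.ofReal (|s| ^ (-κ))) s =
      {x : ℝ | R < x}.indicator (fun s => ENNReal.ofReal (s ^ (-κ))) |s| := fun s => by
    simp [Set.indicator_apply]
  simp_rw [e]
  have hms : MeasurableSet {x : ℝ | R < x} := measurableSet_Ioi
  rw [h, setLIntegral_indicator hms]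
  have : {x : ℝ | R < x} ∩ Set.Ioi 0 = Set.Ioi R := by
    ext x; simp only [Set.mem_inter_iff, Set.mem_ofPred_eq, Set.mem_Ioi]
    constructor
    · exact fun h => h.1
    · exact fun h => ⟨h, hR.trans h⟩
  rw [this, ← ofReal_integral_eq_lintegral_ofReal (integrableOn_Ioi_rpow_of_lt (by linarith) hR),
    integral_Ioi_rpow_of_lt (by linarith) hR, ← ENNReal.ofReal_ofNat 2,
    ← ENNReal.ofReal_mul (by norm_num)]
  · congr 1
    rw [show -κ + 1 = -(κ - 1) by ring, show 1 - κ = -(κ - 1) by ring]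
    have : κ - 1 ≠ 0 := by linarith
    field_simp
  · filter_upwards [ae_restrict_mem measurableSet_Ioi] with t ht
    exact Real.rpow_nonneg (hR.le.trans (le_of_lt ht)) _

/-- The Riesz potential of order `1 - δ` on the line. -/
def rieszPot (δ : ℝ) (n : ℝ → ℝ≥0∞) (t : ℝ) : ℝ≥0∞ :=
  ∫⁻ s, ENNReal.ofReal (|t - s| ^ (-δ)) * n s

theorem measurable_rieszPot (δ : ℝ) {n : ℝ → ℝ≥0∞} (hn : Measurable n) :
    Measurable (rieszPot δ n) := by
  unfold rieszPot
  apply Measurable.lintegral_prod_right' (f := fun z : ℝ × ℝ =>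
    ENNReal.ofReal (|z.1 - z.2| ^ (-δ)) * n z.2)
  exact Measurable.mul (by fun_prop) (hn.comp measurable_snd)

/-- For each level l = 3L the kernel is cut at a radius R and f at a height α, both depending on l.
The far kernel (by Hölder) and the near kernel against the low part of f each contribute at most L,
so above level l the near kernel against the high part must be at least L. Chebyshev in L¹ then
gives the truncated weak-type bound with k = 1, e = b/a, m = a/b. -/
theorem lintegral_rieszPot_rpow_le_const {a b δ : ℝ} (hδ1 : δ < 1) (hb : 1 < b)
    (ha : 0 < a) (hab : 1 / b = 1 / a + 1 - δ) :
    ∃ C : ℝ, 0 < C ∧ ∀ f : ℝ → ℝ, Measurable f → (∀ s, 0 ≤ f s) →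
      ∫⁻ s, ENNReal.ofReal (f s ^ b) = 1 →
        ∫⁻ t, rieszPot δ (fun s => ENNReal.ofReal (f s)) t ^ a ≤ ENNReal.ofReal C := by
  set b' := b.conjExponent with hb'
  have hconj : b.HolderConjugate b' := Real.HolderConjugate.conjExponent hb
  have hb'0 : 0 < b' := hconj.symm.pos
  have hb'i : 1 / b' = 1 - 1 / b := by
    have := hconj.inv_add_inv_eq_one; simp only [one_div]; linarith
  have hδb : (1 - δ * b') / b' = -(1 / a) := by
    have : (1 - δ * b') / b' = 1 / b' - δ := by field_simp
    rw [this, hb'i, hab]; ring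
  have ha1 : 0 < 1 / a := by positivity
  -- The exponent relation gives the tail norm the negative power -1/a of R, which forces the kernel
  -- to the power b' to be integrable at infinity.
  have hδb1 : 1 < δ * b' := by
    by_contra hcon
    have : 0 ≤ (1 - δ * b') / b' := div_nonneg (by linarith) hb'0.le
    linarith
  -- c₁ R^{-1/a} is the L^{b'} norm of the kernel on |s| > R, and c₂ R^{1-δ} is its L¹ norm on |s| ≤
  -- R. D is the constant in the latter once R is expressed through L.
  set c₁ : ℝ := (2 / (δ * b' - 1)) ^ (1 / b') with hc₁
  have hc₁0 : 0 < c₁ := Real.rpow_pos_of_pos (div_pos two_pos (by linarith)) _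
  set c₂ : ℝ := 2 / (1 - δ) with hc₂
  have hc₂0 : 0 < c₂ := div_pos two_pos (by linarith)
  set D : ℝ := c₂ * c₁ ^ (a * (1 - δ)) with hD
  have hD0 : 0 < D := by positivity
  have hm : a / b = 1 + a * (1 - δ) := by
    have : a / b = a * (1 / b) := by ring
    rw [this, hab]; field_simp; ring
  have hmlt : a / b < a := by rw [div_lt_iff₀ (by linarith)]; nlinarith
  set A : ℝ := D * 3 ^ (a / b)
  set B : ℝ := 3 * D ^ (b / a)
  have hB0 : 0 < B := by positivity
  have hA0 : 0 < A := by positivity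
  refine ⟨a * A * B ^ (a - a / b) / (a - a / b),
    div_pos (by positivity) (by linarith), fun f hf hf0 hf1 => ?_⟩
  have key := lintegral_rpow_le_of_meas_lt_le (μ := volume) (ν := volume)
    (measurable_rieszPot δ hf.ennreal_ofReal).aemeasurable hf hf0 (r := a) (m := a / b) (k := 1)
    (e := b / a) (A := A) (B := B) ha hmlt one_pos hA0.le hB0 ?_
  · have he : 1 + b / a * (a - a / b) = b := by
      have : b ≠ 0 := by linarith
      field_simp; ring
    rwa [he, hf1, mul_one] at key
  intro l hl
  set L : ℝ := l / 3 with hLdef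
  have hL : 0 < L := by positivity
  -- Makes the Hölder bound of the far part exactly L, since f has unit L^b norm.
  set R : ℝ := (c₁ / L) ^ a with hRdef
  have hR : 0 < R := by positivity
  have hRa : c₁ * R ^ (-(1 / a)) = L := by
    rw [hRdef, ← Real.rpow_mul (by positivity), mul_neg, mul_one_div_cancel ha.ne',
      Real.rpow_neg_one]
    field_simp
  have hRδ : c₂ * R ^ (1 - δ) = D * L ^ (-(a * (1 - δ))) := by
    rw [hRdef, ← Real.rpow_mul (by positivity), Real.div_rpow hc₁0.le hL.le, hD,
      Real.rpow_neg hL.le]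
    ring
  -- The height at which the near kernel, against a function bounded by α, contributes exactly L.
  set α : ℝ := L / (c₂ * R ^ (1 - δ)) with hα
  have hα0 : 0 < α := by positivity
  set S : Set ℝ := {s | l ≤ B * f s ^ (b / a)} with hS
  have hSm : MeasurableSet S :=
    measurableSet_le measurable_const ((hf.pow_const _).const_mul B)
  have hSα : ∀ s, s ∉ S → f s ≤ α := by
    intro s hs
    have hs : B * f s ^ (b / a) < l := not_le.1 hs
    have h1 : (D * f s) ^ (b / a) < L := by
      rw [Real.mul_rpow hD0.le (hf0 s)]
      have : B * f s ^ (b / a) = 3 * (D ^ (b / a) * f s ^ (b / a)) := by ring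
      rw [hLdef]; linarith
    have hba : 0 < b / a := by positivity
    have h2 : D * f s < L ^ (a / b) := by
      have h3 := Real.rpow_lt_rpow (by have := hf0 s; positivity) h1
        (show 0 < a / b by positivity)
      rwa [← Real.rpow_mul (by have := hf0 s; positivity), show b / a * (a / b) = 1 by
        have : b ≠ 0 := by linarith
        field_simp, Real.rpow_one] at h3
    have h4 : α = L ^ (a / b) / D := by
      rw [hα, hRδ, hm, Real.rpow_add hL, Real.rpow_one, Real.rpow_neg hL.le]
      field_simp
    rw [h4, le_div_iff₀ hD0]; linarith
  set near : ℝ → ℝ≥0∞ := {s : ℝ | |s| ≤ R}.indicator (fun s => ENNReal.ofReal (|s| ^ (-δ)))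
    with hnear
  set far : ℝ → ℝ≥0∞ := {s : ℝ | R < |s|}.indicator (fun s => ENNReal.ofReal (|s| ^ (-δ)))
    with hfar
  have hnear_m : Measurable near :=
    Measurable.indicator (by fun_prop) (measurableSet_le (by fun_prop) measurable_const)
  have hfar_m : Measurable far :=
    Measurable.indicator (by fun_prop) (measurableSet_lt measurable_const (by fun_prop))
  set fS : ℝ → ℝ≥0∞ := S.indicator (fun s => ENNReal.ofReal (f s)) with hfS
  have hfS_m : Measurable fS := hf.ennreal_ofReal.indicator hSm
  set G : ℝ → ℝ≥0∞ := fun t => ∫⁻ s, near (t - s) * fS s with hG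
  have hG_m : Measurable G :=
    Measurable.lintegral_prod_right' (f := fun z : ℝ × ℝ => near (z.1 - z.2) * fS z.2)
      ((hnear_m.comp (measurable_fst.sub measurable_snd)).mul (hfS_m.comp measurable_snd))
  have hfarint : ∀ t, ∫⁻ s, far (t - s) * ENNReal.ofReal (f s) ≤ ENNReal.ofReal L := by
    intro t
    have hh := ENNReal.lintegral_mul_le_Lp_mul_Lq volume hconj.symm
      (f := fun s => far (t - s)) (g := fun s => ENNReal.ofReal (f s))
      (hfar_m.comp (measurable_const.sub measurable_id)).aemeasurable
      hf.ennreal_ofReal.aemeasurable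
    refine hh.trans ?_
    have e1 : ∫⁻ s, ENNReal.ofReal (f s) ^ b = 1 := by
      rw [← hf1]; congr 1; funext s
      rw [ENNReal.ofReal_rpow_of_nonneg (hf0 s) (by linarith)]
    have e2 : ∫⁻ s, far (t - s) ^ b' = ENNReal.ofReal (2 / (δ * b' - 1) * R ^ (1 - δ * b')) := by
      rw [lintegral_sub_left_eq_self (fun s => far s ^ b') t, ← lintegral_far_kernel hδb1 hR]
      congr 1; funext s
      simp only [hfar, Set.indicator_apply]
      split_ifs with hs
      · rw [ENNReal.ofReal_rpow_of_nonneg (by positivity) hb'0.le, ← Real.rpow_mul (abs_nonneg s)]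
        congr 2; ring
      · rw [ENNReal.zero_rpow_of_pos hb'0]
    rw [e1, e2, ENNReal.one_rpow, mul_one,
      ENNReal.ofReal_rpow_of_nonneg (by have : 0 < δ * b' - 1 := by linarith
                                        positivity) (by positivity)]
    apply ENNReal.ofReal_le_ofReal
    rw [Real.mul_rpow (by have : 0 < δ * b' - 1 := by linarith
                          positivity) (by positivity), ← Real.rpow_mul hR.le,
      mul_one_div, hδb, hRa]
  have hnearint : ∀ t, ∫⁻ s, near (t - s) * ENNReal.ofReal α ≤ ENNReal.ofReal L := by
    intro t
    have m2 : Measurable fun s => near (t - s) := hnear_m.comp (measurable_const.sub measurable_id)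
    rw [lintegral_mul_const _ m2,
      lintegral_sub_left_eq_self near t, hnear, lintegral_near_kernel hδ1 hR,
      ← ENNReal.ofReal_mul (by positivity)]
    apply ENNReal.ofReal_le_ofReal
    rw [hα, ← hc₂]
    exact (mul_div_cancel₀ _ (by positivity)).le
  have hsplit : ∀ t, rieszPot δ (fun s => ENNReal.ofReal (f s)) t ≤
      ENNReal.ofReal L + ENNReal.ofReal L + G t := by
    intro t
    calc rieszPot δ (fun s => ENNReal.ofReal (f s)) t
        ≤ ∫⁻ s, (far (t - s) * ENNReal.ofReal (f s) + near (t - s) * ENNReal.ofReal α) +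
            near (t - s) * fS s := by
          refine lintegral_mono fun s => ?_
          by_cases h1 : R < |t - s|
          · have : far (t - s) = ENNReal.ofReal (|t - s| ^ (-δ)) :=
              Set.indicator_of_mem (show t - s ∈ {s : ℝ | R < |s|} from h1) _
            rw [this]
            exact le_add_right (le_add_right le_rfl)
          · have : near (t - s) = ENNReal.ofReal (|t - s| ^ (-δ)) :=
              Set.indicator_of_mem (show t - s ∈ {s : ℝ | |s| ≤ R} from not_lt.1 h1) _
            rw [this]
            by_cases h2 : s ∈ S
            · rw [hfS, Set.indicator_of_mem h2]
              exact le_add_left le_rfl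
            · refine le_add_right (le_add_left ?_)
              exact mul_le_mul_right (ENNReal.ofReal_le_ofReal (hSα s h2)) _
      _ = (∫⁻ s, far (t - s) * ENNReal.ofReal (f s)) + (∫⁻ s, near (t - s) * ENNReal.ofReal α) +
            G t := by
          have m1 : Measurable fun s => far (t - s) := hfar_m.comp (measurable_const.sub measurable_id)
          have m2 : Measurable fun s => near (t - s) :=
            hnear_m.comp (measurable_const.sub measurable_id)
          have m3 : Measurable fun s => near (t - s) * fS s := m2.mul hfS_m
          rw [lintegral_add_right _ m3, lintegral_add_right _ (m2.mul_const _)]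
      _ ≤ _ := add_le_add_left (add_le_add (hfarint t) (hnearint t)) _
  have hGint : ∫⁻ t, G t = ENNReal.ofReal (c₂ * R ^ (1 - δ)) *
      ∫⁻ s in S, ENNReal.ofReal (f s) := by
    rw [hG, lintegral_lintegral_swap]
    · rw [← lintegral_indicator hSm, ← lintegral_const_mul _ hfS_m]
      congr 1; funext s
      have m2 : Measurable fun t => near (t - s) := hnear_m.comp (measurable_id.sub measurable_const)
      rw [lintegral_mul_const _ m2,
        lintegral_sub_right_eq_self near s, hnear, lintegral_near_kernel hδ1 hR]
    · exact ((hnear_m.comp (measurable_fst.sub measurable_snd)).mul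
        (hfS_m.comp measurable_snd)).aemeasurable
  calc volume {y | ENNReal.ofReal l < rieszPot δ (fun s => ENNReal.ofReal (f s)) y}
      ≤ volume {y | ENNReal.ofReal L ≤ G y} := by
        refine measure_mono fun y hy => ?_
        by_contra hcon
        have hcon : G y < ENNReal.ofReal L := not_le.1 hcon
        have h3 : rieszPot δ (fun s => ENNReal.ofReal (f s)) y < ENNReal.ofReal l := by
          refine (hsplit y).trans_lt ?_
          have : ENNReal.ofReal l = ENNReal.ofReal L + ENNReal.ofReal L + ENNReal.ofReal L := by
            rw [← ENNReal.ofReal_add hL.le hL.le, ← ENNReal.ofReal_add (by positivity) hL.le]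
            congr 1; rw [hLdef]; ring
          rw [this]
          exact ENNReal.add_lt_add_left (by simp) hcon
        exact lt_asymm h3 hy
    _ ≤ (∫⁻ t, G t) / ENNReal.ofReal L :=
        meas_ge_le_lintegral_div hG_m.aemeasurable (by simpa using hL) ENNReal.ofReal_ne_top
    _ = _ := by
        rw [hGint, ENNReal.div_eq_inv_mul, ← ENNReal.ofReal_inv_of_pos hL, ← mul_assoc,
          ← ENNReal.ofReal_mul (by positivity)]
        simp only [Real.rpow_one]
        congr 2
        rw [hRδ]
        have e1 : l ^ (-(a / b)) = 3 ^ (-(a / b)) * L ^ (-(a / b)) := by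
          rw [← Real.mul_rpow (by norm_num) hL.le]; congr 1; rw [hLdef]; ring
        rw [e1]
        have e2 : L ^ (-(a / b)) = L⁻¹ * L ^ (-(a * (1 - δ))) := by
          rw [hm, neg_add, Real.rpow_add hL, Real.rpow_neg_one]
        have e3 : (3 : ℝ) ^ (a / b) * 3 ^ (-(a / b)) = 1 := by
          rw [← Real.rpow_add (by norm_num)]; simp
        rw [e2]
        calc L⁻¹ * (D * L ^ (-(a * (1 - δ)))) = D * 1 * (L⁻¹ * L ^ (-(a * (1 - δ)))) := by ring
          _ = _ := by rw [← e3]; ring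

/-- The Hardy–Littlewood–Sobolev inequality on the line. -/
theorem lintegral_rieszPot_rpow_le {a b δ : ℝ} (hδ1 : δ < 1) (hb : 1 < b)
    (ha : 0 < a) (hab : 1 / b = 1 / a + 1 - δ) :
    ∃ C : ℝ, 0 < C ∧ ∀ n : ℝ → ℝ≥0∞, Measurable n →
      (∫⁻ t, rieszPot δ n t ^ a) ^ (1 / a) ≤ ENNReal.ofReal C * (∫⁻ s, n s ^ b) ^ (1 / b) := by
  obtain ⟨C, hC, h⟩ := lintegral_rieszPot_rpow_le_const hδ1 hb ha hab
  have hb0 : 0 < b := by linarith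
  refine ⟨C ^ (1 / a), by positivity, fun n hn => ?_⟩
  set N := ∫⁻ s, n s ^ b with hN
  rcases eq_or_ne N ⊤ with htop | htop
  · rw [htop, ENNReal.top_rpow_of_pos (by positivity), ENNReal.mul_top]
    · exact le_top
    · simp only [ne_eq, ENNReal.ofReal_eq_zero, not_le]; positivity
  rcases eq_or_ne N 0 with h0 | h0
  · have h1 : n =ᵐ[volume] 0 := by
      have := (lintegral_eq_zero_iff (hn.pow_const b)).1 (hN.symm.trans h0)
      filter_upwards [this] with s hs
      have hs : n s ^ b = 0 := hs
      exact (ENNReal.rpow_eq_zero_iff_of_pos hb0).1 hs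
    have h2 : ∀ t, rieszPot δ n t = 0 := fun t => by
      unfold rieszPot
      rw [lintegral_congr_ae (g := fun _ => 0), lintegral_zero]
      filter_upwards [h1] with s hs
      rw [hs]; simp
    simp [h2, ENNReal.zero_rpow_of_pos ha, ENNReal.zero_rpow_of_pos (inv_pos.2 ha)]
  set M := N ^ (1 / b) with hM
  have hM0 : M ≠ 0 := by
    rw [hM]; exact (ENNReal.rpow_pos (pos_iff_ne_zero.2 h0) htop).ne'
  have hMt : M ≠ ⊤ := ENNReal.rpow_ne_top_of_nonneg (by positivity) htop
  -- Normalisation to unit L^b norm. Passing to real values changes nothing off a null set, because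
  -- finiteness of N makes n finite almost everywhere.
  set f : ℝ → ℝ := fun s => (n s / M).toReal with hf
  have hfin : ∀ᵐ s, n s ≠ ⊤ := by
    have := ae_lt_top (hn.pow_const b) htop
    filter_upwards [this] with s hs h'
    rw [h', ENNReal.top_rpow_of_pos hb0] at hs
    exact lt_irrefl _ hs
  have hfe : ∀ᵐ s, ENNReal.ofReal (f s) = n s / M := by
    filter_upwards [hfin] with s hs
    exact ENNReal.ofReal_toReal (ENNReal.div_ne_top hs hM0)
  have hf1 : ∫⁻ s, ENNReal.ofReal (f s ^ b) = 1 := by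
    calc ∫⁻ s, ENNReal.ofReal (f s ^ b) = ∫⁻ s, n s ^ b * (M ^ b)⁻¹ := by
          refine lintegral_congr_ae ?_
          filter_upwards [hfe] with s hs
          rw [← ENNReal.ofReal_rpow_of_nonneg ENNReal.toReal_nonneg hb0.le, hs,
            ENNReal.div_rpow_of_nonneg _ _ hb0.le, ENNReal.div_eq_inv_mul, mul_comm]
      _ = 1 := by
          rw [lintegral_mul_const _ (hn.pow_const b), ← hN, hM, ← ENNReal.rpow_mul,
            one_div_mul_cancel hb0.ne', ENNReal.rpow_one, ENNReal.mul_inv_cancel h0 htop]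
  have hres := h f (by fun_prop) (fun s => ENNReal.toReal_nonneg) hf1
  have hpot : ∀ t, rieszPot δ n t = M * rieszPot δ (fun s => ENNReal.ofReal (f s)) t := fun t => by
    unfold rieszPot
    rw [← lintegral_const_mul _ (by fun_prop)]
    refine lintegral_congr_ae ?_
    filter_upwards [hfe] with s hs
    rw [hs, mul_left_comm, ENNReal.mul_div_cancel hM0 hMt]
  simp_rw [hpot, ENNReal.mul_rpow_of_nonneg _ _ ha.le]
  rw [lintegral_const_mul _ ((measurable_rieszPot δ (by fun_prop)).pow_const a),
    ENNReal.mul_rpow_of_nonneg _ _ (by positivity), ← ENNReal.rpow_mul,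
    mul_one_div_cancel ha.ne', ENNReal.rpow_one, mul_comm]
  gcongr
  rw [← ENNReal.ofReal_rpow_of_nonneg hC.le (by positivity)]
  gcongr

/-! ### Duality of Lebesgue norms tested on Schwartz functions. -/

theorem eLpNorm_ofReal_eq {X E : Type*} [MeasurableSpace X] [NormedAddCommGroup E] {μ : Measure X}
    {r : ℝ} (hr : 0 < r) (f : X → E) :
    eLpNorm f (ENNReal.ofReal r) μ = (∫⁻ x, ‖f x‖ₑ ^ r ∂μ) ^ (1 / r) := by
  rw [eLpNorm_eq_lintegral_rpow_enorm_toReal (by simpa using hr) ENNReal.ofReal_ne_top,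
    ENNReal.toReal_ofReal hr.le]

variable {d : ℕ}

theorem enorm_integral_mul_le_L2 {X : Type*} [MeasurableSpace X] {μ : Measure X} {f g : X → ℂ}
    (hf : AEStronglyMeasurable f μ) (hg : AEStronglyMeasurable g μ) :
    ‖∫ x, f x * g x ∂μ‖ₑ ≤ eLpNorm f 2 μ * eLpNorm g 2 μ := by
  refine (enorm_integral_le_lintegral_enorm _).trans ?_
  rw [← eLpNorm_one_eq_lintegral_enorm]
  have h : eLpNorm (f • g) 1 μ ≤ eLpNorm f 2 μ * eLpNorm g 2 μ :=
    eLpNorm_smul_le_mul_eLpNorm (p := 2) (q := 2) (r := 1) hg hf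
  exact h

/-- A smooth cutoff equal to one on a ball, as a Schwartz multiplier. -/
theorem exists_cutoff (R : ℝ) : ∃ (χ : Space d → ℂ) (R' : ℝ), χ.HasTemperateGrowth ∧
    (∀ x, ‖χ x‖ ≤ 1) ∧ (∀ x ∈ Metric.closedBall 0 R, χ x = 1) ∧
      (∀ x, x ∉ Metric.closedBall 0 R' → χ x = 0) := by
  let b : ContDiffBump (0 : Space d) := ⟨|R| + 1, |R| + 2, by positivity, by linarith⟩
  have hcs : HasCompactSupport (fun x => (b x : ℂ)) := by
    have := b.hasCompactSupport
    exact this.comp_left (g := fun r : ℝ => (r : ℂ)) Complex.ofReal_zero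
  have hsm : ContDiff ℝ ∞ (fun x => (b x : ℂ)) := Complex.ofRealCLM.contDiff.comp b.contDiff
  refine ⟨fun x => (b x : ℂ), |R| + 2, (hcs.toSchwartzMap hsm).hasTemperateGrowth, fun x => ?_,
    fun x hx => ?_, fun x hx => ?_⟩
  · rw [Complex.norm_real, Real.norm_of_nonneg b.nonneg]; exact b.le_one
  · have : x ∈ Metric.closedBall (0 : Space d) b.rIn :=
      Metric.closedBall_subset_closedBall (by change R ≤ |R| + 1; linarith [le_abs_self R]) hx
    simp [b.one_of_mem_closedBall this]
  · have : x ∉ Metric.ball (0 : Space d) b.rOut := fun h => hx (Metric.ball_subset_closedBall h)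
    rw [← b.support_eq] at this
    simpa using this

/-- One sequence must converge in both norms: L² for the pairing with an L² function, L^q for the
bound being transferred. Density gives L²; a cutoff confines the errors to a fixed ball, where the
L² norm dominates the L^q norm. -/
theorem exists_schwartz_tendsto {f : Space d → ℂ} (hf : MemLp f 2) {R : ℝ}
    (hsupp : ∀ x, x ∉ Metric.closedBall 0 R → f x = 0) {q : ℝ≥0∞} (hq : q ≤ 2) :
    ∃ φ : ℕ → 𝓢(Space d, ℂ), Tendsto (fun n => eLpNorm (fun x => φ n x - f x) 2) atTop (𝓝 0) ∧
      Tendsto (fun n => eLpNorm (fun x => φ n x - f x) q) atTop (𝓝 0) := by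
  obtain ⟨χ, R', hχ, hχ1, hχR, hχ0⟩ := exists_cutoff (d := d) R
  have hdense := SchwartzMap.denseRange_toLpCLM (E := Space d) (F := ℂ) (p := 2) (μ := volume)
    ENNReal.ofNat_ne_top
  obtain ⟨ψ, hψ⟩ : ∃ ψ : ℕ → 𝓢(Space d, ℂ),
      Tendsto (fun n => (ψ n).toLp 2 volume) atTop (𝓝 (hf.toLp f)) := by
    obtain ⟨x, hx, hx'⟩ := mem_closure_iff_seq_limit.1 (hdense (hf.toLp f))
    choose ψ hψ using hx
    have : x = fun n => (ψ n).toLp 2 volume := funext fun n => (hψ n).symm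
    exact ⟨ψ, this ▸ hx'⟩
  have hψ2 : Tendsto (fun n => eLpNorm (fun x => ψ n x - f x) 2) atTop (𝓝 0) := by
    have h := (Lp.tendsto_Lp_iff_tendsto_eLpNorm' _ _).1 hψ
    refine h.congr fun n => eLpNorm_congr_ae ?_
    filter_upwards [(ψ n).coeFn_toLp 2 volume, hf.coeFn_toLp] with x h1 h2
    simp [h1, h2]
  refine ⟨fun n => SchwartzMap.smulLeftCLM ℂ χ (ψ n), ?_⟩
  -- The cutoff equals 1 wherever f may be nonzero, so cutting off multiplies the error by χ and
  -- cannot enlarge it.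
  have hbound : ∀ n x, ‖SchwartzMap.smulLeftCLM ℂ χ (ψ n) x - f x‖ ≤ ‖ψ n x - f x‖ := by
    intro n x
    rw [SchwartzMap.smulLeftCLM_apply_apply hχ, smul_eq_mul]
    have : χ x * ψ n x - f x = χ x * (ψ n x - f x) := by
      by_cases hx : x ∈ Metric.closedBall 0 R
      · rw [hχR x hx]; ring
      · rw [hsupp x hx]; ring
    rw [this, norm_mul]
    exact mul_le_of_le_one_left (norm_nonneg _) (hχ1 x)
  have h2 : Tendsto (fun n => eLpNorm (fun x => SchwartzMap.smulLeftCLM ℂ χ (ψ n) x - f x) 2)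
      atTop (𝓝 0) :=
    tendsto_of_tendsto_of_tendsto_of_le_of_le tendsto_const_nhds hψ2 (fun _ => zero_le)
      (fun n => eLpNorm_mono (hbound n))
  refine ⟨h2, ?_⟩
  set B := Metric.closedBall (0 : Space d) (max R R') with hB
  have hzero : ∀ n x, x ∉ B → SchwartzMap.smulLeftCLM ℂ χ (ψ n) x - f x = 0 := by
    intro n x hx
    have h1 : x ∉ Metric.closedBall 0 R := fun h =>
      hx (Metric.closedBall_subset_closedBall (le_max_left _ _) h)
    have h2 : x ∉ Metric.closedBall 0 R' := fun h =>
      hx (Metric.closedBall_subset_closedBall (le_max_right _ _) h)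
    rw [SchwartzMap.smulLeftCLM_apply_apply hχ, hχ0 x h2, hsupp x h1]; simp
  have hres : ∀ n (p : ℝ≥0∞), eLpNorm (fun x => SchwartzMap.smulLeftCLM ℂ χ (ψ n) x - f x) p volume =
      eLpNorm (fun x => SchwartzMap.smulLeftCLM ℂ χ (ψ n) x - f x) p (volume.restrict B) := by
    intro n p
    rw [← eLpNorm_indicator_eq_eLpNorm_restrict measurableSet_closedBall]
    congr 1
    symm
    rw [Set.indicator_eq_self]
    intro x hx
    by_contra hcon
    exact hx (hzero n x hcon)
  set c := (volume.restrict B) Set.univ ^ (1 / q.toReal - 1 / (2 : ℝ≥0∞).toReal)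
  rcases eq_or_ne q 0 with rfl | hq0
  · simp
  have hc : c ≠ ⊤ := by
    refine ENNReal.rpow_ne_top_of_nonneg ?_ ?_
    · rw [sub_nonneg]
      apply one_div_le_one_div_of_le
      · exact ENNReal.toReal_pos hq0 (ne_top_of_le_ne_top ENNReal.ofNat_ne_top hq)
      · exact ENNReal.toReal_mono ENNReal.ofNat_ne_top hq
    · rw [Measure.restrict_apply_univ]
      exact measure_closedBall_lt_top.ne
  have h3 : Tendsto (fun n => eLpNorm (fun x => SchwartzMap.smulLeftCLM ℂ χ (ψ n) x - f x) 2 * c)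
      atTop (𝓝 0) := by
    simpa using ENNReal.Tendsto.mul_const h2 (Or.inr hc)
  refine tendsto_of_tendsto_of_tendsto_of_le_of_le tendsto_const_nhds h3 (fun _ => zero_le)
    fun n => ?_
  simp only [hres n]
  exact eLpNorm_le_eLpNorm_mul_rpow_measure_univ hq
    (((SchwartzMap.continuous _).aestronglyMeasurable).sub hf.1.restrict)

/-- A bound on the pairing with Schwartz functions extends to bounded test functions of bounded
support. -/
theorem enorm_integral_mul_le_of_schwartz {g : Space d → ℂ} (hg : MemLp g 2) {q : ℝ≥0∞}
    (hq1 : 1 ≤ q) (hq : q ≤ 2) {K : ℝ≥0∞}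
    (h : ∀ φ : 𝓢(Space d, ℂ), ‖∫ x, g x * φ x‖ₑ ≤ K * eLpNorm φ q)
    {f : Space d → ℂ} (hf : MemLp f 2) {R : ℝ}
    (hsupp : ∀ x, x ∉ Metric.closedBall 0 R → f x = 0) :
    ‖∫ x, g x * f x‖ₑ ≤ K * eLpNorm f q := by
  rcases eq_or_ne K ⊤ with rfl | hK
  · rcases eq_or_ne (eLpNorm f q) 0 with h0 | h0
    · have hz := (eLpNorm_eq_zero_iff hf.1 (by positivity)).1 h0
      rw [integral_congr_ae (g := fun _ => 0)]
      · simp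
      · filter_upwards [hz] with x hx
        simp [hx]
    · rw [ENNReal.top_mul h0]; exact le_top
  obtain ⟨φ, h2, hq'⟩ := exists_schwartz_tendsto hf hsupp hq
  have hlim : Tendsto (fun n => eLpNorm g 2 * eLpNorm (fun x => φ n x - f x) 2 +
      K * (eLpNorm (fun x => φ n x - f x) q + eLpNorm f q)) atTop
      (𝓝 (eLpNorm g 2 * 0 + K * (0 + eLpNorm f q))) :=
    (ENNReal.Tendsto.const_mul h2 (Or.inr hg.2.ne)).add
      (ENNReal.Tendsto.const_mul (hq'.add tendsto_const_nhds) (Or.inr hK))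
  rw [mul_zero, zero_add, zero_add] at hlim
  refine ge_of_tendsto' hlim fun n => ?_
  have hφ := (φ n).memLp 2 (volume : Measure (Space d))
  have e1 : ∫ x, g x * f x = (∫ x, g x * φ n x) - ∫ x, g x * (φ n x - f x) := by
    rw [← integral_sub]
    · congr 1; funext x; ring
    · exact hg.integrable_mul hφ
    · exact hg.integrable_mul (hφ.sub hf)
  rw [e1, add_comm]
  refine enorm_sub_le.trans (add_le_add ?_ ?_)
  · refine (h (φ n)).trans ?_
    gcongr
    have e2 : eLpNorm (φ n) q volume = eLpNorm ((fun x => φ n x - f x) + f) q volume :=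
      eLpNorm_congr_ae (ae_of_all _ fun x => by simp)
    have e3 : AEStronglyMeasurable (fun x => φ n x - f x) volume :=
      (φ n).continuous.aestronglyMeasurable.sub hf.1
    rw [e2]
    exact eLpNorm_add_le e3 hf.1 hq1
  · exact enorm_integral_mul_le_L2 (f := g) (g := fun x => φ n x - f x) hg.1
      ((φ n).continuous.aestronglyMeasurable.sub hf.1)


theorem enorm_integral_ofReal {X : Type*} [MeasurableSpace X] {μ : Measure X} {F : X → ℝ}
    (hF : ∀ x, 0 ≤ F x) (hi : Integrable (fun x => (F x : ℂ)) μ) :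
    ‖∫ x, (F x : ℂ) ∂μ‖ₑ = ∫⁻ x, ENNReal.ofReal (F x) ∂μ := by
  rw [integral_complex_ofReal, ← ofReal_norm, Complex.norm_real,
    Real.norm_of_nonneg (integral_nonneg hF), ofReal_integral_eq_lintegral_ofReal _ (ae_of_all _ hF)]
  exact hi.re

theorem measurableSet_truncation (g : L2 d) (n : ℕ) :
    MeasurableSet {x : Space d | ‖x‖ ≤ n ∧ ‖g x‖ ≤ n} :=
  (measurableSet_le measurable_norm measurable_const).inter
    (measurableSet_le (Lp.stronglyMeasurable g).measurable.norm measurable_const)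

theorem memLp_two_of_bounded {f : Space d → ℂ} (hf : AEStronglyMeasurable f) {M R : ℝ}
    (hM : ∀ x, ‖f x‖ ≤ M) (hsupp : ∀ x, x ∉ Metric.closedBall 0 R → f x = 0) : MemLp f 2 := by
  have h : MemLp f 2 (volume.restrict (Metric.closedBall (0 : Space d) R)) := by
    haveI : IsFiniteMeasure (volume.restrict (Metric.closedBall (0 : Space d) R)) :=
      ⟨by rw [Measure.restrict_apply_univ]; exact measure_closedBall_lt_top⟩
    exact MemLp.of_bound hf.restrict M (ae_of_all _ hM)
  rw [← memLp_indicator_iff_restrict measurableSet_closedBall] at h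
  refine h.ae_eq (ae_of_all _ fun x => ?_)
  by_cases hx : x ∈ Metric.closedBall (0 : Space d) R
  · rw [Set.indicator_of_mem hx]
  · rw [Set.indicator_of_notMem hx, hsupp x hx]

theorem rpow_le_of_le_mul_rpow {N K : ℝ≥0∞} {r r' : ℝ} (hr : r.HolderConjugate r') (hN : N ≠ ⊤)
    (h : N ≤ K * N ^ (1 / r')) : N ^ (1 / r) ≤ K := by
  rcases eq_or_ne N 0 with rfl | h0
  · simp [ENNReal.zero_rpow_of_pos (inv_pos.2 hr.pos)]
  · have h1 : N ^ (1 / r') ≠ 0 := (ENNReal.rpow_pos (pos_iff_ne_zero.2 h0) hN).ne'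
    have h2 : N ^ (1 / r') ≠ ⊤ :=
      ENNReal.rpow_ne_top_of_nonneg (one_div_nonneg.2 hr.symm.nonneg) hN
    refine (ENNReal.mul_le_mul_iff_left h1 h2).1 ?_
    rw [← ENNReal.rpow_add _ _ h0 hN]
    have : 1 / r + 1 / r' = 1 := by simpa using hr.inv_add_inv_eq_one
    rwa [this, ENNReal.rpow_one]

/-- `L^r` duality against Schwartz functions. -/
theorem eLpNorm_le_of_schwartz (g : L2 d) {r r' : ℝ} (hr : r.HolderConjugate r') (hr2 : 2 ≤ r)
    {K : ℝ≥0∞}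
    (h : ∀ φ : 𝓢(Space d, ℂ), ‖∫ x, g x * φ x‖ₑ ≤ K * eLpNorm φ (ENNReal.ofReal r')) :
    eLpNorm g (ENNReal.ofReal r) ≤ K := by
  have hr0 := hr.pos
  have hr'0 := hr.symm.pos
  have hr'1 : 1 ≤ r' := hr.symm.lt.le
  have hr'2 : r' ≤ 2 := by
    have h1 : 1 / r ≤ 1 / 2 := one_div_le_one_div_of_le two_pos hr2
    have h2 := hr.inv_add_inv_eq_one
    rw [← one_div, ← one_div] at h2
    have h3 : 1 / 2 ≤ 1 / r' := by linarith
    exact (one_div_le_one_div two_pos hr'0).1 h3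
  rw [eLpNorm_ofReal_eq hr0]
  set A : ℕ → Set (Space d) := fun n => {x | ‖x‖ ≤ n ∧ ‖g x‖ ≤ n} with hA
  have hAm : ∀ n, MeasurableSet (A n) := measurableSet_truncation g
  have hAmono : Monotone A := fun m n hmn x hx =>
    ⟨hx.1.trans (by exact_mod_cast hmn), hx.2.trans (by exact_mod_cast hmn)⟩
  have hgm := (Lp.stronglyMeasurable g)
  have key : ∀ n, ∫⁻ x in A n, ‖g x‖ₑ ^ r ≤ K ^ r := by
    intro n
    -- The extremal test function |g|^{r-2} times the conjugate of g, truncated so as to be bounded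
    -- with bounded support. Its pairing with g is N and its L^{r'} norm is N^{1/r'}.
    set f : Space d → ℂ := (A n).indicator
      (fun x => ((‖g x‖ ^ (r - 2) : ℝ) : ℂ) * (starRingEnd ℂ) (g x)) with hf
    have hfm : StronglyMeasurable f := by
      refine StronglyMeasurable.indicator (StronglyMeasurable.mul ?_ ?_) (hAm n)
      · exact (Complex.measurable_ofReal.comp
          (hgm.measurable.norm.pow_const (r - 2))).stronglyMeasurable
      · exact (Complex.continuous_conj.measurable.comp hgm.measurable).stronglyMeasurable
    have hnorm : ∀ x ∈ A n, ‖f x‖ = ‖g x‖ ^ (r - 1) := by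
      intro x hx
      rw [hf, Set.indicator_of_mem hx, norm_mul, Complex.norm_real, RCLike.norm_conj,
        Real.norm_of_nonneg (by positivity)]
      rcases (norm_nonneg (g x)).eq_or_lt with h0 | h0
      · rw [← h0, mul_zero, Real.zero_rpow (by linarith)]
      · rw [← Real.rpow_add_one h0.ne']; congr 1; ring
    have hout : ∀ x, x ∉ A n → f x = 0 := fun x hx => Set.indicator_of_notMem hx _
    have hsupp : ∀ x, x ∉ Metric.closedBall (0 : Space d) n → f x = 0 := fun x hx =>
      hout x fun h' => hx (by simpa using h'.1)
    have hf2 : MemLp f 2 := by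
      refine memLp_two_of_bounded (M := (n : ℝ) ^ (r - 1)) hfm.aestronglyMeasurable (fun x => ?_) hsupp
      by_cases hx : x ∈ A n
      · rw [hnorm x hx]; exact Real.rpow_le_rpow (norm_nonneg _) hx.2 (by linarith)
      · rw [hout x hx, norm_zero]; positivity
    have hb := enorm_integral_mul_le_of_schwartz (Lp.memLp g) (q := ENNReal.ofReal r')
      (by simpa using hr'1) (by simpa using ENNReal.ofReal_le_ofReal hr'2) h hf2 hsupp
    set N := ∫⁻ x in A n, ‖g x‖ₑ ^ r with hN
    have e1 : ‖∫ x, g x * f x‖ₑ = N := by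
      have : ∀ x, g x * f x = (((A n).indicator (fun x => ‖g x‖ ^ r) x : ℝ) : ℂ) := by
        intro x
        by_cases hx : x ∈ A n
        · rw [hf, Set.indicator_of_mem hx, Set.indicator_of_mem hx, mul_left_comm,
            Complex.mul_conj, Complex.normSq_eq_norm_sq]
          rw [← Complex.ofReal_mul]; congr 1
          rcases (norm_nonneg (g x)).eq_or_lt with h0 | h0
          · rw [← h0, Real.zero_rpow (by linarith : r ≠ 0)]; simp
          · rw [← Real.rpow_natCast, ← Real.rpow_add h0]; congr 1; push_cast; ring
        · rw [hout x hx, Set.indicator_of_notMem hx]; simp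
      have hi : Integrable (fun x => g x * f x) := (Lp.memLp g).integrable_mul hf2
      simp_rw [this] at hi ⊢
      rw [enorm_integral_ofReal (fun x => Set.indicator_nonneg (fun x _ => by positivity) x) hi,
        hN, ← lintegral_indicator (hAm n)]
      congr 1; funext x
      by_cases hx : x ∈ A n
      · rw [Set.indicator_of_mem hx, Set.indicator_of_mem hx, ← ofReal_norm,
          ENNReal.ofReal_rpow_of_nonneg (norm_nonneg _) hr0.le]
      · rw [Set.indicator_of_notMem hx, Set.indicator_of_notMem hx, ENNReal.ofReal_zero]
    have e2 : eLpNorm f (ENNReal.ofReal r') = N ^ (1 / r') := by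
      rw [eLpNorm_ofReal_eq hr'0, hN, ← lintegral_indicator (hAm n)]
      congr 2; funext x
      by_cases hx : x ∈ A n
      · rw [Set.indicator_of_mem hx, ← ofReal_norm, hnorm x hx,
          ← ENNReal.ofReal_rpow_of_nonneg (norm_nonneg _) (by linarith), ofReal_norm,
          ← ENNReal.rpow_mul, hr.sub_one_mul_conj]
      · rw [Set.indicator_of_notMem hx, hout x hx, enorm_zero, ENNReal.zero_rpow_of_pos hr'0]
    rw [e1, e2] at hb
    -- Finiteness is what permits division by N^{1/r'}; it is the reason for truncating both x and
    -- g.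
    have hNtop : N ≠ ⊤ := by
      refine ((setLIntegral_mono' (hAm n) (g := fun _ => ENNReal.ofReal ((n : ℝ) ^ r))
        fun x hx => ?_).trans_lt ?_).ne
      · rw [← ofReal_norm, ENNReal.ofReal_rpow_of_nonneg (norm_nonneg _) hr0.le]
        exact ENNReal.ofReal_le_ofReal (Real.rpow_le_rpow (norm_nonneg _) hx.2 hr0.le)
      · rw [setLIntegral_const]
        refine ENNReal.mul_lt_top ENNReal.ofReal_lt_top ?_
        refine (measure_mono (fun x hx => ?_)).trans_lt
          (measure_closedBall_lt_top (x := (0 : Space d)) (r := n))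
        simpa using hx.1
    have h3 := rpow_le_of_le_mul_rpow hr hNtop hb
    calc N = (N ^ (1 / r)) ^ r := by
          rw [← ENNReal.rpow_mul, one_div_mul_cancel hr0.ne', ENNReal.rpow_one]
      _ ≤ K ^ r := by gcongr
  have hU : ⋃ n, A n = Set.univ := by
    refine Set.eq_univ_of_forall fun x => ?_
    obtain ⟨n, hn⟩ := exists_nat_ge (max ‖x‖ ‖g x‖)
    exact Set.mem_iUnion.2 ⟨n, (le_max_left _ _).trans hn, (le_max_right _ _).trans hn⟩
  have hfin : ∫⁻ x, ‖g x‖ₑ ^ r ≤ K ^ r := by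
    rw [← setLIntegral_univ, ← hU, setLIntegral_iUnion_of_directed _ hAmono.directed_le]
    exact iSup_le key
  calc _ ≤ (K ^ r) ^ (1 / r) := by gcongr
    _ = K := by rw [← ENNReal.rpow_mul, mul_one_div_cancel hr0.ne', ENNReal.rpow_one]

/-- `L^∞` duality against Schwartz functions. -/
theorem ae_enorm_le_of_schwartz (g : L2 d) {K : ℝ≥0∞} (hK : K ≠ ⊤)
    (h : ∀ φ : 𝓢(Space d, ℂ), ‖∫ x, g x * φ x‖ₑ ≤ K * eLpNorm φ 1) :
    ∀ᵐ x, ‖g x‖ₑ ≤ K := by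
  have hgm := (Lp.stronglyMeasurable g)
  set A : ℕ → Set (Space d) := fun n => {x | ‖x‖ ≤ n ∧ K < ‖g x‖ₑ} with hA
  have hAm : ∀ n, MeasurableSet (A n) := fun n =>
    (measurableSet_le measurable_norm measurable_const).inter
      (measurableSet_lt measurable_const hgm.measurable.enorm)
  have hnull : ∀ n, volume (A n) = 0 := by
    intro n
    -- The unimodular conjugate phase of g on the set where g exceeds K: its pairing with g is the
    -- integral of |g| there, its L¹ norm the measure of the set.
    set f : Space d → ℂ := (A n).indicator
      (fun x => ((‖g x‖⁻¹ : ℝ) : ℂ) * (starRingEnd ℂ) (g x)) with hf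
    have hfm : StronglyMeasurable f := by
      refine StronglyMeasurable.indicator (StronglyMeasurable.mul ?_ ?_) (hAm n)
      · exact (Complex.measurable_ofReal.comp hgm.measurable.norm.inv).stronglyMeasurable
      · exact (Complex.continuous_conj.measurable.comp hgm.measurable).stronglyMeasurable
    have hg0 : ∀ x ∈ A n, ‖g x‖ ≠ 0 := fun x hx h0 => by
      have : ‖g x‖ₑ = 0 := by rw [← ofReal_norm, h0]; simp
      exact not_lt_zero (this ▸ hx.2)
    have hnorm : ∀ x ∈ A n, ‖f x‖ = 1 := by
      intro x hx
      rw [hf, Set.indicator_of_mem hx, norm_mul, Complex.norm_real, RCLike.norm_conj,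
        Real.norm_of_nonneg (by positivity), inv_mul_cancel₀ (hg0 x hx)]
    have hout : ∀ x, x ∉ A n → f x = 0 := fun x hx => Set.indicator_of_notMem hx _
    have hsupp : ∀ x, x ∉ Metric.closedBall (0 : Space d) n → f x = 0 := fun x hx =>
      hout x fun h' => hx (by simpa using h'.1)
    have hf2 : MemLp f 2 := by
      refine memLp_two_of_bounded (M := 1) hfm.aestronglyMeasurable (fun x => ?_) hsupp
      by_cases hx : x ∈ A n
      · rw [hnorm x hx]
      · rw [hout x hx, norm_zero]; positivity
    have hb := enorm_integral_mul_le_of_schwartz (Lp.memLp g) (q := 1)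
      le_rfl (by norm_num) h hf2 hsupp
    have hvol : volume (A n) ≠ ⊤ := by
      refine ((measure_mono (fun x hx => ?_)).trans_lt
          (measure_closedBall_lt_top (x := (0 : Space d)) (r := n))).ne
      simpa using hx.1
    have e1 : ‖∫ x, g x * f x‖ₑ = ∫⁻ x in A n, ‖g x‖ₑ := by
      have : ∀ x, g x * f x = (((A n).indicator (fun x => ‖g x‖) x : ℝ) : ℂ) := by
        intro x
        by_cases hx : x ∈ A n
        · rw [hf, Set.indicator_of_mem hx, Set.indicator_of_mem hx, mul_left_comm,
            Complex.mul_conj, Complex.normSq_eq_norm_sq, ← Complex.ofReal_mul]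
          congr 1
          rw [sq, inv_mul_cancel_left₀ (hg0 x hx)]
        · rw [hout x hx, Set.indicator_of_notMem hx]; simp
      have hi : Integrable (fun x => g x * f x) := (Lp.memLp g).integrable_mul hf2
      simp_rw [this] at hi ⊢
      rw [enorm_integral_ofReal (fun x => Set.indicator_nonneg (fun x _ => by positivity) x) hi,
        ← lintegral_indicator (hAm n)]
      congr 1; funext x
      by_cases hx : x ∈ A n
      · rw [Set.indicator_of_mem hx, Set.indicator_of_mem hx, ofReal_norm]
      · rw [Set.indicator_of_notMem hx, Set.indicator_of_notMem hx, ENNReal.ofReal_zero]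
    have e2 : eLpNorm f 1 = volume (A n) := by
      rw [eLpNorm_one_eq_lintegral_enorm, ← setLIntegral_one, ← lintegral_indicator (hAm n)]
      congr 1; funext x
      by_cases hx : x ∈ A n
      · rw [Set.indicator_of_mem hx, ← ofReal_norm, hnorm x hx, ENNReal.ofReal_one]
      · rw [Set.indicator_of_notMem hx, hout x hx, enorm_zero]
    rw [e1, e2] at hb
    -- The bound K·|A n| is at least the integral of |g| over A n, although |g| > K at every point
    -- of it; so the set is null.
    have h3 : ∫⁻ x in A n, (‖g x‖ₑ - K) = 0 := by
      rw [lintegral_sub measurable_const, setLIntegral_const]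
      · exact tsub_eq_zero_of_le hb
      · rw [setLIntegral_const]; exact ENNReal.mul_ne_top hK hvol
      · filter_upwards [ae_restrict_mem (hAm n)] with x hx using hx.2.le
    have hm : Measurable fun x => ‖g x‖ₑ - K := hgm.measurable.enorm.sub measurable_const
    rw [lintegral_eq_zero_iff hm, Filter.EventuallyEq, ae_restrict_iff' (hAm n)] at h3
    rw [measure_eq_zero_iff_ae_notMem]
    filter_upwards [h3] with x hx hxA
    have := hx hxA
    simp only [Pi.zero_apply, tsub_eq_zero_iff_le] at this
    exact absurd hxA.2 (not_lt.2 this)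
  have hall : ∀ᵐ x : Space d, ∀ n, x ∉ A n :=
    ae_all_iff.2 fun n => measure_eq_zero_iff_ae_notMem.1 (hnull n)
  filter_upwards [hall] with x hx
  by_contra hcon
  obtain ⟨n, hn⟩ := exists_nat_ge ‖x‖
  exact hx n ⟨hn, not_le.1 hcon⟩

/-! ### Interpolation between L² → L² and L¹ → L^∞. -/

/-- The L¹ → L^∞ bound is known for the transpose on Schwartz functions only. Pairing T f with φ and
moving T across bounds the result by the L¹ norms of f and φ; duality in L^∞ does the rest. -/
theorem ae_enorm_le_of_transpose {d : ℕ} {T : L2 d → L2 d} {T' : 𝓢(Space d, ℂ) → 𝓢(Space d, ℂ)}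
    {K : ℝ} (htr : ∀ (f : L2 d) (φ : 𝓢(Space d, ℂ)), ∫ x, T f x * φ x = ∫ x, f x * T' φ x)
    (hT' : ∀ (φ : 𝓢(Space d, ℂ)) (x : Space d), ‖T' φ x‖ₑ ≤ ENNReal.ofReal K * eLpNorm φ 1)
    (f : L2 d) (hf : eLpNorm f 1 ≠ ⊤) :
    ∀ᵐ x, ‖T f x‖ₑ ≤ ENNReal.ofReal K * eLpNorm f 1 := by
  refine ae_enorm_le_of_schwartz (T f) (ENNReal.mul_ne_top ENNReal.ofReal_ne_top hf) fun φ => ?_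
  rw [htr]
  refine (enorm_integral_le_lintegral_enorm _).trans ?_
  calc ∫⁻ x, ‖f x * T' φ x‖ₑ ≤ ∫⁻ x, ‖f x‖ₑ * (ENNReal.ofReal K * eLpNorm φ 1) := by
        refine lintegral_mono fun x => ?_
        rw [enorm_mul]
        gcongr
        exact hT' φ x
    _ = _ := by
        rw [lintegral_mul_const _ (Lp.stronglyMeasurable f).measurable.enorm,
          eLpNorm_one_eq_lintegral_enorm (f := f)]
        ring

theorem enorm_toLp_sq {d : ℕ} {f : Space d → ℂ} (hf : MemLp f 2) :
    ENNReal.ofReal (‖hf.toLp f‖ ^ 2) = ∫⁻ x, ‖f x‖ₑ ^ (2 : ℝ) := by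
  rw [ENNReal.ofReal_pow (norm_nonneg _), ofReal_norm, Lp.enorm_toLp,
    eLpNorm_eq_lintegral_rpow_enorm_toReal two_ne_zero ENNReal.ofNat_ne_top, ENNReal.toReal_ofNat,
    ← ENNReal.rpow_natCast, ← ENNReal.rpow_mul]
  norm_num

/-- Interpolation between the `L²` bound and the `L¹ → L^∞` bound of an operator. -/
theorem eLpNorm_le_of_transpose {r r' : ℝ} (hr : r.HolderConjugate r') (hr2 : 2 < r) :
    ∃ C : ℝ, 0 < C ∧ ∀ {d : ℕ} {T : L2 d → L2 d} {T' : 𝓢(Space d, ℂ) → 𝓢(Space d, ℂ)} {K : ℝ},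
      0 < K → (∀ f g, T (f + g) = T f + T g) → (∀ f, ‖T f‖ ≤ ‖f‖) →
      (∀ (f : L2 d) (φ : 𝓢(Space d, ℂ)), ∫ x, T f x * φ x = ∫ x, f x * T' φ x) →
      (∀ (φ : 𝓢(Space d, ℂ)) (x : Space d), ‖T' φ x‖ₑ ≤ ENNReal.ofReal K * eLpNorm φ 1) →
      ∀ f : L2 d, eLpNorm (T f) (ENNReal.ofReal r) ≤
        ENNReal.ofReal (C * K ^ (1 - 2 / r)) * eLpNorm f (ENNReal.ofReal r') := by
  have hr0 := hr.pos
  have hr'0 := hr.symm.pos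
  have hr'1 := hr.symm.lt
  have hr20 : 0 < r - 2 := by linarith
  set C₀ : ℝ := r * 4 * 2 ^ (r - 2) / (r - 2) with hC₀
  have hC₀0 : 0 < C₀ := by positivity
  refine ⟨C₀ ^ (1 / r), by positivity, ?_⟩
  intro d T T' K hK hadd hnorm htr hT' f
  have hfm := (Lp.stronglyMeasurable f).measurable
  rw [eLpNorm_ofReal_eq hr0, eLpNorm_ofReal_eq hr'0]
  set N := ∫⁻ x, ‖f x‖ₑ ^ r' with hN
  rcases eq_or_ne N ⊤ with htop | htop
  · rw [htop, ENNReal.top_rpow_of_pos (by positivity), ENNReal.mul_top]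
    · exact le_top
    · simp only [ne_eq, ENNReal.ofReal_eq_zero, not_le]; positivity
  rcases eq_or_ne N 0 with h0 | h0
  · have h1 : f = 0 := by
      rw [Lp.eq_zero_iff_ae_eq_zero]
      have := (lintegral_eq_zero_iff (hfm.enorm.pow_const r')).1 (hN.symm.trans h0)
      filter_upwards [this] with s hs
      have hs : ‖f s‖ₑ ^ r' = 0 := hs
      simpa using (ENNReal.rpow_eq_zero_iff_of_pos hr'0).1 hs
    have h2 : T f = 0 := by
      have := hnorm f
      rw [h1, norm_zero] at this
      rw [h1]; exact norm_le_zero_iff.1 this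
    rw [h2]
    have : ∫⁻ x, ‖(0 : L2 d) x‖ₑ ^ r = 0 := by
      rw [lintegral_congr_ae (g := fun _ => 0), lintegral_zero]
      filter_upwards [Lp.coeFn_zero ℂ 2 (volume : Measure (Space d))] with x hx
      rw [hx]; simp [hr0]
    rw [this, ENNReal.zero_rpow_of_pos (by positivity)]
    exact zero_le
  set Nr := N.toReal with hNr
  have hNr0 : 0 < Nr := ENNReal.toReal_pos h0 htop
  have hNofReal : ENNReal.ofReal Nr = N := ENNReal.ofReal_toReal htop
  -- With this B, the part of f off S has L¹ norm at most (l/B) N, so its image is bounded by K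
  -- (l/B) N = l/2.
  set B : ℝ := 2 * K * Nr with hB
  have hB0 : 0 < B := by positivity
  -- The exponent is negative: for nonzero values, l ≤ B|f|^e selects the small ones. Thus S carries
  -- the part treated in L² and its complement the part treated in L¹.
  set e : ℝ := 1 - r' with he
  have hexp : 2 + e * (r - 2) = r' := by
    have := hr.sub_one_mul_conj
    have h2 := hr.mul_eq_add
    rw [he]; nlinarith
  have key := lintegral_rpow_le_of_meas_lt_le (μ := volume) (ν := volume)
    (g := fun x => ‖T f x‖ₑ) (f := fun x => ‖f x‖)
    (Lp.stronglyMeasurable (T f)).measurable.enorm.aemeasurable hfm.norm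
    (fun x => norm_nonneg _) (r := r) (m := 2) (k := 2) (e := e) (A := 4) (B := B) hr0 hr2
    two_pos (by norm_num) hB0 ?_
  · rw [hexp] at key
    have e1 : ∫⁻ x, ENNReal.ofReal (‖f x‖ ^ r') = N := by
      rw [hN]; congr 1; funext x
      rw [← ENNReal.ofReal_rpow_of_nonneg (norm_nonneg _) hr'0.le, ofReal_norm]
    rw [e1] at key
    have e2 : ENNReal.ofReal (r * 4 * B ^ (r - 2) / (r - 2)) * N =
        (ENNReal.ofReal (C₀ ^ (1 / r) * K ^ (1 - 2 / r)) * N ^ (1 / r')) ^ r := by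
      rw [ENNReal.mul_rpow_of_nonneg _ _ hr0.le, ← ENNReal.rpow_mul,
        ENNReal.ofReal_rpow_of_nonneg (by positivity) hr0.le, ← hNofReal,
        ENNReal.ofReal_rpow_of_pos hNr0, ← ENNReal.ofReal_mul (by positivity),
        ← ENNReal.ofReal_mul (by positivity)]
      congr 1
      rw [Real.mul_rpow (x := C₀ ^ (1 / r)) (by positivity) (by positivity),
        ← Real.rpow_mul hC₀0.le, ← Real.rpow_mul hK.le, one_div_mul_cancel hr0.ne', Real.rpow_one, hB,
        Real.mul_rpow (by positivity) hNr0.le, Real.mul_rpow (by norm_num) hK.le]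
      have x1 : (1 - 2 / r) * r = r - 2 := by field_simp
      have x2 : 1 / r' * r = r - 2 + 1 := by
        have h1 := hr.inv_add_inv_eq_one
        have h2 : 1 / r' = 1 - r⁻¹ := by rw [one_div]; linarith
        rw [h2, sub_mul, inv_mul_cancel₀ hr0.ne']; ring
      rw [x1, x2, Real.rpow_add_one hNr0.ne', hC₀]
      ring
    rw [e2] at key
    calc (∫⁻ x, ‖T f x‖ₑ ^ r) ^ (1 / r) ≤
        ((ENNReal.ofReal (C₀ ^ (1 / r) * K ^ (1 - 2 / r)) * N ^ (1 / r')) ^ r) ^ (1 / r) := by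
          gcongr
      _ = _ := by rw [← ENNReal.rpow_mul, mul_one_div_cancel hr0.ne', ENNReal.rpow_one]
  intro l hl
  set S : Set (Space d) := {x | l ≤ B * ‖f x‖ ^ e} with hS
  have hSm : MeasurableSet S :=
    measurableSet_le measurable_const ((hfm.norm.pow_const e).const_mul B)
  have hf1 : MemLp (Sᶜ.indicator f) 2 := (Lp.memLp f).indicator hSm.compl
  have hf2 : MemLp (S.indicator f) 2 := (Lp.memLp f).indicator hSm
  have hsum : f = hf1.toLp _ + hf2.toLp _ := by
    ext1
    filter_upwards [hf1.coeFn_toLp, hf2.coeFn_toLp, Lp.coeFn_add (hf1.toLp _) (hf2.toLp _)]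
      with x h1 h2 h3
    rw [h3, Pi.add_apply, h1, h2]
    by_cases hx : x ∈ S <;> simp [hx]
  have hL1 : eLpNorm (hf1.toLp _) 1 ≤ ENNReal.ofReal (l / B * Nr) := by
    rw [eLpNorm_congr_ae hf1.coeFn_toLp, eLpNorm_one_eq_lintegral_enorm,
      ENNReal.ofReal_mul (by positivity), hNofReal, hN,
      ← lintegral_const_mul _ (hfm.enorm.pow_const r')]
    refine lintegral_mono fun x => ?_
    by_cases hx : x ∈ S
    · rw [Set.indicator_of_notMem (by simpa using hx), enorm_zero]; exact zero_le
    · rw [Set.indicator_of_mem (by simpa using hx), ← ofReal_norm,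
        ENNReal.ofReal_rpow_of_nonneg (norm_nonneg _) hr'0.le, ← ENNReal.ofReal_mul (by positivity)]
      apply ENNReal.ofReal_le_ofReal
      rcases (norm_nonneg (f x)).eq_or_lt with h0 | h0
      · rw [← h0]; positivity
      · have hx' : B * ‖f x‖ ^ e < l := not_le.1 hx
        have h4 : ‖f x‖ = ‖f x‖ ^ r' * ‖f x‖ ^ e := by
          rw [← Real.rpow_add h0, he]; simp
        have h5 : ‖f x‖ ^ e ≤ l / B := by
          rw [le_div_iff₀ hB0]; linarith
        calc ‖f x‖ = ‖f x‖ ^ r' * ‖f x‖ ^ e := h4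
          _ ≤ ‖f x‖ ^ r' * (l / B) := by gcongr
          _ = _ := by ring
  have hLinf := ae_enorm_le_of_transpose htr hT' (hf1.toLp _)
    (ne_top_of_le_ne_top ENNReal.ofReal_ne_top hL1)
  have hbd : ∀ᵐ x, ‖T (hf1.toLp _) x‖ₑ ≤ ENNReal.ofReal (l / 2) := by
    filter_upwards [hLinf] with x hx
    refine hx.trans ((mul_le_mul_right hL1 _).trans ?_)
    rw [← ENNReal.ofReal_mul hK.le]
    apply ENNReal.ofReal_le_ofReal
    rw [hB]; apply le_of_eq; field_simp
  have hsplit : ∀ᵐ x, ‖T f x‖ₑ ≤ ENNReal.ofReal (l / 2) + ‖T (hf2.toLp _) x‖ₑ := by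
    have : T f = T (hf1.toLp _) + T (hf2.toLp _) := by
      conv_lhs => rw [hsum]
      rw [hadd]
    rw [this]
    filter_upwards [hbd, Lp.coeFn_add (T (hf1.toLp _)) (T (hf2.toLp _))] with x h1 h2
    rw [h2]
    exact (enorm_add_le _ _).trans (add_le_add_left h1 _)
  have hmeas : Measurable fun x => ‖T (hf2.toLp _) x‖ₑ ^ (2 : ℝ) :=
    (Lp.stronglyMeasurable (T (hf2.toLp _))).measurable.enorm.pow_const _
  calc volume {y | ENNReal.ofReal l < ‖T f y‖ₑ}
      ≤ volume {y | ENNReal.ofReal ((l / 2) ^ 2) ≤ ‖T (hf2.toLp _) y‖ₑ ^ (2 : ℝ)} := by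
        refine measure_mono_ae ?_
        filter_upwards [hsplit] with y hy hy'
        have hy' : ENNReal.ofReal l < ‖T f y‖ₑ := hy'
        have h1 : ENNReal.ofReal (l / 2) ≤ ‖T (hf2.toLp _) y‖ₑ := by
          by_contra hcon
          have h2 := ENNReal.add_lt_add_left (a := ENNReal.ofReal (l / 2)) (by simp) (not_le.1 hcon)
          rw [← ENNReal.ofReal_add (by positivity) (by positivity), add_halves] at h2
          exact absurd (hy.trans_lt h2) (not_lt.2 hy'.le)
        change ENNReal.ofReal ((l / 2) ^ 2) ≤ ‖T (hf2.toLp _) y‖ₑ ^ (2 : ℝ)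
        rw [ENNReal.ofReal_pow (by positivity), ← ENNReal.rpow_natCast]
        exact ENNReal.rpow_le_rpow h1 (by norm_num)
    _ ≤ (∫⁻ y, ‖T (hf2.toLp _) y‖ₑ ^ (2 : ℝ)) / ENNReal.ofReal ((l / 2) ^ 2) :=
        meas_ge_le_lintegral_div hmeas.aemeasurable (by simp; positivity) ENNReal.ofReal_ne_top
    _ ≤ (∫⁻ x in S, ENNReal.ofReal (‖f x‖ ^ (2 : ℝ))) / ENNReal.ofReal ((l / 2) ^ 2) := by
        refine ENNReal.div_le_div_right ?_ _
        have h1 := enorm_toLp_sq (Lp.memLp (T (hf2.toLp _)))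
        rw [Lp.toLp_coeFn] at h1
        have h2 := enorm_toLp_sq hf2
        rw [← h1]
        refine (ENNReal.ofReal_le_ofReal (pow_le_pow_left₀ (norm_nonneg _) (hnorm _) 2)).trans ?_
        rw [h2, ← lintegral_indicator hSm]
        refine lintegral_mono fun x => ?_
        by_cases hx : x ∈ S
        · rw [Set.indicator_of_mem hx, Set.indicator_of_mem hx, ← ofReal_norm,
            ENNReal.ofReal_rpow_of_nonneg (norm_nonneg _) (by norm_num)]
        · rw [Set.indicator_of_notMem hx, Set.indicator_of_notMem hx]; simp
    _ = _ := by
        rw [ENNReal.div_eq_inv_mul, ← ENNReal.ofReal_inv_of_pos (by positivity)]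
        congr 2
        rw [Real.rpow_neg hl.le, Real.rpow_two]
        field_simp; norm_num


/-! ### Fourier multipliers and the Schrödinger group on L². -/

theorem fourier_injective_ae {f g : L2 d}
    (h : (𝓕 f : L2 d) =ᵐ[volume] (𝓕 g : L2 d)) : f = g := by
  have h1 : (𝓕 f : L2 d) = 𝓕 g := Lp.ext h
  have h2 := congrArg (fun F : L2 d => (𝓕⁻ F : L2 d)) h1
  simpa using h2

/-- The Fourier multiplier on `L²` with a bounded symbol. -/
def multiplierL2 {m : Space d → ℂ} (hm : MemLp m ∞ (volume : Measure (Space d))) (f : L2 d) : L2 d :=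
  𝓕⁻ ((hm.toLp m • 𝓕 f : L2 d))

theorem fourier_multiplierL2 {m : Space d → ℂ} (hm : MemLp m ∞ (volume : Measure (Space d)))
    (f : L2 d) : (𝓕 (multiplierL2 hm f) : L2 d) =ᵐ[volume] fun ξ => m ξ * (𝓕 f : L2 d) ξ := by
  rw [multiplierL2, FourierTransform.fourier_fourierInv_eq]
  filter_upwards [Lp.coeFn_lpSMul (r := 2) (hm.toLp m) (𝓕 f : L2 d), hm.coeFn_toLp] with ξ h1 h2
  rw [h1, Pi.smul_apply', h2, smul_eq_mul]

theorem multiplierL2_add {m : Space d → ℂ} (hm : MemLp m ∞ (volume : Measure (Space d)))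
    (f g : L2 d) : multiplierL2 hm (f + g) = multiplierL2 hm f + multiplierL2 hm g := by
  apply fourier_injective_ae
  rw [FourierTransform.fourier_add]
  filter_upwards [fourier_multiplierL2 hm (f + g), fourier_multiplierL2 hm f,
    fourier_multiplierL2 hm g, Lp.coeFn_add (𝓕 (multiplierL2 hm f)) (𝓕 (multiplierL2 hm g)),
    Lp.coeFn_add (𝓕 f : L2 d) (𝓕 g)] with ξ h1 h2 h3 h4 h5
  rw [h1, h4, Pi.add_apply, h2, h3, FourierTransform.fourier_add, h5, Pi.add_apply, mul_add]

theorem multiplierL2_smul {m : Space d → ℂ} (hm : MemLp m ∞ (volume : Measure (Space d)))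
    (c : ℂ) (f : L2 d) : multiplierL2 hm (c • f) = c • multiplierL2 hm f := by
  apply fourier_injective_ae
  rw [FourierTransform.fourier_smul]
  filter_upwards [fourier_multiplierL2 hm (c • f), fourier_multiplierL2 hm f,
    Lp.coeFn_smul c (𝓕 (multiplierL2 hm f)), Lp.coeFn_smul c (𝓕 f : L2 d)] with ξ h1 h2 h4 h5
  rw [h1, h4, Pi.smul_apply, h2, FourierTransform.fourier_smul, h5, Pi.smul_apply, smul_eq_mul,
    smul_eq_mul]
  ring

theorem norm_multiplierL2 {m : Space d → ℂ} (hm : MemLp m ∞ (volume : Measure (Space d)))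
    (h1 : ∀ ξ, ‖m ξ‖ = 1) (f : L2 d) : ‖multiplierL2 hm f‖ = ‖f‖ := by
  rw [← Lp.norm_fourier_eq, ← Lp.norm_fourier_eq f, Lp.norm_def, Lp.norm_def]
  congr 1
  refine eLpNorm_congr_norm_ae ?_
  filter_upwards [fourier_multiplierL2 hm f] with ξ h
  rw [h, norm_mul, h1, one_mul]

theorem multiplierL2_multiplierL2 {m₁ m₂ m₃ : Space d → ℂ}
    (hm₁ : MemLp m₁ ∞ (volume : Measure (Space d)))
    (hm₂ : MemLp m₂ ∞ (volume : Measure (Space d))) (hm₃ : MemLp m₃ ∞ (volume : Measure (Space d)))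
    (h : ∀ ξ, m₃ ξ = m₁ ξ * m₂ ξ) (f : L2 d) :
    multiplierL2 hm₁ (multiplierL2 hm₂ f) = multiplierL2 hm₃ f := by
  apply fourier_injective_ae
  filter_upwards [fourier_multiplierL2 hm₁ (multiplierL2 hm₂ f), fourier_multiplierL2 hm₂ f,
    fourier_multiplierL2 hm₃ f] with ξ h1 h2 h3
  rw [h1, h2, h3, h, mul_assoc]

theorem schrodingerL2_eq_multiplierL2 (t : ℝ) (f : L2 d) :
    schrodingerL2 t f = multiplierL2 (memLp_symbol d t) f := rfl

theorem symbol_add (s t : ℝ) (ξ : Space d) : symbol d (s + t) ξ = symbol d s ξ * symbol d t ξ := by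
  rw [symbol, symbol, symbol, ← Complex.exp_add]
  congr 1; push_cast; ring

theorem symbol_zero (ξ : Space d) : symbol d 0 ξ = 1 := by simp [symbol]

theorem symbol_neg_arg (t : ℝ) (ξ : Space d) : symbol d t (-ξ) = symbol d t ξ := by simp [symbol]

/-- The Schrödinger group as a linear isometry of `L²`. -/
def schrodingerLI (t : ℝ) : L2 d →ₗᵢ[ℂ] L2 d where
  toFun := schrodingerL2 t
  map_add' := multiplierL2_add _
  map_smul' := multiplierL2_smul _
  norm_map' := norm_multiplierL2 _ (norm_symbol d t)

theorem schrodingerLI_apply (t : ℝ) (f : L2 d) : schrodingerLI t f = schrodingerL2 t f := rfl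

theorem schrodingerL2_schrodingerL2 (s t : ℝ) (f : L2 d) :
    schrodingerL2 s (schrodingerL2 t f) = schrodingerL2 (s + t) f :=
  multiplierL2_multiplierL2 _ _ _ (symbol_add s t) f

theorem schrodingerL2_zero (f : L2 d) : schrodingerL2 0 f = f := by
  apply fourier_injective_ae
  filter_upwards [fourier_multiplierL2 (memLp_symbol d 0) f] with ξ h
  rw [schrodingerL2_eq_multiplierL2, h, symbol_zero, one_mul]

theorem norm_schrodingerL2 (t : ℝ) (f : L2 d) : ‖schrodingerL2 t f‖ = ‖f‖ :=
  (schrodingerLI t).norm_map f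

theorem schrodingerL2_sub (t : ℝ) (f g : L2 d) :
    schrodingerL2 t (f - g) = schrodingerL2 t f - schrodingerL2 t g := (schrodingerLI t).map_sub f g

theorem inner_schrodingerL2 (t : ℝ) (f g : L2 d) :
    inner ℂ (schrodingerL2 t f) g = inner ℂ f (schrodingerL2 (-t) g) := by
  have h := (schrodingerLI t).inner_map_map f (schrodingerL2 (-t) g)
  rw [← h, schrodingerLI_apply, schrodingerLI_apply, schrodingerL2_schrodingerL2, add_neg_cancel,
    schrodingerL2_zero]

theorem continuous_symbol_time (ξ : Space d) : Continuous fun t => symbol d t ξ := by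
  unfold symbol; fun_prop

theorem norm_sq_eq_lintegral (f : L2 d) : ENNReal.ofReal (‖f‖ ^ 2) = ∫⁻ x, ‖f x‖ₑ ^ (2 : ℝ) := by
  have := enorm_toLp_sq (Lp.memLp f)
  rwa [Lp.toLp_coeFn] at this

theorem continuous_schrodingerL2_time (f : L2 d) : Continuous fun t => schrodingerL2 t f := by
  rw [continuous_iff_continuousAt]
  intro t₀
  rw [ContinuousAt, tendsto_iff_norm_sub_tendsto_zero]
  have hsq : Tendsto (fun t => ENNReal.ofReal (‖schrodingerL2 t f - schrodingerL2 t₀ f‖ ^ 2))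
      (𝓝 t₀) (𝓝 0) := by
    have e : ∀ t, ENNReal.ofReal (‖schrodingerL2 t f - schrodingerL2 t₀ f‖ ^ 2) =
        ∫⁻ ξ, ‖(symbol d t ξ - symbol d t₀ ξ) * (𝓕 f : L2 d) ξ‖ₑ ^ (2 : ℝ) := by
      intro t
      rw [← Lp.norm_fourier_eq, norm_sq_eq_lintegral]
      refine lintegral_congr_ae ?_
      have hs : (𝓕 (schrodingerL2 t f - schrodingerL2 t₀ f) : L2 d) =
          𝓕 (schrodingerL2 t f) - 𝓕 (schrodingerL2 t₀ f) :=
        (Lp.fourierTransformₗᵢ (Space d) ℂ).map_sub _ _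
      rw [hs]
      filter_upwards [Lp.coeFn_sub (𝓕 (schrodingerL2 t f)) (𝓕 (schrodingerL2 t₀ f)),
        fourier_multiplierL2 (memLp_symbol d t) f, fourier_multiplierL2 (memLp_symbol d t₀) f]
        with ξ h1 h2 h3
      rw [h1, Pi.sub_apply, schrodingerL2_eq_multiplierL2, schrodingerL2_eq_multiplierL2, h2, h3,
        sub_mul]
    simp_rw [e]
    have h0 : ∫⁻ ξ, ‖(symbol d t₀ ξ - symbol d t₀ ξ) * (𝓕 f : L2 d) ξ‖ₑ ^ (2 : ℝ) = 0 := by simp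
    rw [← h0]
    have hfm := (Lp.stronglyMeasurable (𝓕 f : L2 d)).measurable
    have hsm : ∀ t, Measurable (symbol d t) := fun t =>
      (hasTemperateGrowth_symbol d t).1.continuous.measurable
    refine tendsto_lintegral_filter_of_dominated_convergence
      (fun ξ => 4 * ‖(𝓕 f : L2 d) ξ‖ₑ ^ (2 : ℝ))
      (Eventually.of_forall fun t => (((hsm t).sub (hsm t₀)).mul hfm).enorm.pow_const _)
      (Eventually.of_forall fun t => ae_of_all _ fun ξ => ?_) ?_ (ae_of_all _ fun ξ => ?_)
    · rw [enorm_mul, ENNReal.mul_rpow_of_nonneg _ _ (by norm_num)]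
      gcongr
      have : ‖symbol d t ξ - symbol d t₀ ξ‖ₑ ≤ 2 := by
        refine enorm_sub_le.trans ?_
        rw [← ofReal_norm, ← ofReal_norm, norm_symbol, norm_symbol, ENNReal.ofReal_one]
        norm_num
      calc ‖symbol d t ξ - symbol d t₀ ξ‖ₑ ^ (2 : ℝ) ≤ 2 ^ (2 : ℝ) := by gcongr
        _ = 4 := by
          rw [show (2 : ℝ) = ((2 : ℕ) : ℝ) by norm_num, ENNReal.rpow_natCast]; norm_num
    · rw [lintegral_const_mul _ (hfm.enorm.pow_const _), ← norm_sq_eq_lintegral]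
      exact ENNReal.mul_ne_top (by norm_num) ENNReal.ofReal_ne_top
    · have hc : Continuous fun t => ‖(symbol d t ξ - symbol d t₀ ξ) * (𝓕 f : L2 d) ξ‖ₑ ^ (2 : ℝ) :=
        ENNReal.continuous_rpow_const.comp
          (((continuous_symbol_time ξ).sub continuous_const).mul continuous_const).enorm
      exact hc.tendsto t₀
  have h2 : Tendsto (fun t => ‖schrodingerL2 t f - schrodingerL2 t₀ f‖ ^ 2) (𝓝 t₀) (𝓝 0) := by
    have := (ENNReal.tendsto_toReal ENNReal.zero_ne_top).comp hsq
    refine this.congr fun t => ?_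
    exact ENNReal.toReal_ofReal (by positivity)
  have h3 := h2.sqrt
  rw [Real.sqrt_zero] at h3
  exact h3.congr fun t => Real.sqrt_sq (norm_nonneg _)

/-- The Schrödinger group on Schwartz functions and on `L²` agree. -/
theorem schrodingerL2_toLp (t : ℝ) (φ : 𝓢(Space d, ℂ)) :
    schrodingerL2 t (φ.toLp 2 volume) = (schrodingerSchwartz t φ).toLp 2 volume := by
  apply fourier_injective_ae
  rw [SchwartzMap.toLp_fourier_eq, schrodingerSchwartz, SchwartzMap.fourierMultiplierCLM_apply,
    FourierTransform.fourier_fourierInv_eq]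
  filter_upwards [fourier_multiplierL2 (memLp_symbol d t) (φ.toLp 2 volume),
    (SchwartzMap.smulLeftCLM ℂ (symbol d t) (𝓕 φ)).coeFn_toLp 2 volume,
    (𝓕 φ).coeFn_toLp 2 volume] with ξ h1 h2 h3
  rw [schrodingerL2_eq_multiplierL2, h1, h2, SchwartzMap.toLp_fourier_eq, h3,
    SchwartzMap.smulLeftCLM_apply_apply (hasTemperateGrowth_symbol d t), smul_eq_mul]

theorem schrodingerSchwartz_schrodingerSchwartz (s t : ℝ) (φ : 𝓢(Space d, ℂ)) :
    schrodingerSchwartz s (schrodingerSchwartz t φ) = schrodingerSchwartz (s + t) φ := by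
  rw [schrodingerSchwartz, schrodingerSchwartz, schrodingerSchwartz,
    SchwartzMap.fourierMultiplierCLM_fourierMultiplierCLM_apply (hasTemperateGrowth_symbol d s)
      (hasTemperateGrowth_symbol d t)]
  congr 2
  funext ξ
  exact (symbol_add s t ξ).symm

/-- Transposing a Fourier multiplier exchanges the roles of 𝓕 and 𝓕⁻, that is, reflects the symbol.
The Schrödinger symbol is even, so the operator is its own transpose. -/
theorem schrodingerSchwartz_transpose (t : ℝ) (φ : 𝓢(Space d, ℂ)) :
    𝓕 (SchwartzMap.smulLeftCLM ℂ (symbol d t) (𝓕⁻ φ)) = schrodingerSchwartz t φ := by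
  ext x
  rw [schrodingerSchwartz, SchwartzMap.fourierMultiplierCLM_apply, SchwartzMap.fourierInv_coe,
    Real.fourierInv_eq_fourier_comp_neg, SchwartzMap.fourier_coe]
  refine congrArg (fun F : Space d → ℂ => (𝓕 F : Space d → ℂ) x) (funext fun ξ => ?_)
  rw [SchwartzMap.smulLeftCLM_apply_apply (hasTemperateGrowth_symbol d t),
    SchwartzMap.smulLeftCLM_apply_apply (hasTemperateGrowth_symbol d t), symbol_neg_arg,
    SchwartzMap.fourierInv_coe, Real.fourierInv_eq_fourier_neg, SchwartzMap.fourier_coe]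

/-- The group is symmetric, with no change of sign in t, because the pairing is bilinear rather than
sesquilinear. This lets evolution pass to the test function throughout. -/
theorem integral_schrodingerL2_mul (t : ℝ) (f : L2 d) (φ : 𝓢(Space d, ℂ)) :
    ∫ x, schrodingerL2 t f x * φ x = ∫ x, f x * schrodingerSchwartz t φ x := by
  have h := congrArg (fun F : 𝓢'(Space d, ℂ) => F φ) (schrodingerL2_eq t f)
  simp only [TemperedDistribution.fourierMultiplierCLM_apply_apply,
    Lp.toTemperedDistribution_apply, smul_eq_mul] at h
  rw [schrodingerSchwartz_transpose] at h
  simp_rw [mul_comm (schrodingerL2 t f _), mul_comm (f _)]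
  exact h


/-! ### The dispersive estimate. -/

/-- The damped Schrödinger symbol `e^{-(ε + 4π²it)|ξ|²}` is the regularisation used to compute the
kernel of the Schrödinger group. -/
theorem norm_integral_gaussian_mul_fourier_le {b : ℂ} (hb : 0 < b.re) (x : Space d)
    (φ : 𝓢(Space d, ℂ)) :
    ‖∫ ξ, Complex.exp (-b * ‖ξ‖ ^ 2 + 2 * π * Complex.I * (inner ℝ x ξ : ℝ)) * (𝓕 φ) ξ‖ ≤
      (π / ‖b‖) ^ ((d : ℝ) / 2) * ∫ y, ‖φ y‖ := by
  have hG : Integrable fun ξ : Space d =>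
      Complex.exp (-b * ‖ξ‖ ^ 2 + 2 * π * Complex.I * (inner ℝ x ξ : ℝ)) :=
    GaussianFourier.integrable_cexp_neg_mul_sq_norm_add hb _ _
  -- The Fourier transform is moved onto the Gaussian, whose transform is explicit and bounded by
  -- (π/|b|)^{d/2}.
  have hflip : ∫ ξ, Complex.exp (-b * ‖ξ‖ ^ 2 + 2 * π * Complex.I * (inner ℝ x ξ : ℝ)) * (𝓕 φ) ξ =
      ∫ y, (𝓕 (fun ξ : Space d =>
        Complex.exp (-b * ‖ξ‖ ^ 2 + 2 * π * Complex.I * (inner ℝ x ξ : ℝ)))) y * φ y := by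
    have h := VectorFourier.integral_fourierIntegral_smul_eq_flip (L := innerₗ (Space d))
      (μ := volume) (ν := volume) Real.continuous_fourierChar continuous_inner hG φ.integrable
    simp only [smul_eq_mul, flip_innerₗ] at h
    exact h.symm
  rw [hflip]
  refine (norm_integral_le_integral_norm _).trans ?_
  rw [← integral_const_mul]
  have hb0 : b ≠ 0 := fun h => by simp [h] at hb
  refine integral_mono_of_nonneg (ae_of_all _ fun y => norm_nonneg _) (φ.integrable.norm.const_mul _)
    (ae_of_all _ fun y => ?_)
  simp only
  rw [fourier_gaussian_innerProductSpace' hb, norm_mul, norm_mul]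
  gcongr
  have h1 : ‖((π : ℂ) / b) ^ ((Module.finrank ℝ (Space d) : ℂ) / 2)‖ = (π / ‖b‖) ^ ((d : ℝ) / 2) := by
    have e : ((Module.finrank ℝ (Space d) : ℂ) / 2) = (((d : ℝ) / 2 : ℝ) : ℂ) := by
      rw [finrank_euclideanSpace_fin]; push_cast; ring
    rw [e, Complex.norm_cpow_real, norm_div, Complex.norm_real, Real.norm_of_nonneg Real.pi_pos.le]
  rw [h1]
  refine mul_le_of_le_one_right (by positivity) ?_
  rw [Complex.norm_exp, Real.exp_le_one_iff]
  have e2 : -(π : ℂ) ^ 2 * (‖x - y‖ : ℂ) ^ 2 / b = ((-(π ^ 2 * ‖x - y‖ ^ 2) : ℝ) : ℂ) * b⁻¹ := by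
    push_cast; rw [div_eq_mul_inv]; ring
  rw [e2, Complex.re_ofReal_mul, Complex.inv_re]
  have : 0 ≤ b.re / Complex.normSq b := div_nonneg hb.le (Complex.normSq_nonneg b)
  have : 0 ≤ π ^ 2 * ‖x - y‖ ^ 2 := by positivity
  nlinarith

/-- The dispersive estimate. -/
theorem norm_schrodingerSchwartz_le {t : ℝ} (ht : t ≠ 0) (φ : 𝓢(Space d, ℂ)) (x : Space d) :
    ‖schrodingerSchwartz t φ x‖ ≤ (4 * π * |t|) ^ (-((d : ℝ) / 2)) * ∫ y, ‖φ y‖ := by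
  have hval : schrodingerSchwartz t φ x =
      ∫ ξ, Complex.exp (-((4 * π ^ 2 * t : ℝ) * Complex.I) * ‖ξ‖ ^ 2 +
        2 * π * Complex.I * (inner ℝ x ξ : ℝ)) * (𝓕 φ) ξ := by
    rw [schrodingerSchwartz, SchwartzMap.fourierMultiplierCLM_apply, SchwartzMap.fourierInv_coe,
      Real.fourierInv_eq']
    refine integral_congr_ae (ae_of_all _ fun ξ => ?_)
    simp only
    rw [SchwartzMap.smulLeftCLM_apply_apply (hasTemperateGrowth_symbol d t), symbol, smul_eq_mul,
      smul_eq_mul, ← mul_assoc, ← Complex.exp_add, real_inner_comm]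
    congr 2
    push_cast; ring
  -- The undamped exponential has modulus one and is not integrable, so the Gaussian formula is used
  -- for positive damping ε. The limit ε → 0 is dominated by |𝓕φ|.
  have hlim : Tendsto (fun ε : ℝ => ∫ ξ, Complex.exp (-((ε : ℂ) + (4 * π ^ 2 * t : ℝ) * Complex.I)
      * ‖ξ‖ ^ 2 + 2 * π * Complex.I * (inner ℝ x ξ : ℝ)) * (𝓕 φ) ξ) (𝓝[>] 0)
      (𝓝 (schrodingerSchwartz t φ x)) := by
    rw [hval]
    refine tendsto_integral_filter_of_dominated_convergence (fun ξ => ‖(𝓕 φ) ξ‖) ?_ ?_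
      (𝓕 φ).integrable.norm (ae_of_all _ fun ξ => ?_)
    · refine Eventually.of_forall fun ε => ?_
      exact (Continuous.mul (by fun_prop) (𝓕 φ).continuous).aestronglyMeasurable
    · filter_upwards [self_mem_nhdsWithin] with ε hε
      refine ae_of_all _ fun ξ => ?_
      rw [norm_mul]
      refine mul_le_of_le_one_left (norm_nonneg _) ?_
      rw [Complex.norm_exp, Real.exp_le_one_iff]
      have : (-((ε : ℂ) + (4 * π ^ 2 * t : ℝ) * Complex.I)
          * ‖ξ‖ ^ 2 + 2 * π * Complex.I * (inner ℝ x ξ : ℝ)) = ((-(ε * ‖ξ‖ ^ 2) : ℝ) : ℂ) +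
          ((-(4 * π ^ 2 * t * ‖ξ‖ ^ 2) + 2 * π * inner ℝ x ξ : ℝ) : ℂ) * Complex.I := by
        push_cast; ring
      rw [this, Complex.add_re, Complex.ofReal_re, Complex.re_ofReal_mul, Complex.I_re, mul_zero,
        add_zero]
      have : 0 < ε := hε
      have : 0 ≤ ε * ‖ξ‖ ^ 2 := by positivity
      linarith
    · have hc : Continuous fun ε : ℝ => Complex.exp (-((ε : ℂ) + (4 * π ^ 2 * t : ℝ) * Complex.I)
          * ‖ξ‖ ^ 2 + 2 * π * Complex.I * (inner ℝ x ξ : ℝ)) * (𝓕 φ) ξ := by fun_prop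
      have := (hc.tendsto 0).mono_left (nhdsWithin_le_nhds (s := Set.Ioi 0))
      simpa using this
  refine le_of_tendsto hlim.norm ?_
  filter_upwards [self_mem_nhdsWithin] with ε hε
  have hε : 0 < ε := hε
  have hre : 0 < ((ε : ℂ) + (4 * π ^ 2 * t : ℝ) * Complex.I).re := by
    rw [Complex.add_re, Complex.re_ofReal_mul, Complex.I_re, mul_zero, add_zero]
    exact hε
  refine (norm_integral_gaussian_mul_fourier_le hre x φ).trans ?_
  refine mul_le_mul_of_nonneg_right ?_ (integral_nonneg fun _ => norm_nonneg _)
  -- The imaginary part alone bounds the modulus from below, so the estimate is uniform in the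
  -- damping.
  have hb : 4 * π ^ 2 * |t| ≤ ‖(ε : ℂ) + (4 * π ^ 2 * t : ℝ) * Complex.I‖ := by
    have := Complex.abs_im_le_norm ((ε : ℂ) + (4 * π ^ 2 * t : ℝ) * Complex.I)
    simp only [Complex.add_im, Complex.ofReal_im, Complex.im_ofReal_mul, Complex.I_im, mul_one,
      zero_add] at this
    rwa [abs_mul, abs_of_pos (by positivity : 0 < 4 * π ^ 2)] at this
  have ht' : 0 < |t| := abs_pos.2 ht
  rw [Real.rpow_neg (by positivity), ← Real.inv_rpow (by positivity)]
  refine Real.rpow_le_rpow (by positivity) ?_ (by positivity)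
  calc π / _ ≤ π / (4 * π ^ 2 * |t|) := by gcongr
    _ = (4 * π * |t|)⁻¹ := by field_simp

/-- The dispersive `L^{r'} → L^r` estimate for the Schrödinger group. -/
theorem eLpNorm_schrodingerL2_le (d : ℕ) {r r' : ℝ} (hr : r.HolderConjugate r') (hr2 : 2 < r) :
    ∃ C : ℝ, 0 < C ∧ ∀ (t : ℝ), t ≠ 0 → ∀ f : L2 d,
      eLpNorm (schrodingerL2 t f) (ENNReal.ofReal r) ≤
        ENNReal.ofReal (C * |t| ^ (-(d * (1 / 2 - 1 / r)))) * eLpNorm f (ENNReal.ofReal r') := by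
  obtain ⟨C, hC, h⟩ := eLpNorm_le_of_transpose hr hr2
  refine ⟨C * (4 * π) ^ (-(d * (1 / 2 - 1 / r))), by positivity, fun t ht f => ?_⟩
  have ht' : 0 < |t| := abs_pos.2 ht
  have key := h (T := schrodingerL2 t) (T' := schrodingerSchwartz t)
    (K := (4 * π * |t|) ^ (-((d : ℝ) / 2))) (by positivity) ((schrodingerLI t).map_add)
    (fun f => (norm_schrodingerL2 t f).le) (integral_schrodingerL2_mul t) ?_ f
  · convert key using 3
    rw [← Real.rpow_mul (by positivity), mul_assoc, Real.mul_rpow (x := 4 * π) (by positivity) ht'.le]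
    have : -((d : ℝ) / 2) * (1 - 2 / r) = -(d * (1 / 2 - 1 / r)) := by ring
    rw [this]
  · intro φ x
    rw [← ofReal_norm, eLpNorm_one_eq_lintegral_enorm,
      ← ofReal_integral_norm_eq_lintegral_enorm φ.integrable, ← ENNReal.ofReal_mul (by positivity)]
    exact ENNReal.ofReal_le_ofReal (norm_schrodingerSchwartz_le ht φ x)


/-! ### Weak derivatives on the Fourier side and the subcritical Sobolev embedding. -/

/-- Turns a distributional identity into a pointwise one, so that H¹ can be handled by weighted
Plancherel. In the forward direction the right-hand side is only locally integrable a priori, hence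
the test against smooth compactly supported functions. -/
theorem lineDeriv_eq_iff_fourier (f g : L2 d) (m : Space d) :
    ∂_{m} (f : 𝓢'(Space d, ℂ)) = (g : 𝓢'(Space d, ℂ)) ↔
      (𝓕 g : L2 d) =ᵐ[volume] fun ξ => (2 * π * Complex.I * (inner ℝ ξ m : ℝ)) * (𝓕 f : L2 d) ξ := by
  have hm : (fun x : Space d => ((inner ℝ x m : ℝ) : ℂ)).HasTemperateGrowth := by fun_prop
  have hval : ∀ φ : 𝓢(Space d, ℂ), (𝓕 (∂_{m} (f : 𝓢'(Space d, ℂ)))) φ =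
      ∫ ξ, φ ξ * ((2 * π * Complex.I * (inner ℝ ξ m : ℝ)) * (𝓕 f : L2 d) ξ) := by
    intro φ
    rw [TemperedDistribution.fourier_lineDerivOp_eq, Lp.fourier_toTemperedDistribution_eq]
    change (2 * π * Complex.I) • (TemperedDistribution.smulLeftCLM ℂ
      (fun x : Space d => ((inner ℝ x m : ℝ) : ℂ)) ((𝓕 f : L2 d) : 𝓢'(Space d, ℂ))) φ = _
    rw [TemperedDistribution.smulLeftCLM_apply_apply, Lp.toTemperedDistribution_apply, smul_eq_mul,
      ← integral_const_mul]
    refine integral_congr_ae (ae_of_all _ fun ξ => ?_)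
    simp only [smul_eq_mul]
    rw [SchwartzMap.smulLeftCLM_apply_apply hm, smul_eq_mul]
    ring
  constructor
  · intro h
    have hcont : Continuous fun ξ : Space d => 2 * π * Complex.I * ((inner ℝ ξ m : ℝ) : ℂ) := by
      fun_prop
    have hF : LocallyIntegrable (fun ξ => (2 * π * Complex.I * (inner ℝ ξ m : ℝ)) * (𝓕 f : L2 d) ξ)
        volume := by
      refine locallyIntegrable_iff.2 fun K hK => ?_
      exact (((Lp.memLp (𝓕 f : L2 d)).locallyIntegrable one_le_two).integrableOn_isCompact
        hK).continuousOn_mul hcont.continuousOn hK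
    have hG := (Lp.memLp (𝓕 g : L2 d)).locallyIntegrable one_le_two
    have := ae_eq_zero_of_integral_contDiff_smul_eq_zero
      (hG.sub hF) ?_
    · filter_upwards [this] with ξ hξ
      exact sub_eq_zero.1 hξ
    intro η hη hηc
    have hg₁ : HasCompactSupport (Complex.ofRealCLM ∘ η) := hηc.comp_left rfl
    have hg₂ : ContDiff ℝ ∞ (Complex.ofRealCLM ∘ η) := by fun_prop
    have h1 := hval (hg₁.toSchwartzMap hg₂)
    rw [h, Lp.fourier_toTemperedDistribution_eq, Lp.toTemperedDistribution_apply] at h1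
    have e : ∀ ξ, η ξ • ((𝓕 g : L2 d) - fun ξ => (2 * π * Complex.I * (inner ℝ ξ m : ℝ)) *
        (𝓕 f : L2 d) ξ) ξ = η ξ • (𝓕 g : L2 d) ξ -
        η ξ • ((2 * π * Complex.I * (inner ℝ ξ m : ℝ)) * (𝓕 f : L2 d) ξ) := fun ξ => by
      rw [Pi.sub_apply, smul_sub]
    simp_rw [e]
    rw [integral_sub (hG.integrable_smul_left_of_hasCompactSupport hη.continuous hηc)
      (hF.integrable_smul_left_of_hasCompactSupport hη.continuous hηc), sub_eq_zero]
    simpa using h1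
  · intro h
    have hinj : 𝓕 (∂_{m} (f : 𝓢'(Space d, ℂ))) = 𝓕 (g : 𝓢'(Space d, ℂ)) := by
      ext φ
      rw [hval, Lp.fourier_toTemperedDistribution_eq, Lp.toTemperedDistribution_apply]
      refine integral_congr_ae ?_
      filter_upwards [h] with ξ hξ
      rw [hξ, smul_eq_mul]
    have := congrArg (fun F : 𝓢'(Space d, ℂ) => 𝓕⁻ F) hinj
    simpa using this

theorem integral_fourierInv_mul (f : L2 d) (φ : 𝓢(Space d, ℂ)) :
    ∫ x, (𝓕⁻ f : L2 d) x * φ x = ∫ x, f x * (𝓕⁻ φ : 𝓢(Space d, ℂ)) x := by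
  have h := congrArg (fun F : 𝓢'(Space d, ℂ) => F φ) (Lp.fourierInv_toTemperedDistribution_eq f)
  simp only [TemperedDistribution.fourierInv_apply, Lp.toTemperedDistribution_apply,
    smul_eq_mul] at h
  simp_rw [mul_comm ((𝓕⁻ f : L2 d) _), mul_comm (f _)]
  exact h.symm

/-- The Hausdorff–Young inequality, up to a constant. -/
theorem eLpNorm_fourierInv_le {r r' : ℝ} (hr : r.HolderConjugate r') (hr2 : 2 < r) :
    ∃ C : ℝ, 0 < C ∧ ∀ (d : ℕ) (f : L2 d), eLpNorm (𝓕⁻ f : L2 d) (ENNReal.ofReal r) ≤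
        ENNReal.ofReal C * eLpNorm f (ENNReal.ofReal r') := by
  obtain ⟨C, hC, h⟩ := eLpNorm_le_of_transpose hr hr2
  refine ⟨C, hC, fun d f => ?_⟩
  have key := h (T := fun f : L2 d => 𝓕⁻ f) (T' := fun φ => 𝓕⁻ φ)
    (K := 1) one_pos (fun f g => FourierTransform.fourierInv_add f g)
    (fun f => ((Lp.fourierTransformₗᵢ (Space d) ℂ).symm.norm_map f).le) integral_fourierInv_mul ?_ f
  · simpa using key
  · intro φ x
    rw [ENNReal.ofReal_one, one_mul, ← ofReal_norm, eLpNorm_one_eq_lintegral_enorm,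
      ← ofReal_integral_norm_eq_lintegral_enorm φ.integrable]
    refine ENNReal.ofReal_le_ofReal ?_
    rw [SchwartzMap.fourierInv_coe, Real.fourierInv_eq]
    refine (norm_integral_le_integral_norm _).trans (le_of_eq ?_)
    simp

namespace H1

theorem fourier_partialDeriv (f : H1 d) (j : Fin d) :
    (𝓕 (f.partialDeriv j) : L2 d) =ᵐ[volume]
      fun ξ => (2 * π * Complex.I * (ξ j : ℝ)) * (𝓕 f.fn : L2 d) ξ := by
  have h := (lineDeriv_eq_iff_fourier _ _ _).1 (f.lineDeriv_fn j)
  simpa [EuclideanSpace.inner_single_right] using h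

theorem norm_sq_eq_lintegral (f : H1 d) : ENNReal.ofReal (‖f‖ ^ 2) =
    ∫⁻ ξ, ENNReal.ofReal (1 + 4 * π ^ 2 * ‖ξ‖ ^ 2) * ‖(𝓕 f.fn : L2 d) ξ‖ₑ ^ (2 : ℝ) := by
  have hm := ((Lp.stronglyMeasurable (𝓕 f.fn : L2 d)).measurable.enorm.pow_const (2 : ℝ))
  have h1 : ∀ j, ENNReal.ofReal (‖f.partialDeriv j‖ ^ 2) =
      ∫⁻ ξ, ENNReal.ofReal (4 * π ^ 2 * ξ j ^ 2) * ‖(𝓕 f.fn : L2 d) ξ‖ₑ ^ (2 : ℝ) := by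
    intro j
    rw [← Lp.norm_fourier_eq, NLS.norm_sq_eq_lintegral]
    refine lintegral_congr_ae ?_
    filter_upwards [fourier_partialDeriv f j] with ξ hξ
    rw [hξ, enorm_mul, ENNReal.mul_rpow_of_nonneg _ _ (by norm_num)]
    congr 1
    rw [← ofReal_norm, ENNReal.ofReal_rpow_of_nonneg (norm_nonneg _) (by norm_num)]
    congr 1
    simp only [norm_mul, Complex.norm_I, Complex.norm_real, Complex.norm_ofNat, mul_one,
      Real.norm_eq_abs, Real.rpow_two, mul_pow, sq_abs]
    norm_num
  rw [H1.norm_sq, ENNReal.ofReal_add (by positivity) (by positivity),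
    ENNReal.ofReal_sum_of_nonneg (fun j _ => by positivity), Finset.sum_congr rfl fun j _ => h1 j,
    ← lintegral_finsetSum _ (fun j _ => by
      exact Measurable.mul (by fun_prop) hm), ← Lp.norm_fourier_eq, NLS.norm_sq_eq_lintegral,
    ← lintegral_add_left hm]
  congr 1; funext ξ
  rw [← Finset.sum_mul, ← ENNReal.ofReal_sum_of_nonneg (fun j _ => by positivity),
    ENNReal.ofReal_add one_pos.le (by positivity), add_mul, ENNReal.ofReal_one, one_mul]
  congr 3
  rw [EuclideanSpace.norm_sq_eq, Finset.mul_sum]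
  simp

/-- Subcritical Sobolev embedding. -/
theorem eLpNorm_fn_le (d : ℕ) {r : ℝ} (hr2 : 2 < r) (hrd : d * (1 / 2 - 1 / r) < 1) :
    ∃ C : ℝ, 0 < C ∧ ∀ f : H1 d, eLpNorm f.fn (ENNReal.ofReal r) ≤ ENNReal.ofReal (C * ‖f‖) := by
  set r' := r.conjExponent
  have hr : r.HolderConjugate r' := Real.HolderConjugate.conjExponent (by linarith)
  have hr0 := hr.pos
  have hr'0 := hr.symm.pos
  have hsum := hr.inv_add_inv_eq_one
  have hr'2 : r' < 2 := by
    have h1 : r⁻¹ < 2⁻¹ := inv_strictAnti₀ two_pos hr2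
    have h3 : 2⁻¹ < r'⁻¹ := by linarith
    exact (inv_lt_inv₀ two_pos hr'0).1 h3
  obtain ⟨C, hC, h⟩ := eLpNorm_fourierInv_le hr hr2
  -- Here 1/m = 1/2 - 1/r, so the subcriticality hypothesis says exactly m > d: the weight
  -- (1+|ξ|²)^{-m/2} is integrable.
  set m : ℝ := 2 * r' / (2 - r') with hm
  have hm0 : 0 < m := div_pos (by linarith) (by linarith)
  have hmd : (d : ℝ) < m := by
    have h1 : 1 / 2 - 1 / r = 1 / m := by
      have : 1 / r = 1 - 1 / r' := by rw [one_div, one_div]; linarith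
      rw [this, hm]
      have : 2 - r' ≠ 0 := by linarith
      field_simp; ring
    rw [h1, mul_one_div, div_lt_one hm0] at hrd
    exact hrd
  have hint : Integrable (fun ξ : Space d => ((1 : ℝ) + ‖ξ‖ ^ 2) ^ (-m / 2)) :=
    integrable_rpow_neg_one_add_norm_sq (by simpa using hmd)
  set I : ℝ≥0∞ := ∫⁻ ξ : Space d, ENNReal.ofReal (((1 : ℝ) + ‖ξ‖ ^ 2) ^ (-m / 2)) with hI
  have hIt : I ≠ ⊤ := by
    have := hint.2
    rw [hasFiniteIntegral_iff_ofReal (ae_of_all _ fun ξ => by positivity)] at this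
    exact this.ne
  set J : ℝ≥0∞ := I ^ ((1 - r' / 2) * (1 / r')) with hJ
  have hJt : J ≠ ⊤ := ENNReal.rpow_ne_top_of_nonneg (by
    have : 0 < 1 - r' / 2 := by linarith
    positivity) hIt
  refine ⟨C * (J.toReal + 1), by positivity, fun f => ?_⟩
  have h1 := h d (𝓕 f.fn)
  rw [FourierTransform.fourierInv_fourier_eq] at h1
  refine h1.trans ?_
  rw [mul_assoc, ENNReal.ofReal_mul hC.le]
  gcongr
  rw [eLpNorm_ofReal_eq hr'0]
  set F : Space d → ℂ := ⇑(𝓕 f.fn : L2 d) with hF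
  have hFm : Measurable F := (Lp.stronglyMeasurable (𝓕 f.fn : L2 d)).measurable
  -- Hölder with weights r'/2 and 1 - r'/2 separates the H¹ density from the integrable weight;
  -- Hausdorff–Young has already reduced the claim to the L^{r'} norm of the transform.
  have hhold := ENNReal.lintegral_mul_norm_pow_le (μ := (volume : Measure (Space d)))
    (f := fun ξ => ENNReal.ofReal (1 + 4 * π ^ 2 * ‖ξ‖ ^ 2) * ‖F ξ‖ₑ ^ (2 : ℝ))
    (g := fun ξ => ENNReal.ofReal ((1 + ‖ξ‖ ^ 2) ^ (-m / 2)))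
    (Measurable.aemeasurable (Measurable.mul (by fun_prop) (hFm.enorm.pow_const _)))
    (by fun_prop) (p := r' / 2) (q := 1 - r' / 2) (by positivity) (by linarith) (by ring)
  rw [← norm_sq_eq_lintegral, ← hI] at hhold
  have hle : ∫⁻ ξ, ‖F ξ‖ₑ ^ r' ≤ ENNReal.ofReal (‖f‖ ^ 2) ^ (r' / 2) * I ^ (1 - r' / 2) := by
    refine le_trans (lintegral_mono fun ξ => ?_) hhold
    have hw : 1 + ‖ξ‖ ^ 2 ≤ 1 + 4 * π ^ 2 * ‖ξ‖ ^ 2 := by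
      have h3 := Real.pi_gt_three
      have h4 : 1 ≤ 4 * π ^ 2 := by nlinarith
      have := mul_le_mul_of_nonneg_right h4 (sq_nonneg ‖ξ‖)
      linarith
    have hw0 : 0 < 1 + ‖ξ‖ ^ 2 := by positivity
    rw [ENNReal.mul_rpow_of_nonneg _ _ (by positivity), ← ENNReal.rpow_mul,
      mul_div_cancel₀ _ two_ne_zero, mul_right_comm,
      ENNReal.ofReal_rpow_of_nonneg (by positivity) (by positivity),
      ENNReal.ofReal_rpow_of_nonneg (by positivity) (by linarith),
      ← ENNReal.ofReal_mul (by positivity)]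
    refine le_mul_of_one_le_left zero_le ?_
    rw [ENNReal.one_le_ofReal, ← Real.rpow_mul hw0.le]
    have : -m / 2 * (1 - r' / 2) = -(r' / 2) := by
      rw [hm]
      have : 2 - r' ≠ 0 := by linarith
      field_simp
    rw [this, Real.rpow_neg hw0.le, ← div_eq_mul_inv, one_le_div (by positivity)]
    exact Real.rpow_le_rpow hw0.le hw (by positivity)
  calc (∫⁻ ξ, ‖F ξ‖ₑ ^ r') ^ (1 / r')
      ≤ (ENNReal.ofReal (‖f‖ ^ 2) ^ (r' / 2) * I ^ (1 - r' / 2)) ^ (1 / r') := by gcongr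
    _ = ENNReal.ofReal ‖f‖ * J := by
        rw [ENNReal.mul_rpow_of_nonneg _ _ (by positivity), ← ENNReal.rpow_mul, ← ENNReal.rpow_mul,
          ← hJ]
        congr 1
        rw [ENNReal.ofReal_rpow_of_nonneg (by positivity) (by positivity), ← Real.rpow_natCast,
          ← Real.rpow_mul (norm_nonneg _)]
        have : ((2 : ℕ) : ℝ) * (r' / 2 * (1 / r')) = 1 := by push_cast; field_simp
        rw [this, Real.rpow_one]
    _ ≤ ENNReal.ofReal ((J.toReal + 1) * ‖f‖) := by
        rw [mul_comm, ENNReal.ofReal_mul (by positivity)]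
        gcongr
        rw [ENNReal.le_ofReal_iff_toReal_le hJt (by positivity)]
        linarith

end H1


/-! ### The Schrödinger group on H¹. -/

namespace H1

theorem fn_sub (f g : H1 d) : (f - g).fn = f.fn - g.fn := rfl

theorem norm_fn_le (f : H1 d) : ‖f.fn‖ ≤ ‖f‖ := by
  refine le_of_sq_le_sq ?_ (norm_nonneg _)
  rw [H1.norm_sq]
  exact le_add_of_nonneg_right (Finset.sum_nonneg fun j _ => by positivity)

/-- On the Fourier side the H¹ norm involves only the function component, so a vanishing function
forces a vanishing gradient. Identities in H¹ can thus be checked in L². -/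
theorem ext_fn {f g : H1 d} (h : f.fn = g.fn) : f = g := by
  rw [← sub_eq_zero, ← norm_eq_zero, ← sq_eq_zero_iff]
  have h0 : (f - g).fn = 0 := by rw [fn_sub, h, sub_self]
  have h1 := norm_sq_eq_lintegral (f - g)
  have h2 : (𝓕 (f - g).fn : L2 d) = 0 := by
    rw [h0]; exact (Lp.fourierTransformₗᵢ (Space d) ℂ).map_zero
  rw [h2, lintegral_congr_ae (g := fun _ => 0), lintegral_zero, ENNReal.ofReal_eq_zero] at h1
  · exact le_antisymm h1 (sq_nonneg _)
  · filter_upwards [Lp.coeFn_zero ℂ 2 (volume : Measure (Space d))] with ξ hξ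
    simp [hξ]

end H1

theorem fn_schrodingerH1 (t : ℝ) (f : H1 d) : (schrodingerH1 t f).fn = schrodingerL2 t f.fn := rfl

theorem partialDeriv_schrodingerH1 (t : ℝ) (f : H1 d) (j : Fin d) :
    (schrodingerH1 t f).partialDeriv j = schrodingerL2 t (f.partialDeriv j) := rfl

theorem norm_schrodingerH1 (t : ℝ) (f : H1 d) : ‖schrodingerH1 t f‖ = ‖f‖ := by
  rw [← sq_eq_sq₀ (norm_nonneg _) (norm_nonneg _), H1.norm_sq, H1.norm_sq, fn_schrodingerH1,
    norm_schrodingerL2]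
  simp_rw [partialDeriv_schrodingerH1, norm_schrodingerL2]

theorem schrodingerH1_sub (t : ℝ) (f g : H1 d) :
    schrodingerH1 t (f - g) = schrodingerH1 t f - schrodingerH1 t g := by
  apply H1.ext_fn
  rw [H1.fn_sub, fn_schrodingerH1, H1.fn_sub, schrodingerL2_sub]; rfl

theorem schrodingerH1_schrodingerH1 (s t : ℝ) (f : H1 d) :
    schrodingerH1 s (schrodingerH1 t f) = schrodingerH1 (s + t) f := by
  apply H1.ext_fn
  simp only [fn_schrodingerH1, schrodingerL2_schrodingerL2]

theorem schrodingerH1_zero (f : H1 d) : schrodingerH1 0 f = f := by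
  apply H1.ext_fn
  rw [fn_schrodingerH1, schrodingerL2_zero]

theorem continuous_schrodingerH1_time (f : H1 d) : Continuous fun t => schrodingerH1 t f := by
  rw [continuous_iff_continuousAt]
  intro t₀
  rw [ContinuousAt, tendsto_iff_norm_sub_tendsto_zero]
  have key : Tendsto (fun t => ‖schrodingerH1 t f - schrodingerH1 t₀ f‖ ^ 2) (𝓝 t₀) (𝓝 0) := by
    have hc : Continuous fun t => ‖schrodingerL2 t f.fn - schrodingerL2 t₀ f.fn‖ ^ 2 +
        ∑ j, ‖schrodingerL2 t (f.partialDeriv j) - schrodingerL2 t₀ (f.partialDeriv j)‖ ^ 2 := by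
      refine Continuous.add ?_ (continuous_finsetSum _ fun j _ => ?_)
      · exact ((continuous_schrodingerL2_time f.fn).sub continuous_const).norm.pow 2
      · exact ((continuous_schrodingerL2_time (f.partialDeriv j)).sub continuous_const).norm.pow 2
    have h := hc.tendsto t₀
    simp only [sub_self, norm_zero, ne_eq, OfNat.ofNat_ne_zero, not_false_eq_true, zero_pow,
      Finset.sum_const_zero, add_zero] at h
    refine h.congr fun t => ?_
    rw [H1.norm_sq]; rfl
  have h3 := key.sqrt
  rw [Real.sqrt_zero] at h3
  exact h3.congr fun t => Real.sqrt_sq (norm_nonneg _)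

/-! ### The homogeneous Strichartz estimate by duality and the T T* argument. -/

/-- The bilinear pairing `∫ f g` on `L²`. -/
def pairing (d : ℕ) : L2 d →L[ℂ] L2 d →L[ℂ] ℂ :=
  (ContinuousLinearMap.mul ℂ ℂ).lpPairing volume 2 2

theorem pairing_apply (f g : L2 d) : pairing d f g = ∫ x, f x * g x := by
  rw [pairing, ContinuousLinearMap.lpPairing_eq_integral]; rfl

theorem norm_pairing_le (f g : L2 d) : ‖pairing d f g‖ ≤ ‖f‖ * ‖g‖ := by
  rw [pairing_apply, ← ENNReal.ofReal_le_ofReal_iff (by positivity), ofReal_norm,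
    ENNReal.ofReal_mul (norm_nonneg _), ofReal_norm, ofReal_norm]
  rw [Lp.enorm_def, Lp.enorm_def]
  exact enorm_integral_mul_le_L2 (Lp.aestronglyMeasurable f) (Lp.aestronglyMeasurable g)

theorem pairing_toLp (f : L2 d) (φ : 𝓢(Space d, ℂ)) :
    pairing d f (φ.toLp 2 volume) = ∫ x, f x * φ x := by
  rw [pairing_apply]
  refine integral_congr_ae ?_
  filter_upwards [φ.coeFn_toLp 2 volume] with x hx
  rw [hx]

theorem enorm_integral_mul_le_holder {X : Type*} [MeasurableSpace X] {μ : Measure X} {f g : X → ℂ}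
    (hf : AEStronglyMeasurable f μ) (hg : AEStronglyMeasurable g μ) {r r' : ℝ}
    (hr : r.HolderConjugate r') :
    ‖∫ x, f x * g x ∂μ‖ₑ ≤ eLpNorm f (ENNReal.ofReal r) μ * eLpNorm g (ENNReal.ofReal r') μ := by
  refine (enorm_integral_le_lintegral_enorm _).trans ?_
  rw [eLpNorm_ofReal_eq hr.pos, eLpNorm_ofReal_eq hr.symm.pos]
  simp_rw [enorm_mul]
  exact ENNReal.lintegral_mul_le_Lp_mul_Lq μ hr hf.enorm hg.enorm

/-- Near-optimal Schwartz test function for the `L^r` norm. -/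
theorem exists_test_function (g : L2 d) {r r' : ℝ} (hr : r.HolderConjugate r') (hr2 : 2 ≤ r)
    (hg : eLpNorm g (ENNReal.ofReal r) ≠ ⊤) {ε : ℝ} (hε : 0 < ε) :
    ∃ φ : 𝓢(Space d, ℂ), eLpNorm φ (ENNReal.ofReal r') ≤ 1 ∧
      (eLpNorm g (ENNReal.ofReal r)).toReal - ε ≤ (∫ x, g x * φ x).re := by
  set N := (eLpNorm g (ENNReal.ofReal r)).toReal with hN
  rcases le_or_gt N ε with h | h
  · refine ⟨0, ?_, ?_⟩
    · rw [eLpNorm_congr_ae (g := fun _ => (0 : ℂ)) (ae_of_all _ fun x => zero_apply x),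
        eLpNorm_zero']
      exact zero_le
    · simp only [zero_apply, mul_zero, integral_zero, Complex.zero_re]; linarith
  -- If no Schwartz function did better than N - ε, duality would bound the norm itself by N - ε.
  have h1 : ∃ φ : 𝓢(Space d, ℂ), ENNReal.ofReal (N - ε) * eLpNorm φ (ENNReal.ofReal r') <
      ‖∫ x, g x * φ x‖ₑ := by
    by_contra hcon
    push Not at hcon
    have h2 := eLpNorm_le_of_schwartz g hr hr2 hcon
    rw [ENNReal.le_ofReal_iff_toReal_le hg (by linarith)] at h2
    linarith
  obtain ⟨φ, hφ⟩ := h1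
  obtain ⟨P, hP⟩ : ∃ P, P = eLpNorm φ (ENNReal.ofReal r') volume := ⟨_, rfl⟩
  obtain ⟨z, hz⟩ : ∃ z, z = ∫ x, g x * φ x := ⟨_, rfl⟩
  have hPt : P ≠ ⊤ := by
    rw [hP]
    exact (φ.memLp (ENNReal.ofReal r') volume).2.ne
  rw [← hP, ← hz] at hφ
  have hz0 : z ≠ 0 := fun h0 => by rw [h0, enorm_zero] at hφ; exact absurd hφ (not_lt.2 zero_le)
  have hP0 : P ≠ 0 := fun h0 => by
    have := enorm_integral_mul_le_holder (Lp.aestronglyMeasurable g)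
      φ.continuous.aestronglyMeasurable (μ := volume) hr
    rw [← hP, ← hz, h0, mul_zero] at this
    exact hz0 (by simpa using this)
  have hp0 : 0 < P.toReal := ENNReal.toReal_pos hP0 hPt
  have hreal : (N - ε) * P.toReal < ‖z‖ := by
    rw [← ENNReal.ofReal_toReal hPt, ← ENNReal.ofReal_mul (by linarith), ← ofReal_norm] at hφ
    exact (ENNReal.ofReal_lt_ofReal_iff (norm_pos_iff.2 hz0)).1 hφ
  -- Rotates the pairing onto the positive real axis and normalises the L^{r'} norm to 1.
  set c : ℂ := (((P.toReal * ‖z‖)⁻¹ : ℝ) : ℂ) * (starRingEnd ℂ) z with hc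
  have hzn : 0 < ‖z‖ := norm_pos_iff.2 hz0
  have hcn : ‖c‖ = P.toReal⁻¹ := by
    rw [hc, norm_mul, RCLike.norm_conj, Complex.norm_real, Real.norm_of_nonneg (by positivity)]
    field_simp
  refine ⟨c • φ, ?_, ?_⟩
  · rw [eLpNorm_congr_ae (g := c • (φ : Space d → ℂ)) (ae_of_all _ fun x => by
        rw [smul_apply]; rfl),
      eLpNorm_const_smul, ← hP, ← ofReal_norm, hcn, ENNReal.ofReal_inv_of_pos hp0,
      ENNReal.ofReal_toReal hPt, ENNReal.inv_mul_cancel hP0 hPt]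
  · have : ∫ x, g x * (c • φ) x = c * z := by
      rw [hz, ← integral_const_mul]
      congr 1; funext x
      rw [smul_apply, smul_eq_mul]; ring
    rw [this, hc, mul_assoc, mul_comm _ z, Complex.mul_conj, Complex.normSq_eq_norm_sq,
      ← Complex.ofReal_mul, Complex.ofReal_re]
    have e : (P.toReal * ‖z‖)⁻¹ * ‖z‖ ^ 2 = ‖z‖ / P.toReal := by field_simp
    rw [e, le_div_iff₀ hp0]; exact hreal.le


theorem ae_ne_real (s : ℝ) : ∀ᵐ t : ℝ, t ≠ s := by
  simp [ae_iff]

theorem eLpNorm_schwartz_toLp (φ : 𝓢(Space d, ℂ)) (p : ℝ≥0∞) :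
    eLpNorm (φ.toLp 2 volume : L2 d) p volume = eLpNorm φ p volume :=
  eLpNorm_congr_ae (φ.coeFn_toLp 2 (volume : Measure (Space d)))

theorem enorm_inner_le_holder (f g : L2 d) {r r' : ℝ} (hr : r.HolderConjugate r') :
    ‖inner ℂ f g‖ₑ ≤ eLpNorm g (ENNReal.ofReal r) volume * eLpNorm f (ENNReal.ofReal r') volume := by
  have e : inner ℂ f g = ∫ x, g x * (starRingEnd ℂ) (f x) := by
    rw [L2.inner_def]
    exact integral_congr_ae (ae_of_all _ fun x => RCLike.inner_apply _ _)
  rw [e]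
  have h2 : eLpNorm (fun x => (starRingEnd ℂ) (f x)) (ENNReal.ofReal r') volume =
      eLpNorm f (ENNReal.ofReal r') volume :=
    eLpNorm_congr_norm_ae (ae_of_all _ fun x => RCLike.norm_conj _)
  rw [← h2]
  exact enorm_integral_mul_le_holder (Lp.aestronglyMeasurable g)
    (Complex.continuous_conj.comp_aestronglyMeasurable (Lp.aestronglyMeasurable f)) hr

/-- The inner product of two evolved functions decays dispersively. -/
theorem exists_inner_schrodingerL2_le (d : ℕ) {r r' : ℝ} (hr : r.HolderConjugate r')
    (hr2 : 2 < r) :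
    ∃ C : ℝ, 0 < C ∧ ∀ (f g : L2 d) (s t : ℝ), t ≠ s →
      ‖inner ℂ (schrodingerL2 s f) (schrodingerL2 t g)‖ₑ ≤
        ENNReal.ofReal C * ENNReal.ofReal (|s - t| ^ (-(d * (1 / 2 - 1 / r)))) *
          eLpNorm g (ENNReal.ofReal r') volume * eLpNorm f (ENNReal.ofReal r') volume := by
  obtain ⟨C, hC, h⟩ := eLpNorm_schrodingerL2_le d hr hr2
  refine ⟨C, hC, fun f g s t hst => ?_⟩
  rw [inner_schrodingerL2, schrodingerL2_schrodingerL2]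
  refine (enorm_inner_le_holder _ _ hr).trans ?_
  refine mul_le_mul_left ?_ _
  have h3 := h (-s + t) (by intro h0; exact hst (by linarith)) g
  rwa [ENNReal.ofReal_mul hC.le, show |-s + t| = |s - t| by rw [← abs_neg]; ring_nf] at h3

theorem exists_inner_schrodinger_le (d : ℕ) {r r' : ℝ} (hr : r.HolderConjugate r') (hr2 : 2 < r) :
    ∃ C : ℝ, 0 < C ∧ ∀ (φ ψ : 𝓢(Space d, ℂ)), eLpNorm φ (ENNReal.ofReal r') ≤ 1 →
      eLpNorm ψ (ENNReal.ofReal r') ≤ 1 → ∀ s t : ℝ, t ≠ s →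
      ‖inner ℂ (schrodingerL2 s (φ.toLp 2 volume)) (schrodingerL2 t (ψ.toLp 2 volume))‖ₑ ≤
        ENNReal.ofReal C * ENNReal.ofReal (|s - t| ^ (-(d * (1 / 2 - 1 / r)))) := by
  obtain ⟨C, hC, h⟩ := exists_inner_schrodingerL2_le d hr hr2
  refine ⟨C, hC, fun φ ψ hφ hψ s t hst => (h _ _ s t hst).trans ?_⟩
  rw [eLpNorm_schwartz_toLp, eLpNorm_schwartz_toLp]
  exact (mul_le_of_le_one_right' hφ).trans (mul_le_of_le_one_right' hψ)

/-- The dual Strichartz estimate for superpositions of evolved Schwartz functions. -/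
theorem exists_norm_integral_schrodinger_le (d : ℕ) {r r' δ : ℝ} (hr : r.HolderConjugate r')
    (hr2 : 2 < r) (hδ : δ = d * (1 / 2 - 1 / r)) (hδ0 : 0 < δ) (hδ1 : δ < 1) :
    ∃ C : ℝ, 0 < C ∧ ∀ (φ : ℝ → 𝓢(Space d, ℂ)) (w : ℝ → ℝ), Measurable w →
      (∀ t, 0 ≤ w t) → (∀ t, eLpNorm (φ t) (ENNReal.ofReal r') ≤ 1) →
      Integrable (fun t => (w t : ℂ) • schrodingerL2 t ((φ t).toLp 2 volume)) →
      ‖∫ t, (w t : ℂ) • schrodingerL2 t ((φ t).toLp 2 volume)‖ₑ ≤ ENNReal.ofReal C *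
        (∫⁻ t, ENNReal.ofReal (w t) ^ (2 / (2 - δ))) ^ ((2 - δ) / 2) := by
  obtain ⟨C₁, hC₁, h1⟩ := exists_inner_schrodinger_le d hr hr2
  have hγ : (2 / δ).HolderConjugate (2 / (2 - δ)) := by
    rw [Real.holderConjugate_iff]
    refine ⟨by rw [lt_div_iff₀ hδ0]; linarith, ?_⟩
    have : 2 - δ ≠ 0 := by linarith
    field_simp; ring
  have hγ'1 : 1 < 2 / (2 - δ) := hγ.symm.lt
  obtain ⟨C₂, hC₂, h2⟩ := lintegral_rieszPot_rpow_le (a := 2 / δ) (b := 2 / (2 - δ)) (δ := δ) hδ1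
    hγ'1 (by positivity) (by have : 2 - δ ≠ 0 := by linarith
                             field_simp; ring)
  refine ⟨(C₁ * C₂) ^ (1 / 2 : ℝ), by positivity, fun φ w hw hw0 hφ hint => ?_⟩
  set H : ℝ → L2 d := fun t => (w t : ℂ) • schrodingerL2 t ((φ t).toLp 2 volume) with hH
  set Ψ : L2 d := ∫ t, H t with hΨ
  set W : ℝ → ℝ≥0∞ := fun t => ENNReal.ofReal (w t) with hW
  have hWm : Measurable W := hw.ennreal_ofReal
  have hHH : ∀ s t, t ≠ s → ‖inner ℂ (H s) (H t)‖ₑ ≤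
      ENNReal.ofReal C₁ * (W s * (ENNReal.ofReal (|s - t| ^ (-δ)) * W t)) := by
    intro s t hst
    simp only [hH, inner_smul_left, inner_smul_right, enorm_mul, RCLike.enorm_conj]
    have e : ∀ t, ‖((w t : ℝ) : ℂ)‖ₑ = W t := fun t => by
      rw [← ofReal_norm, Complex.norm_real, Real.norm_of_nonneg (hw0 t)]
    rw [e, e]
    have := h1 (φ s) (φ t) (hφ s) (hφ t) s t hst
    rw [← hδ] at this
    calc W t * (W s * _) ≤ W t * (W s * (ENNReal.ofReal C₁ * ENNReal.ofReal (|s - t| ^ (-δ)))) := by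
          gcongr
      _ = _ := by ring
  -- T T*: the squared norm of the superposition is a double integral of inner products, each
  -- bounded by |s-t|^{-δ} off the null diagonal. Hardy–Littlewood–Sobolev closes the resulting
  -- bilinear form in W.
  have hsq : ‖Ψ‖ₑ ^ 2 ≤ ENNReal.ofReal (C₁ * C₂) *
      ((∫⁻ t, W t ^ (2 / (2 - δ))) ^ ((2 - δ) / 2)) ^ 2 := by
    have hs : ∀ s, ‖inner ℂ (H s) Ψ‖ₑ ≤ ENNReal.ofReal C₁ * (W s * rieszPot δ W s) := by
      intro s
      have : inner ℂ (H s) Ψ = ∫ t, inner ℂ (H s) (H t) := (integral_inner hint (H s)).symm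
      rw [this]
      refine (enorm_integral_le_lintegral_enorm _).trans ?_
      unfold rieszPot
      rw [← lintegral_const_mul _ (by fun_prop), ← lintegral_const_mul _ (by fun_prop)]
      refine lintegral_mono_ae ?_
      filter_upwards [ae_ne_real s] with t ht
      exact hHH s t ht
    have e1 : ‖Ψ‖ₑ ^ 2 = ‖inner ℂ Ψ Ψ‖ₑ := by
      rw [inner_self_eq_norm_sq_to_K, enorm_pow]
      congr 1
      rw [← ofReal_norm, ← ofReal_norm]; simp
    have e2 : inner ℂ Ψ Ψ = ∫ s, inner ℂ Ψ (H s) := (integral_inner hint Ψ).symm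
    rw [e1, e2]
    refine (enorm_integral_le_lintegral_enorm _).trans ?_
    calc ∫⁻ s, ‖inner ℂ Ψ (H s)‖ₑ ≤ ∫⁻ s, ENNReal.ofReal C₁ * (W s * rieszPot δ W s) := by
          refine lintegral_mono fun s => ?_
          rw [← inner_conj_symm, RCLike.enorm_conj]
          exact hs s
      _ = ENNReal.ofReal C₁ * ∫⁻ s, (rieszPot δ W * W) s := by
          have m : Measurable fun s => W s * rieszPot δ W s := hWm.mul (measurable_rieszPot δ hWm)
          rw [lintegral_const_mul _ m]
          simp_rw [Pi.mul_apply, mul_comm (W _)]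
      _ ≤ ENNReal.ofReal C₁ * ((ENNReal.ofReal C₂ * (∫⁻ t, W t ^ (2 / (2 - δ))) ^ (1 / (2 / (2 - δ)))) *
            (∫⁻ t, W t ^ (2 / (2 - δ))) ^ (1 / (2 / (2 - δ)))) := by
          gcongr
          refine (ENNReal.lintegral_mul_le_Lp_mul_Lq volume hγ
            (measurable_rieszPot δ hWm).aemeasurable hWm.aemeasurable).trans ?_
          gcongr
          exact h2 W hWm
      _ = _ := by
          rw [one_div_div, ENNReal.ofReal_mul hC₁.le]; ring
  have h3 := ENNReal.rpow_le_rpow hsq (show (0 : ℝ) ≤ 1 / 2 by norm_num)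
  rw [ENNReal.mul_rpow_of_nonneg _ _ (by norm_num), ← ENNReal.rpow_natCast, ← ENNReal.rpow_natCast,
    ← ENNReal.rpow_mul, ← ENNReal.rpow_mul (_ ^ _), ENNReal.ofReal_rpow_of_pos (by positivity)] at h3
  simpa using h3

/-- A Schwartz function as an element of `L²`. -/
def schwartzL2 (φ : 𝓢(Space d, ℂ)) : L2 d := φ.toLp 2 volume

theorem lineDeriv_schwartzL2 (φ : 𝓢(Space d, ℂ)) (m : Space d) :
    ∂_{m} (schwartzL2 φ : 𝓢'(Space d, ℂ)) =
      (schwartzL2 (∂_{m} φ : 𝓢(Space d, ℂ)) : 𝓢'(Space d, ℂ)) := by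
  rw [schwartzL2, schwartzL2, Lp.toTemperedDistribution_toLp_eq, Lp.toTemperedDistribution_toLp_eq,
    lineDerivOp_toTemperedDistributionCLM_eq]

/-- The element of `H¹` with prescribed function and weak gradient. -/
def H1.mk (f : L2 d) (g : Fin d → L2 d)
    (h : ∀ j, ∂_{EuclideanSpace.single j (1 : ℝ)} (f : 𝓢'(Space d, ℂ)) = (g j : 𝓢'(Space d, ℂ))) :
    H1 d := ⟨WithLp.toLp 2 (f, WithLp.toLp 2 g), h⟩

theorem H1.partialDeriv_mk (f : L2 d) (g : Fin d → L2 d) (h) (j : Fin d) :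
    (H1.mk f g h).partialDeriv j = g j := rfl

/-- A Schwartz function as an element of `H¹`. -/
def H1.ofSchwartz (φ : 𝓢(Space d, ℂ)) : H1 d :=
  H1.mk (schwartzL2 φ) (fun j => schwartzL2 (∂_{EuclideanSpace.single j (1 : ℝ)} φ : 𝓢(Space d, ℂ)))
    fun j => lineDeriv_schwartzL2 φ _

theorem H1.fn_ofSchwartz (φ : 𝓢(Space d, ℂ)) : (H1.ofSchwartz φ).fn = φ.toLp 2 volume := rfl

/-- The `L^r` norm, as a real number, is Lipschitz on `H¹`. -/
theorem H1.exists_abs_eLpNorm_sub_le (d : ℕ) {r : ℝ} (hr2 : 2 < r)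
    (hrd : d * (1 / 2 - 1 / r) < 1) :
    ∃ C : ℝ, 0 < C ∧ (∀ f : H1 d, eLpNorm f.fn (ENNReal.ofReal r) ≤ ENNReal.ofReal (C * ‖f‖)) ∧
      ∀ f g : H1 d, |(eLpNorm f.fn (ENNReal.ofReal r)).toReal -
        (eLpNorm g.fn (ENNReal.ofReal r)).toReal| ≤ C * ‖f - g‖ := by
  obtain ⟨C, hC, h⟩ := H1.eLpNorm_fn_le d hr2 hrd
  have h1 : (1 : ℝ≥0∞) ≤ ENNReal.ofReal r := by
    rw [← ENNReal.ofReal_one]; exact ENNReal.ofReal_le_ofReal (by linarith)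
  have hfin : ∀ f : H1 d, eLpNorm f.fn (ENNReal.ofReal r) ≠ ⊤ := fun f =>
    ((h f).trans_lt ENNReal.ofReal_lt_top).ne
  have key : ∀ f g : H1 d, (eLpNorm f.fn (ENNReal.ofReal r)).toReal ≤
      (eLpNorm g.fn (ENNReal.ofReal r)).toReal + C * ‖f - g‖ := by
    intro f g
    have e : f.fn = g.fn + (f - g).fn := by rw [H1.fn_sub]; abel
    have h2 : eLpNorm f.fn (ENNReal.ofReal r) volume ≤ eLpNorm g.fn (ENNReal.ofReal r) volume +
        eLpNorm (f - g).fn (ENNReal.ofReal r) volume := by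
      rw [e, eLpNorm_congr_ae (Lp.coeFn_add _ _)]
      exact eLpNorm_add_le (Lp.aestronglyMeasurable _) (Lp.aestronglyMeasurable _) h1
    have h3 := h2.trans (add_le_add_right (h (f - g)) _)
    rw [← ENNReal.toReal_le_toReal (hfin f) (by finiteness [hfin g]),
      ENNReal.toReal_add (hfin g) ENNReal.ofReal_ne_top,
      ENNReal.toReal_ofReal (by positivity)] at h3
    exact h3
  refine ⟨C, hC, h, fun f g => abs_sub_le_iff.2 ⟨by linarith [key f g], ?_⟩⟩
  have := key g f
  rw [norm_sub_rev] at this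
  linarith

/-- The real-valued `L^r` norm. -/
def H1.lpNorm (r : ℝ) (f : H1 d) : ℝ := (eLpNorm f.fn (ENNReal.ofReal r)).toReal

theorem H1.lpNorm_nonneg (r : ℝ) (f : H1 d) : 0 ≤ H1.lpNorm r f := ENNReal.toReal_nonneg

theorem H1.ofReal_lpNorm {r : ℝ} (hr2 : 2 < r) (hrd : d * (1 / 2 - 1 / r) < 1) (f : H1 d) :
    ENNReal.ofReal (H1.lpNorm r f) = eLpNorm f.fn (ENNReal.ofReal r) := by
  obtain ⟨C, hC, h, -⟩ := H1.exists_abs_eLpNorm_sub_le d hr2 hrd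
  exact ENNReal.ofReal_toReal ((h f).trans_lt ENNReal.ofReal_lt_top).ne

theorem H1.continuous_lpNorm {r : ℝ} (hr2 : 2 < r) (hrd : d * (1 / 2 - 1 / r) < 1) :
    Continuous (H1.lpNorm r : H1 d → ℝ) := by
  obtain ⟨C, hC, -, h⟩ := H1.exists_abs_eLpNorm_sub_le d hr2 hrd
  refine (LipschitzWith.of_dist_le_mul (K := C.toNNReal) fun f g => ?_).continuous
  rw [Real.dist_eq, dist_eq_norm, Real.coe_toNNReal _ hC.le]
  exact h f g

theorem H1.exists_lpNorm_le (d : ℕ) {r : ℝ} (hr2 : 2 < r) (hrd : d * (1 / 2 - 1 / r) < 1) :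
    ∃ C : ℝ, 0 < C ∧ (∀ f : H1 d, H1.lpNorm r f ≤ C * ‖f‖) ∧
      ∀ f g : H1 d, |H1.lpNorm r f - H1.lpNorm r g| ≤ C * ‖f - g‖ := by
  obtain ⟨C, hC, h, h'⟩ := H1.exists_abs_eLpNorm_sub_le d hr2 hrd
  exact ⟨C, hC, fun f => ENNReal.toReal_le_of_le_ofReal (by positivity) (h f), h'⟩


/-- Lets test functions be chosen separately on each time slab, which avoids any measurable
selection in time. -/
theorem aestronglyMeasurable_floor {E : Type*} [NormedAddCommGroup E] (G : ℤ → ℝ → E)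
    (hG : ∀ k, Continuous (G k)) (h : ℝ) :
    AEStronglyMeasurable (fun t : ℝ => G ⌊t / h⌋ t) := by
  have hs : ∀ k : ℤ, MeasurableSet {t : ℝ | ⌊t / h⌋ = k} := fun k =>
    (Int.measurable_floor.comp (measurable_id.div_const h)) (measurableSet_singleton k)
  have hu : (⋃ k : ℤ, {t : ℝ | ⌊t / h⌋ = k}) = Set.univ := by
    ext t; simp
  rw [← Measure.restrict_univ (μ := (volume : Measure ℝ)), ← hu, aestronglyMeasurable_iUnion_iff]
  intro k
  refine (hG k).aestronglyMeasurable.congr ?_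
  filter_upwards [ae_restrict_mem (hs k)] with t ht
  rw [show ⌊t / h⌋ = k from ht]

theorem pairing_schrodingerL2_toLp (t : ℝ) (f : L2 d) (φ : 𝓢(Space d, ℂ)) :
    pairing d f (schrodingerL2 t (φ.toLp 2 volume)) = ∫ x, schrodingerL2 t f x * φ x := by
  rw [schrodingerL2_toLp, pairing_toLp, integral_schrodingerL2_mul]

/-- Piecewise constant Schwartz test functions nearly norming `S(t)f` in `L^r`. -/
theorem exists_test_functions {r r' : ℝ} (hr : r.HolderConjugate r') (hr2 : 2 < r)
    (hrd : d * (1 / 2 - 1 / r) < 1) (f : H1 d) {ε : ℝ} (hε : 0 < ε) :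
    ∃ (h : ℝ) (φ : ℤ → 𝓢(Space d, ℂ)), 0 < h ∧ (∀ k, eLpNorm (φ k) (ENNReal.ofReal r') ≤ 1) ∧
      ∀ t : ℝ, H1.lpNorm r (schrodingerH1 t f) - 3 * ε ≤
        (∫ x, schrodingerL2 t f.fn x * φ ⌊t / h⌋ x).re := by
  obtain ⟨C, hC, hb, hl⟩ := H1.exists_lpNorm_le d hr2 hrd
  have hcont := continuous_schrodingerH1_time f
  rw [Metric.continuous_iff] at hcont
  obtain ⟨η, hη, hη'⟩ := hcont 0 (ε / C) (by positivity)
  -- By the group law and unitarity, continuity of the orbit at time 0 is already uniform continuity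
  -- in time.
  have hdiff : ∀ s t, |s - t| < η → C * ‖schrodingerH1 s f - schrodingerH1 t f‖ ≤ ε := by
    intro s t hst
    have e : schrodingerH1 s f - schrodingerH1 t f =
        schrodingerH1 t (schrodingerH1 (s - t) f - schrodingerH1 0 f) := by
      rw [schrodingerH1_sub, schrodingerH1_schrodingerH1, schrodingerH1_schrodingerH1]
      simp
    rw [e, norm_schrodingerH1, ← dist_eq_norm, mul_comm, ← le_div_iff₀ hC]
    exact (hη' (s - t) (by simpa using hst)).le
  have hfin : ∀ g : H1 d, eLpNorm g.fn (ENNReal.ofReal r) volume ≠ ⊤ := fun g => by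
    rw [← H1.ofReal_lpNorm hr2 hrd]; exact ENNReal.ofReal_ne_top
  choose ψ hψ1 hψ2 using fun k : ℤ => exists_test_function
    (schrodingerH1 (k * (η / 2)) f).fn hr hr2.le (hfin _) hε
  refine ⟨η / 2, ψ, by positivity, hψ1, fun t => ?_⟩
  set k := ⌊t / (η / 2)⌋ with hk
  have hη2 : 0 < η / 2 := by positivity
  have hkt : |t - k * (η / 2)| < η := by
    have h1 := Int.floor_le (t / (η / 2))
    have h2 := Int.lt_floor_add_one (t / (η / 2))
    rw [← hk] at h1 h2
    rw [le_div_iff₀ hη2] at h1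
    rw [div_lt_iff₀ hη2] at h2
    rw [abs_lt]; constructor <;> linarith
  -- Three errors of size ε add up: the choice of a nearly norming function at the grid time, the
  -- drift of the norm since that time, and the drift of the pairing.
  have h1 := hdiff _ _ hkt
  have h2 := (abs_le.1 (hl (schrodingerH1 t f) (schrodingerH1 (k * (η / 2)) f))).2
  have h3 : H1.lpNorm r (schrodingerH1 (k * (η / 2)) f) - ε ≤
    (∫ x, (schrodingerH1 (k * (η / 2)) f).fn x * ψ k x).re := hψ2 k
  have h4 : ‖(∫ x, (schrodingerH1 t f).fn x * ψ k x) -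
      ∫ x, (schrodingerH1 (k * (η / 2)) f).fn x * ψ k x‖ ≤ ε := by
    rw [← pairing_toLp, ← pairing_toLp, ← sub_apply, ← map_sub, ← H1.fn_sub,
      pairing_toLp, ← ENNReal.ofReal_le_ofReal_iff hε.le, ofReal_norm]
    refine (enorm_integral_mul_le_holder (Lp.aestronglyMeasurable _)
      (ψ k).continuous.aestronglyMeasurable hr).trans ?_
    refine (mul_le_of_le_one_right' (hψ1 k)).trans ?_
    rw [← H1.ofReal_lpNorm hr2 hrd]
    exact ENNReal.ofReal_le_ofReal ((hb _).trans h1)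
  have h5 := (Complex.abs_re_le_norm _).trans h4
  rw [Complex.sub_re, abs_le] at h5
  rw [fn_schrodingerH1] at h5
  linarith [h5.1]

/-- The homogeneous Strichartz estimate for `H¹` data. -/
theorem exists_strichartz (d : ℕ) {r δ : ℝ} (hr2 : 2 < r) (hδ : δ = d * (1 / 2 - 1 / r))
    (hδ0 : 0 < δ) (hδ1 : δ < 1) :
    ∃ C : ℝ, 0 < C ∧ ∀ f : H1 d,
      (∫⁻ t, ENNReal.ofReal (H1.lpNorm r (schrodingerH1 t f)) ^ (2 / δ)) ^ (δ / 2) ≤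
        ENNReal.ofReal (C * ‖f.fn‖) := by
  have hr : r.HolderConjugate (r / (r - 1)) := Real.HolderConjugate.conjExponent (by linarith)
  obtain ⟨C, hC, hdual⟩ := exists_norm_integral_schrodinger_le d hr hr2 hδ hδ0 hδ1
  have hrd : d * (1 / 2 - 1 / r) < 1 := hδ ▸ hδ1
  refine ⟨C, hC, fun f => ?_⟩
  have hγ : (2 / δ).HolderConjugate (2 / (2 - δ)) := by
    rw [Real.holderConjugate_iff]
    refine ⟨by rw [lt_div_iff₀ hδ0]; linarith, ?_⟩
    have : 2 - δ ≠ 0 := by linarith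
    field_simp; ring
  set N : ℝ → ℝ := fun t => H1.lpNorm r (schrodingerH1 t f) with hN
  have hN0 : ∀ t, 0 ≤ N t := fun t => H1.lpNorm_nonneg _ _
  have hNc : Continuous N := (H1.continuous_lpNorm hr2 hrd).comp (continuous_schrodingerH1_time f)
  have hγ1 : 1 < 2 / δ := hγ.lt
  have hT : ∀ T : ℝ, (∫⁻ t in Set.Icc (-T) T, ENNReal.ofReal (N t) ^ (2 / δ)) ^ (δ / 2) ≤
      ENNReal.ofReal (C * ‖f.fn‖) := by
    intro T
    set I := Set.Icc (-T) T with hI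
    have hIm : MeasurableSet I := measurableSet_Icc
    -- The extremal weight N^{γ-1} with γ = 2/δ: both the integral of w N and that of w^{γ'} equal
    -- A. Restriction to a compact interval keeps A finite, so that a power of it can be divided
    -- out.
    set w : ℝ → ℝ := I.indicator fun t => N t ^ (2 / δ - 1) with hw
    have hpc : Continuous fun t => N t ^ (2 / δ - 1) :=
      hNc.rpow_const fun t => Or.inr (by linarith)
    have hwm : Measurable w := hpc.measurable.indicator hIm
    have hw0 : ∀ t, 0 ≤ w t := fun t =>
      Set.indicator_nonneg (fun t _ => Real.rpow_nonneg (hN0 t) _) t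
    have hwi : Integrable w := (hpc.integrableOn_Icc).integrable_indicator hIm
    have hNi : IntegrableOn (fun t => N t ^ (2 / δ)) I :=
      (hNc.rpow_const fun t => Or.inr (by linarith)).integrableOn_Icc
    set A : ℝ := ∫ t in I, N t ^ (2 / δ) with hA
    have hA0 : 0 ≤ A := integral_nonneg fun t => Real.rpow_nonneg (hN0 t) _
    have hlA : ∫⁻ t in I, ENNReal.ofReal (N t) ^ (2 / δ) = ENNReal.ofReal A := by
      rw [hA, ofReal_integral_eq_lintegral_ofReal hNi (ae_of_all _ fun t => Real.rpow_nonneg (hN0 t) _)]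
      refine lintegral_congr fun t => ?_
      rw [ENNReal.ofReal_rpow_of_nonneg (hN0 t) (by linarith)]
    have hwA : ∫⁻ t, ENNReal.ofReal (w t) ^ (2 / (2 - δ)) = ENNReal.ofReal A := by
      rw [← hlA, ← lintegral_indicator hIm]
      refine lintegral_congr fun t => ?_
      by_cases ht : t ∈ I
      · rw [hw, Set.indicator_of_mem ht, Set.indicator_of_mem ht,
          ← ENNReal.ofReal_rpow_of_nonneg (hN0 t) (by linarith), ← ENNReal.rpow_mul]
        congr 1
        have : 2 - δ ≠ 0 := by linarith
        field_simp
      · rw [hw, Set.indicator_of_notMem ht, Set.indicator_of_notMem ht, ENNReal.ofReal_zero,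
          ENNReal.zero_rpow_of_pos (by have := hγ.symm.pos; exact this)]
    have hwN : ∫ t, w t * N t = A := by
      rw [hA, ← integral_indicator hIm]
      refine integral_congr_ae (ae_of_all _ fun t => ?_)
      by_cases ht : t ∈ I
      · simp only [hw, Set.indicator_of_mem ht]
        rcases (hN0 t).eq_or_lt with h0 | h0
        · rw [← h0, mul_zero, Real.zero_rpow (by linarith)]
        · rw [← Real.rpow_add_one h0.ne']; ring_nf
      · simp only [hw, Set.indicator_of_notMem ht, zero_mul]
    have hwNi : Integrable fun t => w t * N t := by
      have : (fun t => w t * N t) = I.indicator fun t => N t ^ (2 / δ - 1) * N t := by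
        ext t
        by_cases ht : t ∈ I
        · simp only [hw, Set.indicator_of_mem ht]
        · simp only [hw, Set.indicator_of_notMem ht, zero_mul]
      rw [this]
      exact ((hpc.mul hNc).integrableOn_Icc).integrable_indicator hIm
    have main : ∀ ε : ℝ, 0 < ε → A - 3 * ε * ∫ t, w t ≤ ‖f.fn‖ * (C * A ^ ((2 - δ) / 2)) := by
      intro ε hε
      obtain ⟨h, φ, hh, hφ1, hφ2⟩ := exists_test_functions hr hr2 hrd f hε
      obtain ⟨M, hM⟩ : ∃ M : ℝ, ∀ t ∈ I, ‖schrodingerL2 t ((φ ⌊t / h⌋).toLp 2 volume)‖ ≤ M := by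
        refine ⟨∑ k ∈ Finset.Icc ⌊-T / h⌋ ⌊T / h⌋, ‖(φ k).toLp 2 volume‖, fun t ht => ?_⟩
        rw [norm_schrodingerL2]
        refine Finset.single_le_sum (f := fun k => ‖(φ k).toLp 2 volume‖)
          (fun k _ => norm_nonneg _) (Finset.mem_Icc.2 ⟨?_, ?_⟩)
        · exact Int.floor_le_floor (by have := ht.1; gcongr)
        · exact Int.floor_le_floor (by have := ht.2; gcongr)
      have hmeas : AEStronglyMeasurable
          (fun t : ℝ => schrodingerL2 t ((φ ⌊t / h⌋).toLp 2 volume)) :=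
        aestronglyMeasurable_floor (fun k t => schrodingerL2 t ((φ k).toLp 2 volume))
          (fun k => continuous_schrodingerL2_time _) h
      have hint : Integrable
          (fun t => (w t : ℂ) • schrodingerL2 t ((φ ⌊t / h⌋).toLp 2 volume)) := by
        refine (hwi.mul_const M).mono'
          ((Complex.measurable_ofReal.comp hwm).aestronglyMeasurable.smul hmeas)
          (ae_of_all _ fun t => ?_)
        rw [norm_smul, Complex.norm_real, Real.norm_of_nonneg (hw0 t)]
        by_cases ht : t ∈ I
        · exact mul_le_mul_of_nonneg_left (hM t ht) (hw0 t)
        · simp only [hw, Set.indicator_of_notMem ht, zero_mul, le_refl]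
      have h1 := hdual (fun t => φ ⌊t / h⌋) w hwm hw0 (fun t => hφ1 _) hint
      obtain ⟨Ψ, hΨ⟩ : ∃ Ψ : L2 d,
        Ψ = ∫ t, (w t : ℂ) • schrodingerL2 t ((φ ⌊t / h⌋).toLp 2 volume) := ⟨_, rfl⟩
      rw [← hΨ, hwA, ENNReal.ofReal_rpow_of_nonneg hA0 (by linarith), ← ENNReal.ofReal_mul hC.le,
        ← ofReal_norm, ENNReal.ofReal_le_ofReal_iff (by positivity)] at h1
      have h2 : pairing d f.fn Ψ =
          ∫ t, (w t : ℂ) * ∫ x, schrodingerL2 t f.fn x * φ ⌊t / h⌋ x := by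
        rw [hΨ, ← ContinuousLinearMap.integral_comp_comm _ hint]
        refine integral_congr_ae (ae_of_all _ fun t => ?_)
        simp only [map_smul, smul_eq_mul, pairing_schrodingerL2_toLp]
      have hi2 : Integrable
          (fun t => (w t : ℂ) * ∫ x, schrodingerL2 t f.fn x * φ ⌊t / h⌋ x) := by
        refine ((pairing d f.fn).integrable_comp hint).congr (ae_of_all _ fun t => ?_)
        simp only [map_smul, smul_eq_mul, pairing_schrodingerL2_toLp]
      have h3 : A - 3 * ε * ∫ t, w t ≤ (pairing d f.fn Ψ).re := by
        rw [h2, ← hwN, ← integral_const_mul, ← integral_sub hwNi (hwi.const_mul _)]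
        have e : (∫ t, (w t : ℂ) * ∫ x, schrodingerL2 t f.fn x * φ ⌊t / h⌋ x).re =
            ∫ t, ((w t : ℂ) * ∫ x, schrodingerL2 t f.fn x * φ ⌊t / h⌋ x).re :=
          (integral_re hi2).symm
        rw [e]
        refine integral_mono (hwNi.sub (hwi.const_mul _)) hi2.re fun t => ?_
        simp only [Complex.re_ofReal_mul]
        have := mul_le_mul_of_nonneg_left (hφ2 t) (hw0 t)
        calc _ = w t * (N t - 3 * ε) := by ring
          _ ≤ _ := this
      calc _ ≤ (pairing d f.fn Ψ).re := h3
        _ ≤ ‖pairing d f.fn Ψ‖ := Complex.re_le_norm _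
        _ ≤ ‖f.fn‖ * ‖Ψ‖ := norm_pairing_le _ _
        _ ≤ _ := by gcongr
    have hfinal : A ≤ ‖f.fn‖ * (C * A ^ ((2 - δ) / 2)) := by
      have ht : Tendsto (fun ε : ℝ => A - 3 * ε * ∫ t, w t) (𝓝[>] 0) (𝓝 A) := by
        have : Continuous fun ε : ℝ => A - 3 * ε * ∫ t, w t := by fun_prop
        have h := (this.tendsto 0).mono_left (nhdsWithin_le_nhds (s := Set.Ioi 0))
        simpa using h
      refine le_of_tendsto ht ?_
      filter_upwards [self_mem_nhdsWithin] with ε hε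
      exact main ε hε
    rw [hlA]
    have h5 : ENNReal.ofReal A ≤
        ENNReal.ofReal (C * ‖f.fn‖) * ENNReal.ofReal A ^ (1 / (2 / (2 - δ))) := by
      rw [one_div_div, ENNReal.ofReal_rpow_of_nonneg hA0 (by linarith),
        ← ENNReal.ofReal_mul (by positivity)]
      exact ENNReal.ofReal_le_ofReal (hfinal.trans (le_of_eq (by ring)))
    have := rpow_le_of_le_mul_rpow hγ ENNReal.ofReal_ne_top h5
    rwa [one_div_div] at this
  have hmono : Monotone fun n : ℕ => Set.Icc (-(n : ℝ)) n := fun m n hmn => by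
    have : (m : ℝ) ≤ n := by exact_mod_cast hmn
    exact Set.Icc_subset_Icc (by linarith) this
  have hU : ⋃ n : ℕ, Set.Icc (-(n : ℝ)) n = Set.univ := by
    ext t
    obtain ⟨n, hn⟩ := exists_nat_ge |t|
    simp only [Set.mem_iUnion, Set.mem_univ, iff_true]
    exact ⟨n, abs_le.1 hn⟩
  have hlim : Tendsto (fun n : ℕ => ∫⁻ t in Set.Icc (-(n : ℝ)) n, ENNReal.ofReal (N t) ^ (2 / δ))
      atTop (𝓝 (∫⁻ t, ENNReal.ofReal (N t) ^ (2 / δ))) := by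
    have h := tendsto_atTop_iSup (α := ℝ≥0∞)
      (f := fun n : ℕ => ∫⁻ t in Set.Icc (-(n : ℝ)) n, ENNReal.ofReal (N t) ^ (2 / δ))
      fun m n hmn => lintegral_mono_set (hmono hmn)
    rwa [← setLIntegral_iUnion_of_directed _ hmono.directed_le, hU, setLIntegral_univ] at h
  exact le_of_tendsto (hlim.ennrpow_const (δ / 2)) (Eventually.of_forall fun n => hT n)


/-! ### Lipschitz bounds for the nonlinearity. -/

/-- With |w| ≤ |z|, split into |z|^p (z-w) and (|z|^p - |w|^p) w. The second piece costs twice the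
first, since p ≤ 2 makes |z|^p - |w|^p at most 2|z|^p (1 - |w|/|z|). -/
theorem norm_rpow_mul_sub_le {p : ℝ} (hp0 : 0 < p) (hp2 : p ≤ 2) (z w : ℂ) :
    ‖((‖z‖ ^ p : ℝ) : ℂ) * z - ((‖w‖ ^ p : ℝ) : ℂ) * w‖ ≤
      3 * (‖z‖ ^ p + ‖w‖ ^ p) * ‖z - w‖ := by
  have key : ∀ z w : ℂ, ‖w‖ ≤ ‖z‖ →
      ‖((‖z‖ ^ p : ℝ) : ℂ) * z - ((‖w‖ ^ p : ℝ) : ℂ) * w‖ ≤ 3 * ‖z‖ ^ p * ‖z - w‖ := by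
    intro z w hwz
    rcases (norm_nonneg z).eq_or_lt with h0 | h0
    · have hz : z = 0 := norm_eq_zero.1 h0.symm
      have hw : w = 0 := norm_eq_zero.1 (le_antisymm (h0 ▸ hwz) (norm_nonneg _))
      simp [hz, hw]
    have hzp : 0 < ‖z‖ ^ p := Real.rpow_pos_of_pos h0 p
    have e : ((‖z‖ ^ p : ℝ) : ℂ) * z - ((‖w‖ ^ p : ℝ) : ℂ) * w =
        ((‖z‖ ^ p : ℝ) : ℂ) * (z - w) + ((‖z‖ ^ p - ‖w‖ ^ p : ℝ) : ℂ) * w := by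
      push_cast; ring
    have hmono : ‖w‖ ^ p ≤ ‖z‖ ^ p := Real.rpow_le_rpow (norm_nonneg _) hwz hp0.le
    have hq : ‖z‖ ^ p - ‖w‖ ^ p ≤ ‖z‖ ^ p * (2 * (1 - ‖w‖ / ‖z‖)) := by
      set s := ‖w‖ / ‖z‖ with hs
      have hs0 : 0 ≤ s := by positivity
      have hs1 : s ≤ 1 := (div_le_one h0).2 hwz
      have hws : ‖w‖ = s * ‖z‖ := by rw [hs]; field_simp
      -- With s ≤ 1 and p ≤ 2 the power s^p dominates s², hence 1 - s^p ≤ 1 - s² ≤ 2(1 - s).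
      have h2 : s ^ 2 ≤ s ^ p := by
        rcases hs0.eq_or_lt with h | h
        · rw [← h, Real.zero_rpow hp0.ne']; norm_num
        · rw [← Real.rpow_natCast]
          exact Real.rpow_le_rpow_of_exponent_ge h hs1 (by exact_mod_cast hp2)
      rw [hws, Real.mul_rpow hs0 h0.le]
      have : 1 - s ^ p ≤ 2 * (1 - s) := by nlinarith [sq_nonneg (1 - s)]
      nlinarith
    have hr : (‖z‖ ^ p - ‖w‖ ^ p) * ‖w‖ ≤ 2 * ‖z‖ ^ p * ‖z - w‖ := by
      calc (‖z‖ ^ p - ‖w‖ ^ p) * ‖w‖ ≤ (‖z‖ ^ p * (2 * (1 - ‖w‖ / ‖z‖))) * ‖z‖ :=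
            mul_le_mul hq hwz (norm_nonneg _) (by
              have : ‖w‖ / ‖z‖ ≤ 1 := (div_le_one h0).2 hwz
              exact mul_nonneg hzp.le (by linarith))
        _ = 2 * ‖z‖ ^ p * (‖z‖ - ‖w‖) := by field_simp
        _ ≤ _ := by gcongr; exact norm_sub_norm_le z w
    rw [e]
    refine (norm_add_le _ _).trans ?_
    rw [norm_mul, norm_mul, Complex.norm_real, Complex.norm_real, Real.norm_of_nonneg hzp.le,
      Real.norm_of_nonneg (by linarith)]
    linarith
  have hz := Real.rpow_nonneg (norm_nonneg z) p
  have hw := Real.rpow_nonneg (norm_nonneg w) p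
  rcases le_total ‖w‖ ‖z‖ with h | h
  · exact (key z w h).trans (by gcongr; linarith)
  · rw [norm_sub_rev, norm_sub_rev z w]
    exact (key w z h).trans (by gcongr; linarith)

/-- Hölder with the power h^p placed in L^{a/p}. It serves in space for the nonlinearity, in time
for Duhamel terms, and for interpolating Lebesgue norms. -/
theorem lintegral_rpow_mul_le {α : Type*} [MeasurableSpace α] {μ : Measure α} {h k : α → ℝ≥0∞}
    (hh : AEMeasurable h μ) (hk : AEMeasurable k μ) {p a b c : ℝ} (hp : 0 < p) (ha : 0 < a)
    (hb : 0 < b) (habc : 1 / c = p / a + 1 / b) :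
    (∫⁻ x, (h x ^ p * k x) ^ c ∂μ) ^ (1 / c) ≤
      ((∫⁻ x, h x ^ a ∂μ) ^ (1 / a)) ^ p * (∫⁻ x, k x ^ b ∂μ) ^ (1 / b) := by
  have hc : 0 < c := by
    have : 0 < 1 / c := habc ▸ by positivity
    exact one_div_pos.1 this
  have hlt : c < a / p := by
    rw [← one_div_lt_one_div (by positivity) hc, habc, one_div_div]
    have : 0 < 1 / b := by positivity
    linarith
  have h1 := ENNReal.lintegral_Lp_mul_le_Lq_mul_Lr (p := c) (q := a / p) (r := b) hc hlt
    (by rw [habc, one_div_div]) μ (f := fun x => h x ^ p) (g := k) (hh.pow_const p) hk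
  refine h1.trans (le_of_eq ?_)
  simp_rw [← ENNReal.rpow_mul]
  congr 2
  · refine congrArg (fun y => y) (lintegral_congr fun x => ?_)
    congr 1; field_simp
  · rw [one_div_div]; ring

theorem continuous_nonlinearity (hd : 2 ≤ d) : Continuous (nonlinearity d) := by
  have h1 : (1 : ℝ) < d := by exact_mod_cast hd
  refine (Complex.continuous_ofReal.comp (continuous_norm.rpow_const fun z => Or.inr ?_)).mul
    continuous_id
  exact div_nonneg (by norm_num) (by linarith)

theorem power_pos (hd : 3 ≤ d) : 0 < 4 / ((d : ℝ) - 1) := by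
  have h1 : (3 : ℝ) ≤ d := by exact_mod_cast hd
  exact div_pos (by norm_num) (by linarith)

theorem power_le (hd : 3 ≤ d) : 4 / ((d : ℝ) - 1) ≤ 2 := by
  have h1 : (3 : ℝ) ≤ d := by exact_mod_cast hd
  rw [div_le_iff₀ (by linarith)]; linarith

theorem norm_nonlinearity_sub_le (hd : 3 ≤ d) (z w : ℂ) :
    ‖nonlinearity d z - nonlinearity d w‖ ≤
      3 * (‖z‖ ^ (4 / ((d : ℝ) - 1)) + ‖w‖ ^ (4 / ((d : ℝ) - 1))) * ‖z - w‖ :=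
  norm_rpow_mul_sub_le (power_pos hd) (power_le hd) z w

theorem nonlinearity_zero : nonlinearity d 0 = 0 := by simp [nonlinearity]

/-- The nonlinearity is locally Lipschitz from `L^s` to `L^c` if `1/c = (p+1)/s`. -/
theorem H1.eLpNorm_nonlinearity_sub_le (hd : 3 ≤ d) {s c : ℝ} (hs2 : 2 < s)
    (hsd : d * (1 / 2 - 1 / s) < 1) (hc1 : 1 ≤ c)
    (hcs : 1 / c = 4 / ((d : ℝ) - 1) / s + 1 / s) (f g : H1 d) :
    eLpNorm (fun x => nonlinearity d (f.fn x) - nonlinearity d (g.fn x)) (ENNReal.ofReal c) ≤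
      ENNReal.ofReal (3 * (H1.lpNorm s f ^ (4 / ((d : ℝ) - 1)) +
        H1.lpNorm s g ^ (4 / ((d : ℝ) - 1))) * H1.lpNorm s (f - g)) := by
  have hp := power_pos hd
  obtain ⟨p, hpe⟩ : ∃ p : ℝ, p = 4 / ((d : ℝ) - 1) := ⟨_, rfl⟩
  have hnl := norm_nonlinearity_sub_le hd
  rw [← hpe] at hp hcs ⊢
  simp_rw [← hpe] at hnl
  have hs0 : 0 < s := by linarith
  have hc0 : 0 < c := by linarith
  have hae : ∀ f : H1 d, AEMeasurable (fun x => ‖f.fn x‖ₑ) volume := fun f =>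
    (Lp.aestronglyMeasurable f.fn).enorm
  have piece : ∀ f k : H1 d, (∫⁻ x, (‖f.fn x‖ₑ ^ p * ‖k.fn x‖ₑ) ^ c) ^ (1 / c) ≤
      ENNReal.ofReal (H1.lpNorm s f ^ p * H1.lpNorm s k) := by
    intro f k
    refine (lintegral_rpow_mul_le (hae f) (hae k) hp hs0 hs0 hcs).trans (le_of_eq ?_)
    rw [ENNReal.ofReal_mul (Real.rpow_nonneg (H1.lpNorm_nonneg _ _) _),
      ← ENNReal.ofReal_rpow_of_nonneg (H1.lpNorm_nonneg _ _) hp.le,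
      H1.ofReal_lpNorm hs2 hsd, H1.ofReal_lpNorm hs2 hsd, eLpNorm_ofReal_eq hs0,
      eLpNorm_ofReal_eq hs0]
  rw [eLpNorm_ofReal_eq hc0]
  have hpt : ∀ᵐ x, ‖nonlinearity d (f.fn x) - nonlinearity d (g.fn x)‖ₑ ^ c ≤
      ((fun x => 3 * (‖f.fn x‖ₑ ^ p * ‖(f - g).fn x‖ₑ)) +
        (fun x => 3 * (‖g.fn x‖ₑ ^ p * ‖(f - g).fn x‖ₑ))) x ^ c := by
    have h0 : ((f - g).fn : Space d → ℂ) =ᵐ[volume] f.fn - g.fn := by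
      rw [H1.fn_sub]; exact Lp.coeFn_sub _ _
    filter_upwards [h0] with x hx
    refine ENNReal.rpow_le_rpow ?_ hc0.le
    have h1 := ENNReal.ofReal_le_ofReal (hnl (f.fn x) (g.fn x))
    rw [ofReal_norm, ENNReal.ofReal_mul (by positivity), ENNReal.ofReal_mul (by norm_num),
      ENNReal.ofReal_add (by positivity) (by positivity), ofReal_norm,
      ← ENNReal.ofReal_rpow_of_nonneg (norm_nonneg _) hp.le,
      ← ENNReal.ofReal_rpow_of_nonneg (norm_nonneg _) hp.le, ofReal_norm, ofReal_norm] at h1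
    refine h1.trans (le_of_eq ?_)
    rw [Pi.add_apply, hx, Pi.sub_apply, ENNReal.ofReal_ofNat]; ring
  have m : ∀ f k : H1 d, AEMeasurable (fun x => 3 * (‖f.fn x‖ₑ ^ p * ‖k.fn x‖ₑ)) volume :=
    fun f k => (((hae f).pow_const p).mul (hae k)).const_mul 3
  have scale : ∀ f k : H1 d, (∫⁻ x, (3 * (‖f.fn x‖ₑ ^ p * ‖k.fn x‖ₑ)) ^ c) ^ (1 / c) ≤
      3 * ENNReal.ofReal (H1.lpNorm s f ^ p * H1.lpNorm s k) := by
    intro f k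
    simp_rw [ENNReal.mul_rpow_of_nonneg _ _ hc0.le]
    rw [lintegral_const_mul'' _ ?_, ENNReal.mul_rpow_of_nonneg _ _ (by positivity),
      ← ENNReal.rpow_mul, mul_one_div_cancel hc0.ne', ENNReal.rpow_one]
    · simp_rw [← ENNReal.mul_rpow_of_nonneg _ _ hc0.le]
      exact mul_le_mul_right (piece f k) _
    · simp_rw [← ENNReal.mul_rpow_of_nonneg _ _ hc0.le]
      exact (((hae f).pow_const p).mul (hae k)).pow_const c
  refine (ENNReal.rpow_le_rpow (lintegral_mono_ae hpt) (by positivity)).trans ?_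
  refine (ENNReal.lintegral_Lp_add_le (m f (f - g)) (m g (f - g)) hc1).trans ?_
  refine (add_le_add (scale _ _) (scale _ _)).trans (le_of_eq ?_)
  have n1 := Real.rpow_nonneg (H1.lpNorm_nonneg s f) p
  have n2 := Real.rpow_nonneg (H1.lpNorm_nonneg s g) p
  have n3 := H1.lpNorm_nonneg s (f - g)
  rw [← mul_add, ← ENNReal.ofReal_add (by positivity) (by positivity),
    show (3 : ℝ≥0∞) = ENNReal.ofReal 3 by simp, ← ENNReal.ofReal_mul (by norm_num)]
  congr 1; ring


/-! ### The potential-energy exponent and the pairing with the nonlinearity. -/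

/-- The exponent `p + 2` of the potential energy. -/
def energyExp (d : ℕ) : ℝ := 2 * ((d : ℝ) + 1) / ((d : ℝ) - 1)

theorem three_le_cast (hd : 3 ≤ d) : (3 : ℝ) ≤ d := by exact_mod_cast hd

theorem two_lt_energyExp (hd : 3 ≤ d) : 2 < energyExp d := by
  have := three_le_cast hd
  rw [energyExp, lt_div_iff₀ (by linarith)]; linarith

/-- The dispersive rate on L^{p+2}. Being below 1 it makes the kernel locally integrable, which both
Sobolev and fractional integration require. -/
theorem decay_energyExp (hd : 3 ≤ d) : (d : ℝ) * (1 / 2 - 1 / energyExp d) = d / (d + 1) := by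
  have := three_le_cast hd
  have h1 : (d : ℝ) - 1 ≠ 0 := by linarith
  rw [energyExp]; field_simp; ring

theorem decay_energyExp_lt (hd : 3 ≤ d) : (d : ℝ) * (1 / 2 - 1 / energyExp d) < 1 := by
  rw [decay_energyExp hd, div_lt_one (by positivity)]; linarith

theorem energyExp_conj (hd : 3 ≤ d) :
    (energyExp d).HolderConjugate (2 * ((d : ℝ) + 1) / ((d : ℝ) + 3)) := by
  have := three_le_cast hd
  rw [Real.holderConjugate_iff]
  refine ⟨by linarith [two_lt_energyExp hd], ?_⟩
  rw [energyExp]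
  have h1 : (d : ℝ) - 1 ≠ 0 := by linarith
  field_simp; ring

/-- The dual exponent of p+2 is (p+2)/(p+1), so the nonlinearity sends L^{p+2} to its dual and pairs
with H¹ functions. -/
theorem energyExp_dual (hd : 3 ≤ d) : 1 / (2 * ((d : ℝ) + 1) / ((d : ℝ) + 3)) =
    4 / ((d : ℝ) - 1) / energyExp d + 1 / energyExp d := by
  have := three_le_cast hd
  rw [energyExp]
  have h1 : (d : ℝ) - 1 ≠ 0 := by linarith
  field_simp; ring

/-- The norm of `L^{p+2}`. -/
abbrev H1.enNorm (f : H1 d) : ℝ := H1.lpNorm (energyExp d) f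

theorem H1.coeFn_fn_zero : ((0 : H1 d).fn : Space d → ℂ) =ᵐ[volume] 0 := Lp.coeFn_zero _ _ _

theorem H1.lpNorm_zero (s : ℝ) : H1.lpNorm s (0 : H1 d) = 0 := by
  rw [H1.lpNorm, eLpNorm_congr_ae H1.coeFn_fn_zero, eLpNorm_zero, ENNReal.toReal_zero]

theorem H1.memLp_nonlinearity (hd : 3 ≤ d) (f : H1 d) :
    MemLp (fun x => nonlinearity d (f.fn x))
      (ENNReal.ofReal (2 * ((d : ℝ) + 1) / ((d : ℝ) + 3))) := by
  refine ⟨(continuous_nonlinearity (by omega)).comp_aestronglyMeasurable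
    (Lp.aestronglyMeasurable _), ?_⟩
  have h := H1.eLpNorm_nonlinearity_sub_le hd (two_lt_energyExp hd) (decay_energyExp_lt hd)
    (energyExp_conj hd).symm.lt.le (energyExp_dual hd) f 0
  refine lt_of_le_of_lt (le_of_eq ?_) (h.trans_lt ENNReal.ofReal_lt_top)
  refine eLpNorm_congr_ae ?_
  filter_upwards [H1.coeFn_fn_zero (d := d)] with x hx
  rw [hx, Pi.zero_apply, nonlinearity_zero, sub_zero]

theorem H1.memLp_fn {r : ℝ} (hr2 : 2 < r) (hrd : d * (1 / 2 - 1 / r) < 1) (f : H1 d) :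
    MemLp f.fn (ENNReal.ofReal r) volume :=
  ⟨Lp.aestronglyMeasurable _, by
    rw [← H1.ofReal_lpNorm hr2 hrd]; exact ENNReal.ofReal_lt_top⟩

theorem H1.integrable_nonlinearity_mul (hd : 3 ≤ d) (f k : H1 d) :
    Integrable fun x => nonlinearity d (f.fn x) * k.fn x := by
  have := (energyExp_conj hd).symm.ennrealOfReal
  exact (H1.memLp_nonlinearity hd f).integrable_mul
    (H1.memLp_fn (two_lt_energyExp hd) (decay_energyExp_lt hd) k)

/-- The pairing of the nonlinearity with a function. -/
def nlPair (f k : H1 d) : ℂ := ∫ x, nonlinearity d (f.fn x) * k.fn x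

theorem nlPair_sub_right (hd : 3 ≤ d) (f k l : H1 d) :
    nlPair f k - nlPair f l = nlPair f (k - l) := by
  rw [nlPair, nlPair, ← integral_sub (H1.integrable_nonlinearity_mul hd f k)
    (H1.integrable_nonlinearity_mul hd f l)]
  refine integral_congr_ae ?_
  have h : ((k - l).fn : Space d → ℂ) =ᵐ[volume] k.fn - l.fn := by
    rw [H1.fn_sub]; exact Lp.coeFn_sub _ _
  filter_upwards [h] with x hx
  rw [hx, Pi.sub_apply]; ring

/-- Bound for the pairing of a difference of nonlinearities in an arbitrary pair of dual
exponents. -/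
theorem enorm_nlPair_sub_le_holder (hd : 3 ≤ d) {r r' : ℝ} (hr : r.HolderConjugate r')
    (f g k : H1 d) :
    ‖nlPair f k - nlPair g k‖ₑ ≤ eLpNorm k.fn (ENNReal.ofReal r) *
      eLpNorm (fun x => nonlinearity d (f.fn x) - nonlinearity d (g.fn x)) (ENNReal.ofReal r') := by
  have hc : ∀ f : H1 d, AEStronglyMeasurable (fun x => nonlinearity d (f.fn x)) volume := fun f =>
    (continuous_nonlinearity (by omega)).comp_aestronglyMeasurable (Lp.aestronglyMeasurable _)
  rw [nlPair, nlPair, ← integral_sub (H1.integrable_nonlinearity_mul hd f k)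
    (H1.integrable_nonlinearity_mul hd g k)]
  simp_rw [← sub_mul, mul_comm (_ - _)]
  exact enorm_integral_mul_le_holder (Lp.aestronglyMeasurable _) ((hc f).sub (hc g)) hr

/-- The size of the difference of the nonlinearities, measured in the dual of `L^{p+2}`. -/
def nlBound (f g : H1 d) : ℝ :=
  3 * (H1.enNorm f ^ (4 / ((d : ℝ) - 1)) + H1.enNorm g ^ (4 / ((d : ℝ) - 1))) * H1.enNorm (f - g)

theorem nlBound_nonneg (f g : H1 d) : 0 ≤ nlBound f g := by
  have n1 := Real.rpow_nonneg (H1.lpNorm_nonneg (energyExp d) f) (4 / ((d : ℝ) - 1))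
  have n2 := Real.rpow_nonneg (H1.lpNorm_nonneg (energyExp d) g) (4 / ((d : ℝ) - 1))
  have n3 := H1.lpNorm_nonneg (energyExp d) (f - g)
  unfold nlBound H1.enNorm
  positivity

theorem eLpNorm_nonlinearity_sub_le_nlBound (hd : 3 ≤ d) (f g : H1 d) :
    eLpNorm (fun x => nonlinearity d (f.fn x) - nonlinearity d (g.fn x))
      (ENNReal.ofReal (2 * ((d : ℝ) + 1) / ((d : ℝ) + 3))) ≤ ENNReal.ofReal (nlBound f g) :=
  H1.eLpNorm_nonlinearity_sub_le hd (two_lt_energyExp hd) (decay_energyExp_lt hd)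
    (energyExp_conj hd).symm.lt.le (energyExp_dual hd) f g

theorem norm_nlPair_sub_le (hd : 3 ≤ d) (f g k : H1 d) :
    ‖nlPair f k - nlPair g k‖ ≤ H1.enNorm k * nlBound f g := by
  have hk := H1.lpNorm_nonneg (energyExp d) k
  have hb := nlBound_nonneg f g
  rw [← ENNReal.ofReal_le_ofReal_iff (mul_nonneg hk hb), ofReal_norm, ENNReal.ofReal_mul hk,
    H1.ofReal_lpNorm (two_lt_energyExp hd) (decay_energyExp_lt hd)]
  exact (enorm_nlPair_sub_le_holder hd (energyExp_conj hd) f g k).trans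
    (mul_le_mul_right (eLpNorm_nonlinearity_sub_le_nlBound hd f g) _)

theorem continuous_enNorm (hd : 3 ≤ d) : Continuous (H1.enNorm : H1 d → ℝ) :=
  H1.continuous_lpNorm (two_lt_energyExp hd) (decay_energyExp_lt hd)

theorem continuous_nlBound (hd : 3 ≤ d) : Continuous fun q : H1 d × H1 d => nlBound q.1 q.2 := by
  have hp := power_pos hd
  unfold nlBound
  have h := continuous_enNorm hd
  refine (continuous_const.mul (Continuous.add ?_ ?_)).mul ?_
  · exact (h.comp continuous_fst).rpow_const fun _ => Or.inr hp.le
  · exact (h.comp continuous_snd).rpow_const fun _ => Or.inr hp.le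
  · exact h.comp (continuous_fst.sub continuous_snd)

theorem nlPair_zero_left (k : H1 d) : nlPair 0 k = 0 := by
  rw [nlPair, integral_congr_ae (g := fun _ => (0 : ℂ)) _, integral_zero]
  filter_upwards [H1.coeFn_fn_zero (d := d)] with x hx
  rw [hx, Pi.zero_apply, nonlinearity_zero, zero_mul]

theorem nlBound_self (f : H1 d) : nlBound f f = 0 := by
  rw [nlBound, sub_self, H1.enNorm, H1.enNorm, H1.lpNorm_zero, mul_zero]

theorem continuous_nlPair (hd : 3 ≤ d) : Continuous fun q : H1 d × H1 d => nlPair q.1 q.2 := by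
  rw [continuous_iff_continuousAt]
  rintro ⟨f₀, k₀⟩
  rw [ContinuousAt, tendsto_iff_norm_sub_tendsto_zero]
  have hc : Continuous fun q : H1 d × H1 d =>
      H1.enNorm q.2 * nlBound q.1 f₀ + H1.enNorm (q.2 - k₀) * nlBound f₀ 0 := by
    have h := continuous_enNorm (d := d) hd
    have hb : Continuous fun q : H1 d × H1 d => nlBound q.1 f₀ :=
      (continuous_nlBound hd).comp (continuous_fst.prodMk continuous_const)
    exact ((h.comp continuous_snd).mul hb).add
      ((h.comp (continuous_snd.sub continuous_const)).mul continuous_const)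
  have h0 := hc.tendsto (f₀, k₀)
  simp only [sub_self, nlBound_self, mul_zero, H1.enNorm, H1.lpNorm_zero, zero_mul, add_zero] at h0
  refine squeeze_zero (fun _ => norm_nonneg _) (fun q => ?_) h0
  have e : nlPair q.1 q.2 - nlPair f₀ k₀ = (nlPair q.1 q.2 - nlPair f₀ q.2) +
      (nlPair f₀ (q.2 - k₀) - nlPair 0 (q.2 - k₀)) := by
    rw [nlPair_zero_left, sub_zero, ← nlPair_sub_right hd]; ring
  rw [e]
  exact (norm_add_le _ _).trans (add_le_add (norm_nlPair_sub_le hd _ _ _)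
    (norm_nlPair_sub_le hd _ _ _))

/-! ### Duhamel's formula between two arbitrary times. -/

theorem integral_nonlinearity_mul_schwartz (t : ℝ) (f : H1 d) (φ : 𝓢(Space d, ℂ)) :
    ∫ x, nonlinearity d (f.fn x) * schrodingerSchwartz t φ x =
      nlPair f (schrodingerH1 t (H1.ofSchwartz φ)) := by
  rw [nlPair]
  refine integral_congr_ae ?_
  have h : ((schrodingerH1 t (H1.ofSchwartz φ)).fn : Space d → ℂ) =ᵐ[volume]
      schrodingerSchwartz t φ := by
    rw [fn_schrodingerH1, H1.fn_ofSchwartz, schrodingerL2_toLp]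
    exact SchwartzMap.coeFn_toLp _ _ _
  filter_upwards [h] with x hx
  rw [hx]

/-- Duhamel's formula in the moving frame. -/
theorem IsGlobalSolution.pairing_eq {u : ℝ → H1 d} (hu : IsGlobalSolution u) (t t₁ : ℝ)
    (φ : 𝓢(Space d, ℂ)) :
    ∫ x, (schrodingerH1 (t - t₁) (u t₁)).fn x * φ x =
      (∫ x, (schrodingerH1 t (u 0)).fn x * φ x) +
        Complex.I * ∫ s in (0 : ℝ)..t₁, nlPair (u s) (schrodingerH1 (t - s) (H1.ofSchwartz φ)) := by
  -- The formula at time t₁ is tested against the evolved function e^{i(t-t₁)Δ}φ, and symmetry moves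
  -- the group back onto u.
  have h := hu.duhamel t₁ (schrodingerSchwartz (t - t₁) φ)
  rw [fn_schrodingerH1, integral_schrodingerL2_mul, h, fn_schrodingerH1, fn_schrodingerH1,
    ← integral_schrodingerL2_mul, schrodingerL2_schrodingerL2]
  congr 2
  · rw [sub_add_cancel]
  · refine intervalIntegral.integral_congr fun s _ => ?_
    rw [schrodingerSchwartz_schrodingerSchwartz, integral_nonlinearity_mul_schwartz,
      show t₁ - s + (t - t₁) = t - s by ring]

theorem IsGlobalSolution.continuous_nlPair (hd : 3 ≤ d) {u : ℝ → H1 d} (hu : IsGlobalSolution u)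
    (t : ℝ) (k : H1 d) : Continuous fun s => nlPair (u s) (schrodingerH1 (t - s) k) := by
  have hsub : Continuous fun s : ℝ => t - s := continuous_const.sub continuous_id
  have h : Continuous fun s : ℝ => schrodingerH1 (t - s) k :=
    Continuous.comp (g := fun τ => schrodingerH1 τ k) (continuous_schrodingerH1_time k) hsub
  exact Continuous.comp (g := fun q : H1 d × H1 d => nlPair q.1 q.2)
    (f := fun s => (u s, schrodingerH1 (t - s) k)) (NLS.continuous_nlPair hd)
    (hu.continuous.prodMk h)

theorem IsGlobalSolution.pairing_sub (hd : 3 ≤ d) {u : ℝ → H1 d} (hu : IsGlobalSolution u)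
    (t t₁ t₂ : ℝ) (φ : 𝓢(Space d, ℂ)) :
    (∫ x, (schrodingerH1 (t - t₂) (u t₂)).fn x * φ x) -
      (∫ x, (schrodingerH1 (t - t₁) (u t₁)).fn x * φ x) =
      Complex.I * ∫ s in t₁..t₂, nlPair (u s) (schrodingerH1 (t - s) (H1.ofSchwartz φ)) := by
  have hc := hu.continuous_nlPair hd t (H1.ofSchwartz φ)
  rw [hu.pairing_eq, hu.pairing_eq, add_sub_add_left_eq_sub, ← mul_sub,
    intervalIntegral.integral_interval_sub_left (hc.intervalIntegrable _ _)
      (hc.intervalIntegrable _ _)]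

theorem H1.integral_fn_sub_mul (f g : H1 d) (φ : 𝓢(Space d, ℂ)) :
    ∫ x, (f - g).fn x * φ x = (∫ x, f.fn x * φ x) - ∫ x, g.fn x * φ x := by
  rw [← pairing_toLp, ← pairing_toLp, ← pairing_toLp, H1.fn_sub, map_sub, sub_apply]

/-- The Duhamel term of the difference of two solutions. -/
def duhamelDiff (u v : ℝ → H1 d) (t t₁ t₂ : ℝ) : H1 d :=
  schrodingerH1 (t - t₂) (u t₂ - v t₂) - schrodingerH1 (t - t₁) (u t₁ - v t₁)

/-- The Duhamel term is defined through the states at its endpoints and so lies in H¹ from the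
start; the time integral of the nonlinearity enters only after testing. All later bounds start here.
-/
theorem enorm_integral_duhamelDiff_le (hd : 3 ≤ d) {u v : ℝ → H1 d} (hu : IsGlobalSolution u)
    (hv : IsGlobalSolution v) (t : ℝ) {t₁ t₂ : ℝ} (h12 : t₁ ≤ t₂) (φ : 𝓢(Space d, ℂ)) :
    ‖∫ x, (duhamelDiff u v t t₁ t₂).fn x * φ x‖ₑ ≤
      ∫⁻ s in Set.Ioc t₁ t₂, ‖nlPair (u s) (schrodingerH1 (t - s) (H1.ofSchwartz φ)) -
        nlPair (v s) (schrodingerH1 (t - s) (H1.ofSchwartz φ))‖ₑ := by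
  have hcu := hu.continuous_nlPair hd t (H1.ofSchwartz φ)
  have hcv := hv.continuous_nlPair hd t (H1.ofSchwartz φ)
  have e : ∫ x, (duhamelDiff u v t t₁ t₂).fn x * φ x =
      Complex.I * ∫ s in t₁..t₂, (nlPair (u s) (schrodingerH1 (t - s) (H1.ofSchwartz φ)) -
        nlPair (v s) (schrodingerH1 (t - s) (H1.ofSchwartz φ))) := by
    rw [intervalIntegral.integral_sub (hcu.intervalIntegrable _ _) (hcv.intervalIntegrable _ _),
      mul_sub, ← hu.pairing_sub hd, ← hv.pairing_sub hd, duhamelDiff, schrodingerH1_sub,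
      schrodingerH1_sub, H1.integral_fn_sub_mul, H1.integral_fn_sub_mul, H1.integral_fn_sub_mul]
    ring
  rw [e, intervalIntegral.integral_of_le h12, enorm_mul, ← ofReal_norm Complex.I, Complex.norm_I,
    ENNReal.ofReal_one, one_mul]
  exact enorm_integral_le_lintegral_enorm _

/-- Comparison with zero turns every estimate for the difference of two solutions into one for a
single solution. -/
theorem isGlobalSolution_zero : IsGlobalSolution (fun _ : ℝ => (0 : H1 d)) := by
  refine ⟨continuous_const, fun t φ => ?_⟩
  have h0 : schrodingerH1 t (0 : H1 d) = 0 := by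
    have := schrodingerH1_sub t (0 : H1 d) 0
    simpa using this
  rw [h0]
  simp_rw [integral_nonlinearity_mul_schwartz, nlPair_zero_left]
  simp


theorem H1.eLpNorm_ofSchwartz (φ : 𝓢(Space d, ℂ)) (p : ℝ≥0∞) :
    eLpNorm (H1.ofSchwartz φ).fn p volume = eLpNorm φ p volume := eLpNorm_schwartz_toLp φ p

/-- Dispersive bound for Duhamel terms. -/
theorem exists_eLpNorm_duhamelDiff_le (hd : 3 ≤ d) {r r' : ℝ} (hr : r.HolderConjugate r')
    (hr2 : 2 < r) :
    ∃ C : ℝ, 0 < C ∧ ∀ u v : ℝ → H1 d, IsGlobalSolution u → IsGlobalSolution v →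
      ∀ B : ℝ → ℝ≥0∞, (∀ s, eLpNorm (fun x => nonlinearity d ((u s).fn x) -
        nonlinearity d ((v s).fn x)) (ENNReal.ofReal r') ≤ B s) →
      ∀ t t₁ t₂ : ℝ, t₁ ≤ t₂ →
        eLpNorm (duhamelDiff u v t t₁ t₂).fn (ENNReal.ofReal r) ≤ ENNReal.ofReal C *
          ∫⁻ s in Set.Ioc t₁ t₂, ENNReal.ofReal (|t - s| ^ (-(d * (1 / 2 - 1 / r)))) * B s := by
  obtain ⟨C, hC, h⟩ := eLpNorm_schrodingerL2_le d hr hr2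
  refine ⟨C, hC, fun u v hu hv B hB t t₁ t₂ h12 => ?_⟩
  refine eLpNorm_le_of_schwartz _ hr hr2.le fun φ => ?_
  obtain ⟨P, hP⟩ : ∃ P, P = eLpNorm φ (ENNReal.ofReal r') volume := ⟨_, rfl⟩
  have hPfin : P ≠ ⊤ := by rw [hP]; exact (φ.memLp (ENNReal.ofReal r') volume).2.ne
  rw [← hP]
  refine (enorm_integral_duhamelDiff_le hd hu hv t h12 φ).trans ?_
  have hpt : ∀ᵐ s ∂(volume.restrict (Set.Ioc t₁ t₂)),
      ‖nlPair (u s) (schrodingerH1 (t - s) (H1.ofSchwartz φ)) -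
        nlPair (v s) (schrodingerH1 (t - s) (H1.ofSchwartz φ))‖ₑ ≤
      (ENNReal.ofReal C * P) *
        (ENNReal.ofReal (|t - s| ^ (-(d * (1 / 2 - 1 / r)))) * B s) := by
    -- Decay is applied to the evolved test function, measured in the exponent dual to that of the
    -- nonlinearity; the singular time s = t is null.
    filter_upwards [ae_restrict_of_ae (ae_ne_real t)] with s hs
    refine (enorm_nlPair_sub_le_holder hd hr _ _ _).trans ?_
    have h1 := h (t - s) (sub_ne_zero.2 hs.symm) (H1.ofSchwartz φ).fn
    rw [H1.eLpNorm_ofSchwartz, ← hP, ENNReal.ofReal_mul hC.le] at h1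
    refine (mul_le_mul' h1 (hB s)).trans (le_of_eq ?_)
    ring
  refine (lintegral_mono_ae hpt).trans (le_of_eq ?_)
  rw [lintegral_const_mul' _ _ (by finiteness)]
  ring

/-! ### Space-time estimates for Duhamel terms. -/

/-- The time exponent `4(d+1)/(d-1)` of the critical space-time norm. -/
def criticalExp (d : ℕ) : ℝ := 4 * ((d : ℝ) + 1) / ((d : ℝ) - 1)

/-- The time exponent `2(d+1)/d` of the admissible pair. -/
def admissibleExp (d : ℕ) : ℝ := 2 * ((d : ℝ) + 1) / d

/-- The `L^b` norm in time. -/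
def timeNorm (b : ℝ) (I : Set ℝ) (f : ℝ → ℝ) : ℝ≥0∞ :=
  (∫⁻ t in I, ENNReal.ofReal (f t) ^ b) ^ (1 / b)

theorem criticalExp_pos (hd : 3 ≤ d) : 1 < criticalExp d := by
  have := three_le_cast hd
  rw [criticalExp, lt_div_iff₀ (by linarith)]; linarith

theorem admissibleExp_gt (hd : 3 ≤ d) : 2 < admissibleExp d := by
  have := three_le_cast hd
  rw [admissibleExp, lt_div_iff₀ (by linarith)]; linarith

theorem timeNorm_mono_set {b : ℝ} (hb : 0 < b) {I J : Set ℝ} (h : I ⊆ J) (f : ℝ → ℝ) :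
    timeNorm b I f ≤ timeNorm b J f :=
  ENNReal.rpow_le_rpow (lintegral_mono_set h) (by positivity)

theorem timeNorm_le_add {b : ℝ} (hb : 1 ≤ b) {I : Set ℝ} (hI : MeasurableSet I) {f g h : ℝ → ℝ}
    (hg : Measurable g) (hh : Measurable h) (hfgh : ∀ t ∈ I, f t ≤ g t + h t) :
    timeNorm b I f ≤ timeNorm b I g + timeNorm b I h := by
  refine le_trans ?_ (ENNReal.lintegral_Lp_add_le hg.ennreal_ofReal.aemeasurable
    hh.ennreal_ofReal.aemeasurable hb)
  refine ENNReal.rpow_le_rpow ?_ (by positivity)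
  refine setLIntegral_mono' hI fun t ht => ENNReal.rpow_le_rpow ?_ (by linarith)
  exact (ENNReal.ofReal_le_ofReal (hfgh t ht)).trans ENNReal.ofReal_add_le

/-- Hölder in time. The p factors in the critical norm cost p/a = 1/(d+1), independently of b, which
is why the relation between b and c has this form. -/
theorem timeNorm_nlBound_le (hd : 3 ≤ d) {b c : ℝ} (hb : 0 < b) (hc : 1 ≤ c)
    (hbc : 1 / c = 1 / b + 1 / ((d : ℝ) + 1)) {u v : ℝ → H1 d} (hu : Continuous u)
    (hv : Continuous v) (I : Set ℝ) :
    timeNorm c I (fun s => nlBound (u s) (v s)) ≤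
      3 * (timeNorm (criticalExp d) I (fun s => H1.enNorm (u s)) ^ (4 / ((d : ℝ) - 1)) +
        timeNorm (criticalExp d) I (fun s => H1.enNorm (v s)) ^ (4 / ((d : ℝ) - 1))) *
        timeNorm b I (fun s => H1.enNorm (u s - v s)) := by
  have h3 := three_le_cast hd
  have hp := power_pos hd
  have hca : 1 / c = 4 / ((d : ℝ) - 1) / criticalExp d + 1 / b := by
    rw [hbc, criticalExp]
    have h1 : (d : ℝ) - 1 ≠ 0 := by linarith
    field_simp
    ring
  have ha := criticalExp_pos hd
  obtain ⟨p, hpe⟩ : ∃ p : ℝ, p = 4 / ((d : ℝ) - 1) := ⟨_, rfl⟩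
  obtain ⟨a, hae⟩ : ∃ a : ℝ, a = criticalExp d := ⟨_, rfl⟩
  rw [← hpe] at hp
  rw [← hpe, ← hae] at hca ⊢
  rw [← hae] at ha
  have hc0 : 0 < c := by linarith
  have hn := continuous_enNorm (d := d) hd
  have m : ∀ {w : ℝ → H1 d}, Continuous w →
      AEMeasurable (fun s => ENNReal.ofReal (H1.enNorm (w s))) (volume.restrict I) :=
    fun hw => (hn.comp hw).measurable.ennreal_ofReal.aemeasurable
  have mw := m (hu.sub hv)
  have scale : ∀ {w : ℝ → H1 d}, Continuous w → (∫⁻ s in I, (3 * (ENNReal.ofReal (H1.enNorm (w s)) ^ p *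
      ENNReal.ofReal (H1.enNorm (u s - v s)))) ^ c) ^ (1 / c) ≤
      3 * (timeNorm a I (fun s => H1.enNorm (w s)) ^ p *
        timeNorm b I (fun s => H1.enNorm (u s - v s))) := by
    intro w hw
    simp_rw [ENNReal.mul_rpow_of_nonneg 3 _ hc0.le]
    rw [lintegral_const_mul'' _ ?_, ENNReal.mul_rpow_of_nonneg _ _ (by positivity),
      ← ENNReal.rpow_mul, mul_one_div_cancel hc0.ne', ENNReal.rpow_one]
    · exact mul_le_mul_right (lintegral_rpow_mul_le (m hw) mw hp (by linarith) hb hca) _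
    · exact (((m hw).pow_const p).mul mw).pow_const c
  have hle : timeNorm c I (fun s => nlBound (u s) (v s)) ≤
      (∫⁻ s in I, ((fun s => 3 * (ENNReal.ofReal (H1.enNorm (u s)) ^ p *
        ENNReal.ofReal (H1.enNorm (u s - v s)))) + (fun s => 3 * (ENNReal.ofReal (H1.enNorm (v s)) ^ p *
        ENNReal.ofReal (H1.enNorm (u s - v s))))) s ^ c) ^ (1 / c) := by
    refine le_of_eq ?_
    unfold timeNorm
    congr 1
    refine lintegral_congr fun s => ?_
    congr 1
    have n1 := Real.rpow_nonneg (H1.lpNorm_nonneg (energyExp d) (u s)) p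
    have n2 := Real.rpow_nonneg (H1.lpNorm_nonneg (energyExp d) (v s)) p
    simp only [Pi.add_apply, nlBound, ← hpe]
    rw [ENNReal.ofReal_mul (by positivity),
      ENNReal.ofReal_mul (by norm_num), ENNReal.ofReal_add n1 n2,
      ← ENNReal.ofReal_rpow_of_nonneg (H1.lpNorm_nonneg _ _) hp.le,
      ← ENNReal.ofReal_rpow_of_nonneg (H1.lpNorm_nonneg _ _) hp.le, ENNReal.ofReal_ofNat]
    ring
  refine hle.trans ((ENNReal.lintegral_Lp_add_le ((((m hu).pow_const p).mul mw).const_mul 3)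
    ((((m hv).pow_const p).mul mw).const_mul 3) hc).trans ?_)
  refine (add_le_add (scale hu) (scale hv)).trans (le_of_eq ?_)
  ring

/-- Fractional integration in time applied to nonlinear terms. -/
theorem exists_timeNorm_le_of_pointwise (hd : 3 ≤ d) {b c : ℝ} (hb : 0 < b) (hc : 1 < c)
    (hbc : 1 / c = 1 / b + 1 / ((d : ℝ) + 1)) (C₀ : ℝ) (hC₀ : 0 < C₀) :
    ∃ C : ℝ, 0 < C ∧ ∀ u v : ℝ → H1 d, Continuous u → Continuous v →
      ∀ (t₁ t₂ : ℝ) (J : Set ℝ) (f : ℝ → ℝ), MeasurableSet J →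
      (∀ t ∈ J, ENNReal.ofReal (f t) ≤ ENNReal.ofReal C₀ * ∫⁻ s in Set.Ioc t₁ t₂,
        ENNReal.ofReal (|t - s| ^ (-((d : ℝ) / (d + 1)))) *
          ENNReal.ofReal (nlBound (u s) (v s))) →
      timeNorm b J f ≤ ENNReal.ofReal C *
        ((timeNorm (criticalExp d) (Set.Ioc t₁ t₂) (fun s => H1.enNorm (u s)) ^ (4 / ((d : ℝ) - 1)) +
          timeNorm (criticalExp d) (Set.Ioc t₁ t₂) (fun s => H1.enNorm (v s)) ^ (4 / ((d : ℝ) - 1))) *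
          timeNorm b (Set.Ioc t₁ t₂) (fun s => H1.enNorm (u s - v s))) := by
  have h3 := three_le_cast hd
  have hδ1 : (d : ℝ) / (d + 1) < 1 := by rw [div_lt_one (by positivity)]; linarith
  -- The same relation between b and c is the Hardy–Littlewood–Sobolev one for δ = d/(d+1), so the
  -- estimate returns to the exponent b.
  obtain ⟨C₁, hC₁, h1⟩ := lintegral_rieszPot_rpow_le (a := b) (b := c) hδ1 hc hb
    (by rw [hbc]; field_simp; ring)
  refine ⟨C₀ * C₁ * 3, by positivity, fun u v hu hv t₁ t₂ J f hJ hf => ?_⟩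
  have hm : Measurable fun s => nlBound (u s) (v s) :=
    ((continuous_nlBound hd).comp (hu.prodMk hv)).measurable
  have hc0 : 0 < c := by linarith
  set n : ℝ → ℝ≥0∞ := (Set.Ioc t₁ t₂).indicator fun s => ENNReal.ofReal (nlBound (u s) (v s)) with hn
  have hnm : Measurable n := hm.ennreal_ofReal.indicator measurableSet_Ioc
  have hf' : ∀ t ∈ J, ENNReal.ofReal (f t) ≤ ENNReal.ofReal C₀ * rieszPot ((d : ℝ) / (d + 1)) n t := by
    intro t ht
    refine (hf t ht).trans (le_of_eq ?_)
    congr 1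
    rw [rieszPot, ← lintegral_indicator measurableSet_Ioc]
    refine lintegral_congr fun s => ?_
    by_cases hs : s ∈ Set.Ioc t₁ t₂
    · rw [hn, Set.indicator_of_mem hs, Set.indicator_of_mem hs]
    · rw [hn, Set.indicator_of_notMem hs, Set.indicator_of_notMem hs, mul_zero]
  have hmR := measurable_rieszPot ((d : ℝ) / (d + 1)) hnm
  have hnI : (∫⁻ s, n s ^ c) ^ (1 / c) =
      timeNorm c (Set.Ioc t₁ t₂) (fun s => nlBound (u s) (v s)) := by
    rw [timeNorm, ← lintegral_indicator measurableSet_Ioc]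
    congr 1
    refine lintegral_congr fun s => ?_
    by_cases hs : s ∈ Set.Ioc t₁ t₂
    · rw [hn, Set.indicator_of_mem hs, Set.indicator_of_mem hs]
    · rw [hn, Set.indicator_of_notMem hs, Set.indicator_of_notMem hs, ENNReal.zero_rpow_of_pos hc0]
  calc timeNorm b J f ≤ (∫⁻ t, (ENNReal.ofReal C₀ * rieszPot ((d : ℝ) / (d + 1)) n t) ^ b) ^ (1 / b) := by
        refine ENNReal.rpow_le_rpow ?_ (by positivity)
        exact (setLIntegral_mono' hJ fun t ht => ENNReal.rpow_le_rpow (hf' t ht) hb.le).trans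
          (setLIntegral_le_lintegral _ _)
    _ = ENNReal.ofReal C₀ * (∫⁻ t, rieszPot ((d : ℝ) / (d + 1)) n t ^ b) ^ (1 / b) := by
        simp_rw [ENNReal.mul_rpow_of_nonneg _ _ hb.le]
        rw [lintegral_const_mul _ (hmR.pow_const b), ENNReal.mul_rpow_of_nonneg _ _ (by positivity),
          ← ENNReal.rpow_mul, mul_one_div_cancel hb.ne', ENNReal.rpow_one]
    _ ≤ ENNReal.ofReal C₀ * (ENNReal.ofReal C₁ * (∫⁻ s, n s ^ c) ^ (1 / c)) :=
        mul_le_mul_right (h1 n hnm) _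
    _ ≤ _ := by
        rw [hnI]
        refine (mul_le_mul_right (mul_le_mul_right
          (timeNorm_nlBound_le hd hb hc.le hbc hu hv _) _) _).trans (le_of_eq ?_)
        rw [ENNReal.ofReal_mul (by positivity), ENNReal.ofReal_mul hC₀.le, ENNReal.ofReal_ofNat]
        ring

theorem exists_enNorm_duhamelDiff_le (hd : 3 ≤ d) :
    ∃ C : ℝ, 0 < C ∧ ∀ u v : ℝ → H1 d, IsGlobalSolution u → IsGlobalSolution v →
      ∀ t t₁ t₂ : ℝ, t₁ ≤ t₂ → ENNReal.ofReal (H1.enNorm (duhamelDiff u v t t₁ t₂)) ≤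
        ENNReal.ofReal C * ∫⁻ s in Set.Ioc t₁ t₂,
          ENNReal.ofReal (|t - s| ^ (-((d : ℝ) / (d + 1)))) *
            ENNReal.ofReal (nlBound (u s) (v s)) := by
  obtain ⟨C, hC, h⟩ := exists_eLpNorm_duhamelDiff_le hd (energyExp_conj hd) (two_lt_energyExp hd)
  refine ⟨C, hC, fun u v hu hv t t₁ t₂ h12 => ?_⟩
  rw [H1.ofReal_lpNorm (two_lt_energyExp hd) (decay_energyExp_lt hd), ← decay_energyExp hd]
  exact h u v hu hv _ (fun s => eLpNorm_nonlinearity_sub_le_nlBound hd (u s) (v s)) t t₁ t₂ h12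

theorem exists_strichartz_timeNorm (hd : 3 ≤ d) :
    ∃ C : ℝ, 0 < C ∧ ∀ f : H1 d, timeNorm (admissibleExp d) Set.univ
      (fun t => H1.enNorm (schrodingerH1 t f)) ≤ ENNReal.ofReal (C * ‖f.fn‖) := by
  have h3 := three_le_cast hd
  obtain ⟨C, hC, h⟩ := exists_strichartz d (δ := (d : ℝ) / (d + 1)) (two_lt_energyExp hd)
    (decay_energyExp hd).symm (by positivity) (by rw [div_lt_one (by positivity)]; linarith)
  refine ⟨C, hC, fun f => ?_⟩
  have e1 : 2 / ((d : ℝ) / (d + 1)) = admissibleExp d := by rw [admissibleExp]; field_simp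
  have e2 : (d : ℝ) / (d + 1) / 2 = 1 / admissibleExp d := by rw [admissibleExp]; field_simp
  have := h f
  rw [e1, e2] at this
  rw [timeNorm, setLIntegral_univ]
  exact this

/-- Inhomogeneous Strichartz estimate with values in `L²`. -/
theorem exists_norm_duhamelDiff_le (hd : 3 ≤ d) :
    ∃ C : ℝ, 0 < C ∧ ∀ u v : ℝ → H1 d, IsGlobalSolution u → IsGlobalSolution v →
      ∀ t₁ t₂ : ℝ, t₁ ≤ t₂ → ‖(duhamelDiff u v 0 t₁ t₂).fn‖ₑ ≤ ENNReal.ofReal C *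
        ((timeNorm (criticalExp d) (Set.Ioc t₁ t₂) (fun s => H1.enNorm (u s)) ^ (4 / ((d : ℝ) - 1)) +
          timeNorm (criticalExp d) (Set.Ioc t₁ t₂) (fun s => H1.enNorm (v s)) ^ (4 / ((d : ℝ) - 1))) *
          timeNorm (admissibleExp d) (Set.Ioc t₁ t₂) (fun s => H1.enNorm (u s - v s))) := by
  have h3 := three_le_cast hd
  obtain ⟨C, hC, h⟩ := exists_strichartz_timeNorm hd
  have hγ : (admissibleExp d).HolderConjugate (2 * ((d : ℝ) + 1) / (d + 2)) := by
    rw [Real.holderConjugate_iff]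
    refine ⟨by linarith [admissibleExp_gt hd], ?_⟩
    rw [admissibleExp]; field_simp; ring
  have h22 : (2 : ℝ).HolderConjugate 2 := by
    rw [Real.holderConjugate_iff]; norm_num
  refine ⟨C * 3, by positivity, fun u v hu hv t₁ t₂ h12 => ?_⟩
  have hm : Measurable fun s => nlBound (u s) (v s) :=
    ((continuous_nlBound hd).comp (hu.continuous.prodMk hv.continuous)).measurable
  have hnb := timeNorm_nlBound_le hd (b := admissibleExp d) (c := 2 * ((d : ℝ) + 1) / (d + 2))
    (by linarith [admissibleExp_gt hd]) hγ.symm.lt.le (by rw [admissibleExp]; field_simp)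
    hu.continuous hv.continuous (Set.Ioc t₁ t₂)
  obtain ⟨Y, hY⟩ : ∃ Y, Y = timeNorm (2 * ((d : ℝ) + 1) / (d + 2)) (Set.Ioc t₁ t₂)
    (fun s => nlBound (u s) (v s)) := ⟨_, rfl⟩
  have key : eLpNorm (duhamelDiff u v 0 t₁ t₂).fn (ENNReal.ofReal 2) volume ≤
      ENNReal.ofReal C * Y := by
    -- Dual Strichartz: the evolved test function takes the admissible norm, controlled by its L²
    -- norm, and the nonlinearity takes the dual one.
    refine eLpNorm_le_of_schwartz _ h22 le_rfl fun φ => ?_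
    have hφ2 : ENNReal.ofReal ‖(H1.ofSchwartz φ).fn‖ = eLpNorm φ (ENNReal.ofReal 2) volume := by
      rw [ofReal_norm, Lp.enorm_def, H1.eLpNorm_ofSchwartz, ENNReal.ofReal_ofNat]
    refine (enorm_integral_duhamelDiff_le hd hu hv 0 h12 φ).trans ?_
    have hcont : Continuous fun s : ℝ => H1.enNorm (schrodingerH1 (0 - s) (H1.ofSchwartz φ)) := by
      have hsub : Continuous fun s : ℝ => 0 - s := continuous_const.sub continuous_id
      exact (continuous_enNorm hd).comp (Continuous.comp (g := fun τ => schrodingerH1 τ _)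
        (continuous_schrodingerH1_time _) hsub)
    calc _ ≤ ∫⁻ s in Set.Ioc t₁ t₂, ((fun s => ENNReal.ofReal
          (H1.enNorm (schrodingerH1 (0 - s) (H1.ofSchwartz φ)))) *
          fun s => ENNReal.ofReal (nlBound (u s) (v s))) s := by
          refine lintegral_mono fun s => ?_
          rw [Pi.mul_apply, ← ENNReal.ofReal_mul (H1.lpNorm_nonneg _ _), ← ofReal_norm]
          exact ENNReal.ofReal_le_ofReal (norm_nlPair_sub_le hd _ _ _)
      _ ≤ _ := ENNReal.lintegral_mul_le_Lp_mul_Lq _ hγ hcont.measurable.ennreal_ofReal.aemeasurable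
          hm.ennreal_ofReal.aemeasurable
      _ ≤ ENNReal.ofReal (C * ‖(H1.ofSchwartz φ).fn‖) * Y := by
          rw [hY]
          refine mul_le_mul_left ?_ _
          refine le_trans ?_ (h (H1.ofSchwartz φ))
          rw [timeNorm, setLIntegral_univ]
          refine ENNReal.rpow_le_rpow ?_ (by have := admissibleExp_gt hd; positivity)
          refine (setLIntegral_le_lintegral _ _).trans (le_of_eq ?_)
          simp_rw [zero_sub]
          exact lintegral_neg_eq_self (fun s => ENNReal.ofReal
            (H1.enNorm (schrodingerH1 s (H1.ofSchwartz φ))) ^ admissibleExp d)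
      _ = _ := by rw [ENNReal.ofReal_mul hC.le, hφ2]; ring
  rw [Lp.enorm_def]
  rw [ENNReal.ofReal_ofNat] at key
  refine key.trans ((mul_le_mul_right (hY ▸ hnb) _).trans (le_of_eq ?_))
  rw [ENNReal.ofReal_mul hC.le, ENNReal.ofReal_ofNat]; ring


/-! ### Small data theory in the critical norm. -/

theorem timeNorm_Ioc_eq {b : ℝ} (hb : 0 < b) {f : ℝ → ℝ} (hf : Continuous f) (h0 : ∀ t, 0 ≤ f t)
    {t₁ t₂ : ℝ} (h12 : t₁ ≤ t₂) :
    timeNorm b (Set.Ioc t₁ t₂) f = ENNReal.ofReal ((∫ t in t₁..t₂, f t ^ b) ^ (1 / b)) := by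
  have hc : Continuous fun t => f t ^ b := hf.rpow_const fun t => Or.inr hb.le
  rw [intervalIntegral.integral_of_le h12, ← ENNReal.ofReal_rpow_of_nonneg
    (integral_nonneg fun t => Real.rpow_nonneg (h0 t) _) (by positivity),
    ofReal_integral_eq_lintegral_ofReal (hc.integrableOn_Ioc)
      (ae_of_all _ fun t => Real.rpow_nonneg (h0 t) _), timeNorm]
  congr 1
  exact lintegral_congr fun t => ENNReal.ofReal_rpow_of_nonneg (h0 t) hb.le

theorem timeNorm_enNorm_zero {b : ℝ} (hb : 0 < b) (I : Set ℝ) :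
    timeNorm b I (fun _ => H1.enNorm (0 : H1 d)) = 0 := by
  simp only [timeNorm, H1.enNorm, H1.lpNorm_zero, ENNReal.ofReal_zero, ENNReal.zero_rpow_of_pos hb,
    lintegral_zero]
  exact ENNReal.zero_rpow_of_pos (by positivity)

theorem tendsto_timeNorm_Ioi {b : ℝ} (hb : 0 < b) {f : ℝ → ℝ} (hf : Measurable f) {t₀ : ℝ}
    (h : timeNorm b (Set.Ioi t₀) f ≠ ⊤) :
    Tendsto (fun T => timeNorm b (Set.Ioi T) f) atTop (𝓝 0) := by
  have hfin : ∫⁻ t in Set.Ioi t₀, ENNReal.ofReal (f t) ^ b ≠ ⊤ := by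
    intro h0
    rw [timeNorm, h0, ENNReal.top_rpow_of_pos (by positivity)] at h
    exact h rfl
  have hm : Measurable fun t => ENNReal.ofReal (f t) ^ b := hf.ennreal_ofReal.pow_const b
  have key : Tendsto (fun T => ∫⁻ t in Set.Ioi T, ENNReal.ofReal (f t) ^ b) atTop (𝓝 0) := by
    have h1 : Tendsto (fun T => ∫⁻ t, (Set.Ioi T).indicator (fun t => ENNReal.ofReal (f t) ^ b) t)
        atTop (𝓝 (∫⁻ _ : ℝ, 0)) := by
      refine tendsto_lintegral_filter_of_dominated_convergence
        ((Set.Ioi t₀).indicator fun t => ENNReal.ofReal (f t) ^ b) ?_ ?_ ?_ ?_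
      · exact Eventually.of_forall fun T => hm.indicator measurableSet_Ioi
      · filter_upwards [eventually_ge_atTop t₀] with T hT
        exact ae_of_all _ fun t => Set.indicator_le_indicator_of_subset (Set.Ioi_subset_Ioi hT)
          (fun _ => zero_le) t
      · rwa [lintegral_indicator measurableSet_Ioi]
      · refine ae_of_all _ fun t => tendsto_const_nhds.congr' ?_
        filter_upwards [eventually_ge_atTop t] with T hT
        rw [Set.indicator_of_notMem (by simpa using hT)]
    rw [lintegral_zero] at h1
    refine h1.congr fun T => ?_
    rw [lintegral_indicator measurableSet_Ioi]
  have := key.ennrpow_const (1 / b)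
  rwa [ENNReal.zero_rpow_of_pos (by positivity)] at this

/-- Absorption into the left-hand side; without finiteness of x the hypothesis would be empty. -/
theorem le_two_mul_of_le_add_half {x A : ℝ≥0∞} (hx : x ≠ ⊤) (h : x ≤ A + x / 2) : x ≤ 2 * A := by
  rcases eq_or_ne A ⊤ with hA | hA
  · rw [hA]; simp
  lift x to NNReal using hx
  lift A to NNReal using hA
  have h' : x ≤ A + x / 2 := by
    have : ((x / 2 : NNReal) : ℝ≥0∞) = (x : ℝ≥0∞) / 2 := by
      rw [ENNReal.coe_div (by norm_num)]; rfl
    rw [← this] at h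
    exact_mod_cast h
  have h2 : x ≤ 2 * A := by
    have h3 : (x : ℝ) ≤ A + x / 2 := by exact_mod_cast h'
    have : (x : ℝ) ≤ 2 * A := by linarith
    exact_mod_cast this
  exact_mod_cast h2

/-- The linear evolution has small critical norm at late times. -/
theorem tendsto_timeNorm_schrodingerH1 (hd : 3 ≤ d) (f : H1 d) :
    Tendsto (fun T => timeNorm (criticalExp d) (Set.Ioi T)
      (fun t => H1.enNorm (schrodingerH1 t f))) atTop (𝓝 0) := by
  have h3 := three_le_cast hd
  obtain ⟨C, hC, hst⟩ := exists_strichartz_timeNorm hd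
  obtain ⟨K, hK, hs, -⟩ := H1.exists_lpNorm_le d (two_lt_energyExp hd) (decay_energyExp_lt hd)
  have hcont : Continuous fun t => H1.enNorm (schrodingerH1 t f) :=
    (continuous_enNorm hd).comp (continuous_schrodingerH1_time f)
  have ha := criticalExp_pos hd
  have hγ := admissibleExp_gt hd
  have haγ : admissibleExp d < criticalExp d := by
    rw [admissibleExp, criticalExp, div_lt_div_iff₀ (by linarith) (by linarith)]
    nlinarith
  refine tendsto_timeNorm_Ioi (by linarith) hcont.measurable (t₀ := 0) ?_
  have hfin : ∫⁻ t, ENNReal.ofReal (H1.enNorm (schrodingerH1 t f)) ^ admissibleExp d ≠ ⊤ := by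
    intro h0
    have := hst f
    rw [timeNorm, setLIntegral_univ, h0, ENNReal.top_rpow_of_pos (by positivity)] at this
    exact ENNReal.ofReal_ne_top (top_le_iff.1 this)
  -- The critical exponent exceeds the admissible one, so the critical norm is finite by Strichartz
  -- and the uniform L^{p+2} bound that Sobolev gives along the free flow.
  have hle : ∫⁻ t in Set.Ioi 0, ENNReal.ofReal (H1.enNorm (schrodingerH1 t f)) ^ criticalExp d ≤
      ENNReal.ofReal (K * ‖f‖) ^ (criticalExp d - admissibleExp d) *
        ∫⁻ t, ENNReal.ofReal (H1.enNorm (schrodingerH1 t f)) ^ admissibleExp d := by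
    refine (setLIntegral_le_lintegral _ _).trans ?_
    rw [← lintegral_const_mul _ (hcont.measurable.ennreal_ofReal.pow_const _)]
    refine lintegral_mono fun t => ?_
    have h1 : ENNReal.ofReal (H1.enNorm (schrodingerH1 t f)) ^ criticalExp d =
        ENNReal.ofReal (H1.enNorm (schrodingerH1 t f)) ^ (criticalExp d - admissibleExp d) *
        ENNReal.ofReal (H1.enNorm (schrodingerH1 t f)) ^ admissibleExp d := by
      rw [← ENNReal.rpow_add_of_nonneg _ _ (by linarith) (by linarith), sub_add_cancel]
    rw [h1]
    refine mul_le_mul_left (ENNReal.rpow_le_rpow (ENNReal.ofReal_le_ofReal ?_) (by linarith)) _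
    have := hs (schrodingerH1 t f)
    rwa [norm_schrodingerH1] at this
  rw [timeNorm]
  refine ENNReal.rpow_ne_top_of_nonneg (by positivity) (ne_top_of_le_ne_top ?_ hle)
  exact ENNReal.mul_ne_top (ENNReal.rpow_ne_top_of_nonneg (by linarith) ENNReal.ofReal_ne_top) hfin

theorem sub_eq_add_duhamelDiff (u v : ℝ → H1 d) (t₁ t : ℝ) :
    u t - v t = schrodingerH1 (t - t₁) (u t₁ - v t₁) + duhamelDiff u v t t₁ t := by
  rw [duhamelDiff, sub_self, schrodingerH1_zero]; abel

theorem enNorm_add_le (hd : 3 ≤ d) (f g : H1 d) :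
    H1.enNorm (f + g) ≤ H1.enNorm f + H1.enNorm g := by
  have h2 := two_lt_energyExp hd
  have h1 : (1 : ℝ≥0∞) ≤ ENNReal.ofReal (energyExp d) := by
    rw [← ENNReal.ofReal_one]; exact ENNReal.ofReal_le_ofReal (by linarith)
  have e : (f + g).fn = f.fn + g.fn := rfl
  rw [← ENNReal.ofReal_le_ofReal_iff (add_nonneg (H1.lpNorm_nonneg _ _) (H1.lpNorm_nonneg _ _)),
    ENNReal.ofReal_add (H1.lpNorm_nonneg _ _) (H1.lpNorm_nonneg _ _),
    H1.ofReal_lpNorm h2 (decay_energyExp_lt hd), H1.ofReal_lpNorm h2 (decay_energyExp_lt hd),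
    H1.ofReal_lpNorm h2 (decay_energyExp_lt hd), e, eLpNorm_congr_ae (Lp.coeFn_add _ _)]
  exact eLpNorm_add_le (Lp.aestronglyMeasurable _) (Lp.aestronglyMeasurable _) h1

theorem continuous_schrodingerH1_sub (t₁ : ℝ) (f : H1 d) :
    Continuous fun t => schrodingerH1 (t - t₁) f :=
  Continuous.comp (g := fun τ => schrodingerH1 τ f) (continuous_schrodingerH1_time f)
    (continuous_id.sub continuous_const)

theorem continuous_duhamelDiff_self {u v : ℝ → H1 d} (hu : Continuous u) (hv : Continuous v)
    (t₁ : ℝ) : Continuous fun t => duhamelDiff u v t t₁ t := by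
  have e : (fun t => duhamelDiff u v t t₁ t) =
      fun t => u t - v t - schrodingerH1 (t - t₁) (u t₁ - v t₁) := by
    ext1 t
    rw [sub_eq_add_duhamelDiff u v t₁ t]; abel
  rw [e]
  exact (hu.sub hv).sub (continuous_schrodingerH1_sub t₁ _)

/-- The difference of two solutions on a time interval, in an arbitrary time norm compatible with
fractional integration. -/
theorem exists_timeNorm_sub_le (hd : 3 ≤ d) {b c : ℝ} (hb : 1 ≤ b) (hc : 1 < c)
    (hbc : 1 / c = 1 / b + 1 / ((d : ℝ) + 1)) :
    ∃ C : ℝ, 0 < C ∧ ∀ u v : ℝ → H1 d, IsGlobalSolution u → IsGlobalSolution v →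
      ∀ t₁ t₂ : ℝ, timeNorm b (Set.Ioc t₁ t₂) (fun t => H1.enNorm (u t - v t)) ≤
        timeNorm b (Set.Ioc t₁ t₂) (fun t => H1.enNorm (schrodingerH1 (t - t₁) (u t₁ - v t₁))) +
        ENNReal.ofReal C *
        ((timeNorm (criticalExp d) (Set.Ioc t₁ t₂) (fun s => H1.enNorm (u s)) ^ (4 / ((d : ℝ) - 1)) +
          timeNorm (criticalExp d) (Set.Ioc t₁ t₂) (fun s => H1.enNorm (v s)) ^ (4 / ((d : ℝ) - 1))) *
          timeNorm b (Set.Ioc t₁ t₂) (fun s => H1.enNorm (u s - v s))) := by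
  obtain ⟨C₀, hC₀, h0⟩ := exists_enNorm_duhamelDiff_le hd
  obtain ⟨C, hC, h⟩ := exists_timeNorm_le_of_pointwise hd (by linarith) hc hbc C₀ hC₀
  refine ⟨C, hC, fun u v hu hv t₁ t₂ => ?_⟩
  have hn := continuous_enNorm (d := d) hd
  have hcD : Continuous fun t => H1.enNorm (duhamelDiff u v t t₁ t) :=
    hn.comp (continuous_duhamelDiff_self hu.continuous hv.continuous t₁)
  refine (timeNorm_le_add hb measurableSet_Ioc
    (hn.comp (continuous_schrodingerH1_sub t₁ (u t₁ - v t₁))).measurable hcD.measurable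
    (fun t _ => ?_)).trans (add_le_add le_rfl ?_)
  · rw [sub_eq_add_duhamelDiff u v t₁ t]
    exact enNorm_add_le hd _ _
  · refine h u v hu.continuous hv.continuous t₁ t₂ _ _ measurableSet_Ioc fun t ht => ?_
    refine (h0 u v hu hv t t₁ t ht.1.le).trans (mul_le_mul_right ?_ _)
    -- The upper limit t is enlarged to t₂ so that fractional integration acts on one fixed function
    -- of s.
    exact lintegral_mono_set (Set.Ioc_subset_Ioc_right ht.2)

/-- Small data bootstrap for the critical norm. -/
theorem exists_bootstrap (hd : 3 ≤ d) :
    ∃ η : ℝ, 0 < η ∧ ∀ u : ℝ → H1 d, IsGlobalSolution u → ∀ t₀ : ℝ,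
      timeNorm (criticalExp d) (Set.Ioi t₀) (fun t => H1.enNorm (schrodingerH1 (t - t₀) (u t₀))) ≤
        ENNReal.ofReal η →
      ∀ T, t₀ ≤ T → timeNorm (criticalExp d) (Set.Ioc t₀ T) (fun t => H1.enNorm (u t)) ≤
        ENNReal.ofReal (2 * η) := by
  have h3 := three_le_cast hd
  have hp := power_pos hd
  have ha := criticalExp_pos hd
  obtain ⟨C, hC, h⟩ := exists_timeNorm_sub_le hd (b := criticalExp d)
    (c := 4 * ((d : ℝ) + 1) / ((d : ℝ) + 3)) ha.le
    (by rw [lt_div_iff₀ (by linarith)]; linarith)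
    (by rw [criticalExp]; have h1 : (d : ℝ) - 1 ≠ 0 := by linarith
        field_simp; ring)
  -- With this η, reaching 2η would give 2η ≤ η + η/2.
  obtain ⟨η, hη, hη'⟩ : ∃ η : ℝ, 0 < η ∧ C * (2 * η) ^ (4 / ((d : ℝ) - 1)) ≤ 1 / 4 := by
    have hcont : Continuous fun η : ℝ => C * (2 * η) ^ (4 / ((d : ℝ) - 1)) :=
      continuous_const.mul ((continuous_const.mul continuous_id).rpow_const fun _ => Or.inr hp.le)
    have ht := hcont.tendsto 0
    rw [mul_zero, Real.zero_rpow hp.ne', mul_zero] at ht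
    have := (ht.mono_left (nhdsWithin_le_nhds (s := Set.Ioi 0))).eventually
      (ge_mem_nhds (show (0 : ℝ) < 1 / 4 by norm_num))
    obtain ⟨η, h1, h2⟩ := (this.and self_mem_nhdsWithin).exists
    exact ⟨η, h2, h1⟩
  refine ⟨η, hη, fun u hu t₀ hlin T hT => ?_⟩
  have hn : Continuous fun t => H1.enNorm (u t) := (continuous_enNorm hd).comp hu.continuous
  set Y : ℝ → ℝ := fun T => (∫ t in t₀..T, H1.enNorm (u t) ^ criticalExp d) ^ (1 / criticalExp d)
    with hY
  have hn0 : ∀ t, 0 ≤ H1.enNorm (u t) := fun t => H1.lpNorm_nonneg _ _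
  have hYe : ∀ T, t₀ ≤ T → timeNorm (criticalExp d) (Set.Ioc t₀ T) (fun t => H1.enNorm (u t)) =
      ENNReal.ofReal (Y T) := fun T hT => timeNorm_Ioc_eq (by linarith) hn hn0 hT
  have hYc : Continuous Y := by
    have hc : Continuous fun t => H1.enNorm (u t) ^ criticalExp d :=
      hn.rpow_const fun _ => Or.inr (by linarith)
    exact (intervalIntegral.continuous_primitive (fun a b => hc.intervalIntegrable a b) t₀).rpow_const
      fun _ => Or.inr (by positivity)
  have hY0 : Y t₀ = 0 := by
    simp only [hY, intervalIntegral.integral_same]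
    exact Real.zero_rpow (by positivity)
  -- Continuity barrier: Y starts at 0, is continuous, and cannot take the value 2η, so by the
  -- intermediate value theorem it stays below.
  have hstep : ∀ T, t₀ ≤ T → Y T ≠ 2 * η := by
    intro T hT hYT
    have h1 := h u (fun _ => 0) hu isGlobalSolution_zero t₀ T
    simp only [sub_zero] at h1
    rw [timeNorm_enNorm_zero (by linarith), ENNReal.zero_rpow_of_pos hp, add_zero, hYe T hT, hYT,
      ENNReal.ofReal_rpow_of_pos (by positivity), ← ENNReal.ofReal_mul (by positivity),
      ← ENNReal.ofReal_mul (by positivity)] at h1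
    have h2 := h1.trans (add_le_add_left ((timeNorm_mono_set (by linarith)
      Set.Ioc_subset_Ioi_self _).trans hlin) _)
    rw [← ENNReal.ofReal_add hη.le (by positivity),
      ENNReal.ofReal_le_ofReal_iff (by positivity)] at h2
    nlinarith
  rw [hYe T hT]
  refine ENNReal.ofReal_le_ofReal ?_
  by_contra hlt
  push Not at hlt
  obtain ⟨T', hT', hYT'⟩ := intermediate_value_Icc hT hYc.continuousOn
    (show 2 * η ∈ Set.Icc (Y t₀) (Y T) from ⟨by rw [hY0]; positivity, hlt.le⟩)
  exact hstep T' hT'.1 hYT'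

/-- Lipschitz dependence in `L²` of the asymptotic profile, for solutions with small critical
norm. -/
theorem exists_lipschitz (hd : 3 ≤ d) :
    ∃ κ C : ℝ, 0 < κ ∧ 0 < C ∧ ∀ u v : ℝ → H1 d, IsGlobalSolution u → IsGlobalSolution v →
      ∀ t₀ : ℝ,
      timeNorm (criticalExp d) (Set.Ioi t₀) (fun t => H1.enNorm (u t)) ≤ ENNReal.ofReal κ →
      timeNorm (criticalExp d) (Set.Ioi t₀) (fun t => H1.enNorm (v t)) ≤ ENNReal.ofReal κ →
      ∀ t₁ t₂ : ℝ, t₀ ≤ t₁ → t₁ ≤ t₂ → ‖(duhamelDiff u v 0 t₁ t₂).fn‖ₑ ≤ ENNReal.ofReal C *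
        (timeNorm (criticalExp d) (Set.Ioi t₁) (fun s => H1.enNorm (u s)) ^ (4 / ((d : ℝ) - 1)) +
          timeNorm (criticalExp d) (Set.Ioi t₁) (fun s => H1.enNorm (v s)) ^ (4 / ((d : ℝ) - 1))) *
          ‖(u t₀ - v t₀).fn‖ₑ := by
  have h3 := three_le_cast hd
  have hp := power_pos hd
  have ha := criticalExp_pos hd
  have hγ := admissibleExp_gt hd
  obtain ⟨C₁, hC₁, h1⟩ := exists_timeNorm_sub_le hd (b := admissibleExp d)
    (c := 2 * ((d : ℝ) + 1) / ((d : ℝ) + 2)) (by linarith)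
    (by rw [lt_div_iff₀ (by linarith)]; linarith)
    (by rw [admissibleExp]; field_simp)
  obtain ⟨C₂, hC₂, h2⟩ := exists_norm_duhamelDiff_le hd
  obtain ⟨C₃, hC₃, hst⟩ := exists_strichartz_timeNorm hd
  -- The two solutions contribute 2κ^p; the product with C₁ must be at most 1/2 for the admissible
  -- norm of the difference to be absorbed.
  obtain ⟨κ, hκ, hκ'⟩ : ∃ κ : ℝ, 0 < κ ∧ C₁ * (2 * κ ^ (4 / ((d : ℝ) - 1))) ≤ 1 / 2 := by
    have hcont : Continuous fun η : ℝ => C₁ * (2 * η ^ (4 / ((d : ℝ) - 1))) :=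
      continuous_const.mul (continuous_const.mul (continuous_id.rpow_const fun _ => Or.inr hp.le))
    have ht := hcont.tendsto 0
    rw [Real.zero_rpow hp.ne', mul_zero, mul_zero] at ht
    have := (ht.mono_left (nhdsWithin_le_nhds (s := Set.Ioi 0))).eventually
      (ge_mem_nhds (show (0 : ℝ) < 1 / 2 by norm_num))
    obtain ⟨η, h1, h2⟩ := (this.and self_mem_nhdsWithin).exists
    exact ⟨η, h2, h1⟩
  refine ⟨κ, C₂ * (2 * C₃), hκ, by positivity, fun u v hu hv t₀ hXu hXv t₁ t₂ h01 h12 => ?_⟩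
  have hw : Continuous fun t => H1.enNorm (u t - v t) :=
    (continuous_enNorm hd).comp (hu.continuous.sub hv.continuous)
  obtain ⟨S, hS⟩ : ∃ S, S = timeNorm (admissibleExp d) (Set.Ioc t₀ t₂)
    (fun t => H1.enNorm (u t - v t)) := ⟨_, rfl⟩
  have hSfin : S ≠ ⊤ := by
    rw [hS, timeNorm_Ioc_eq (by linarith) hw (fun t => H1.lpNorm_nonneg _ _) (h01.trans h12)]
    exact ENNReal.ofReal_ne_top
  have hlin : timeNorm (admissibleExp d) (Set.Ioc t₀ t₂)
      (fun t => H1.enNorm (schrodingerH1 (t - t₀) (u t₀ - v t₀))) ≤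
      ENNReal.ofReal C₃ * ‖(u t₀ - v t₀).fn‖ₑ := by
    have := hst (schrodingerH1 (-t₀) (u t₀ - v t₀))
    simp_rw [schrodingerH1_schrodingerH1, ← sub_eq_add_neg] at this
    rw [fn_schrodingerH1, norm_schrodingerL2, ENNReal.ofReal_mul hC₃.le, ofReal_norm] at this
    exact (timeNorm_mono_set (by linarith) (Set.subset_univ _) _).trans this
  have hXI : ∀ {w : ℝ → H1 d}, timeNorm (criticalExp d) (Set.Ioi t₀) (fun t => H1.enNorm (w t)) ≤
      ENNReal.ofReal κ → timeNorm (criticalExp d) (Set.Ioc t₀ t₂) (fun t => H1.enNorm (w t)) ^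
        (4 / ((d : ℝ) - 1)) ≤ ENNReal.ofReal (κ ^ (4 / ((d : ℝ) - 1))) := by
    intro w hX
    rw [← ENNReal.ofReal_rpow_of_pos hκ]
    exact ENNReal.rpow_le_rpow
      ((timeNorm_mono_set (by linarith) Set.Ioc_subset_Ioi_self _).trans hX) hp.le
  -- The admissible norm on (t₀, t₂] is controlled by the L² difference at t₀ alone. The critical
  -- norms from t₁ on are kept in the final bound, since they supply the decay.
  have hS2 : S ≤ 2 * (ENNReal.ofReal C₃ * ‖(u t₀ - v t₀).fn‖ₑ) := by
    refine le_two_mul_of_le_add_half hSfin ?_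
    have h4 := h1 u v hu hv t₀ t₂
    rw [← hS] at h4
    refine h4.trans (add_le_add hlin ?_)
    calc _ ≤ ENNReal.ofReal C₁ * ((ENNReal.ofReal (κ ^ (4 / ((d : ℝ) - 1))) +
          ENNReal.ofReal (κ ^ (4 / ((d : ℝ) - 1)))) * S) := by
          refine mul_le_mul_right (mul_le_mul_left (add_le_add (hXI hXu) (hXI hXv)) _) _
      _ = ENNReal.ofReal (C₁ * (2 * κ ^ (4 / ((d : ℝ) - 1)))) * S := by
          rw [← ENNReal.ofReal_add (by positivity) (by positivity), ← mul_assoc,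
            ← ENNReal.ofReal_mul hC₁.le, two_mul]
      _ ≤ ENNReal.ofReal (1 / 2) * S := mul_le_mul_left (ENNReal.ofReal_le_ofReal hκ') _
      _ = S / 2 := by
          rw [ENNReal.ofReal_div_of_pos (by norm_num), ENNReal.ofReal_one, ENNReal.ofReal_ofNat,
            ENNReal.div_eq_inv_mul, ENNReal.div_eq_inv_mul, mul_one]
  have hA := admissibleExp_gt hd
  calc _ ≤ _ := h2 u v hu hv t₁ t₂ h12
    _ ≤ ENNReal.ofReal C₂ * ((timeNorm (criticalExp d) (Set.Ioi t₁) (fun s => H1.enNorm (u s)) ^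
          (4 / ((d : ℝ) - 1)) +
          timeNorm (criticalExp d) (Set.Ioi t₁) (fun s => H1.enNorm (v s)) ^ (4 / ((d : ℝ) - 1))) *
          (2 * (ENNReal.ofReal C₃ * ‖(u t₀ - v t₀).fn‖ₑ))) := by
        refine mul_le_mul_right (mul_le_mul' (add_le_add ?_ ?_) ?_) _
        · exact ENNReal.rpow_le_rpow (timeNorm_mono_set (by linarith) Set.Ioc_subset_Ioi_self _) hp.le
        · exact ENNReal.rpow_le_rpow (timeNorm_mono_set (by linarith) Set.Ioc_subset_Ioi_self _) hp.le
        · refine le_trans ?_ hS2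
          rw [hS]
          exact timeNorm_mono_set (by linarith) (Set.Ioc_subset_Ioc_left h01) _
    _ = _ := by
        rw [ENNReal.ofReal_mul hC₂.le, ENNReal.ofReal_mul (by norm_num), ENNReal.ofReal_ofNat]
        ring


/-! ### Smallness of the free evolution from a well-chosen time. -/

/-- Interpolation of Lebesgue norms. -/
theorem eLpNorm_le_rpow_mul_rpow (f : L2 d) {p₁ p₂ q θ : ℝ} (h₁ : 0 < p₁) (h₂ : 0 < p₂)
    (hθ0 : 0 < θ) (hθ1 : θ < 1) (hq : 1 / q = θ / p₁ + (1 - θ) / p₂) :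
    eLpNorm f (ENNReal.ofReal q) ≤
      eLpNorm f (ENNReal.ofReal p₁) ^ θ * eLpNorm f (ENNReal.ofReal p₂) ^ (1 - θ) := by
  have hq0 : 0 < q := by
    have : 0 < 1 / q := hq ▸ add_pos (by positivity) (div_pos (by linarith) h₂)
    exact one_div_pos.1 this
  have h1θ : 0 < 1 - θ := by linarith
  have hf : AEMeasurable (fun x => ‖f x‖ₑ) volume := (Lp.aestronglyMeasurable f).enorm
  rw [eLpNorm_ofReal_eq hq0, eLpNorm_ofReal_eq h₁, eLpNorm_ofReal_eq h₂]
  have h := lintegral_rpow_mul_le hf (hf.pow_const (1 - θ)) (p := θ) (a := p₁)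
    (b := p₂ / (1 - θ)) (c := q) hθ0 h₁ (by positivity) (by rw [hq, one_div_div])
  refine (le_of_eq ?_).trans (h.trans (le_of_eq ?_))
  · congr 1
    refine lintegral_congr fun x => ?_
    rw [← ENNReal.rpow_add_of_nonneg _ _ hθ0.le h1θ.le, add_sub_cancel, ENNReal.rpow_one]
  · congr 1
    rw [one_div_div, ← ENNReal.rpow_mul]
    simp_rw [← ENNReal.rpow_mul]
    have e : (1 - θ) * (p₂ / (1 - θ)) = p₂ := by field_simp
    rw [e]
    congr 1; ring

/-- Half the gap t - b is used because the far kernel lives on a strict inequality, which the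
endpoint s = b would violate at the full gap. -/
theorem lintegral_Ioc_kernel_le {κ : ℝ} (hκ : 1 < κ) {t b : ℝ} (hbt : b < t) (a : ℝ) :
    ∫⁻ s in Set.Ioc a b, ENNReal.ofReal (|t - s| ^ (-κ)) ≤
      ENNReal.ofReal (2 / (κ - 1) * ((t - b) / 2) ^ (1 - κ)) := by
  have hR : 0 < (t - b) / 2 := by linarith
  rw [← lintegral_far_kernel hκ hR, ← lintegral_indicator measurableSet_Ioc]
  refine le_trans ?_ (lintegral_sub_left_eq_self
    ({s : ℝ | (t - b) / 2 < |s|}.indicator fun s => ENNReal.ofReal (|s| ^ (-κ))) t).le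
  refine lintegral_mono fun s => ?_
  by_cases hs : s ∈ Set.Ioc a b
  · have h1 : t - b ≤ t - s := by linarith [hs.2]
    have h2 : t - s ∈ {s : ℝ | (t - b) / 2 < |s|} := by
      show (t - b) / 2 < |t - s|
      rw [abs_of_pos (by linarith)]; linarith
    rw [Set.indicator_of_mem hs, Set.indicator_of_mem h2]
  · rw [Set.indicator_of_notMem hs]; exact zero_le

/-- Unitarity bounds the two endpoint states, so the estimate does not grow with the length of the
time interval. -/
theorem norm_duhamelDiff_le {u v : ℝ → H1 d} {K : ℝ} (h : ∀ t, ‖u t - v t‖ ≤ K) (t t₁ t₂ : ℝ) :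
    ‖duhamelDiff u v t t₁ t₂‖ ≤ 2 * K := by
  rw [duhamelDiff]
  refine (norm_sub_le _ _).trans ?_
  rw [norm_schrodingerH1, norm_schrodingerH1]
  linarith [h t₁, h t₂]

/-- Pointwise decay of the contribution of the remote past. -/
theorem exists_enNorm_remote_le (hd : 3 ≤ d) (K : ℝ) (hK : 0 ≤ K) :
    ∃ C : ℝ, 0 ≤ C ∧ ∀ u : ℝ → H1 d, IsGlobalSolution u → (∀ t, ‖u t‖ ≤ K) →
      ∀ b t : ℝ, 0 ≤ b → b < t → H1.enNorm (duhamelDiff u (fun _ => 0) t 0 b) ≤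
        C * (t - b) ^ (-((d : ℝ) / (4 * (d + 1)))) := by
  have h3 := three_le_cast hd
  have h8 : (0 : ℝ) < 3 * d - 8 := by linarith
  have h1' : (d : ℝ) - 1 ≠ 0 := by linarith
  have hp := power_pos hd
  -- r gives the dispersive rate 4/3 > 1, integrable at infinity, and r' is its conjugate. The
  -- exponent s = (p+1) r' puts the nonlinearity in L^{r'}; it lies in the subcritical Sobolev
  -- range, so the energy bound K controls it at every time.
  obtain ⟨r, hr⟩ : ∃ r : ℝ, r = 6 * d / (3 * d - 8) := ⟨_, rfl⟩
  obtain ⟨r', hr'⟩ : ∃ r : ℝ, r = 6 * d / (3 * d + 8) := ⟨_, rfl⟩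
  obtain ⟨s, hs⟩ : ∃ s : ℝ, s = ((d : ℝ) + 3) / (d - 1) * r' := ⟨_, rfl⟩
  have hr2 : 2 < r := by rw [hr, lt_div_iff₀ h8]; linarith
  have hconj : r.HolderConjugate r' := by
    rw [Real.holderConjugate_iff]
    refine ⟨by linarith, ?_⟩
    rw [hr, hr']; field_simp; ring
  have hδ : (d : ℝ) * (1 / 2 - 1 / r) = 4 / 3 := by rw [hr]; field_simp; ring
  have hs2 : 2 < s := by
    rw [hs, hr', div_mul_div_comm, lt_div_iff₀ (mul_pos (by linarith) (by linarith))]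
    nlinarith
  have hsd : (d : ℝ) * (1 / 2 - 1 / s) < 1 := by
    have e : 1 / s = ((d : ℝ) - 1) * (3 * d + 8) / (6 * d * (d + 3)) := by
      rw [hs, hr']; field_simp
    have h2 : ((d : ℝ) - 2) / (2 * d) < 1 / s := by
      rw [e, div_lt_div_iff₀ (by positivity) (by positivity)]
      nlinarith [mul_pos (show (0 : ℝ) < d by linarith) (show (0 : ℝ) < d by linarith)]
    have h4 : (d : ℝ) * (((d : ℝ) - 2) / (2 * d)) = (d - 2) / 2 := by field_simp
    nlinarith [mul_lt_mul_of_pos_left h2 (show (0 : ℝ) < d by linarith)]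
  have hcs : 1 / r' = 4 / ((d : ℝ) - 1) / s + 1 / s := by
    rw [hs, hr']; field_simp; ring
  obtain ⟨Cs, hCs, hsob, -⟩ := H1.exists_lpNorm_le d hs2 hsd
  obtain ⟨C₁, hC₁, hdis⟩ := exists_eLpNorm_duhamelDiff_le hd hconj hr2
  rw [hδ] at hdis
  obtain ⟨B, hB⟩ : ∃ B : ℝ, B = 3 * (Cs * K) ^ (4 / ((d : ℝ) - 1)) * (Cs * K) := ⟨_, rfl⟩
  have hB0 : 0 ≤ B := by rw [hB]; positivity
  -- L^{p+2} lies between L^r and L² with this θ. Integrating the rate 4/3 leaves (t-b)^{-1/3}, and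
  -- interpolation turns it into the power -θ/3 = -d/(4(d+1)).
  obtain ⟨θ, hθ⟩ : ∃ θ : ℝ, θ = 3 * d / (4 * (d + 1)) := ⟨_, rfl⟩
  have hθ0 : 0 < θ := by rw [hθ]; positivity
  have hθ1 : θ < 1 := by rw [hθ, div_lt_one (by positivity)]; linarith
  refine ⟨(C₁ * B * (6 * 2 ^ (1 / 3 : ℝ))) ^ θ * (2 * K) ^ (1 - θ), by positivity,
    fun u hu huK b t hb hbt => ?_⟩
  have hnl : ∀ τ, eLpNorm (fun x => nonlinearity d ((u τ).fn x) - nonlinearity d ((0 : H1 d).fn x))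
      (ENNReal.ofReal r') ≤ ENNReal.ofReal B := by
    intro τ
    refine (H1.eLpNorm_nonlinearity_sub_le hd hs2 hsd hconj.symm.lt.le hcs (u τ) 0).trans
      (ENNReal.ofReal_le_ofReal ?_)
    rw [H1.lpNorm_zero, Real.zero_rpow hp.ne', add_zero, sub_zero, hB]
    have h5 : H1.lpNorm s (u τ) ≤ Cs * K := (hsob _).trans (by gcongr; exact huK τ)
    have h6 := H1.lpNorm_nonneg s (u τ)
    have h7 := Real.rpow_le_rpow h6 h5 hp.le
    gcongr
  have hr_bound : eLpNorm (duhamelDiff u (fun _ => 0) t 0 b).fn (ENNReal.ofReal r) volume ≤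
      ENNReal.ofReal (C₁ * B * (6 * 2 ^ (1 / 3 : ℝ)) * (t - b) ^ (-(1 / 3 : ℝ))) := by
    refine (hdis u _ hu isGlobalSolution_zero (fun _ => ENNReal.ofReal B) hnl t 0 b hb).trans ?_
    rw [lintegral_mul_const' _ _ ENNReal.ofReal_ne_top]
    refine (mul_le_mul_right (mul_le_mul_left
      (lintegral_Ioc_kernel_le (by norm_num) hbt 0) _) _).trans (le_of_eq ?_)
    have htb : 0 < t - b := by linarith
    rw [← ENNReal.ofReal_mul (by positivity), ← ENNReal.ofReal_mul hC₁.le]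
    congr 1
    rw [Real.div_rpow htb.le (by norm_num), show (1 : ℝ) - 4 / 3 = -(1 / 3) by norm_num,
      Real.rpow_neg (show (0 : ℝ) ≤ 2 by norm_num)]
    field_simp; norm_num; ring
  have h2_bound : eLpNorm (duhamelDiff u (fun _ => 0) t 0 b).fn (ENNReal.ofReal 2) volume ≤
      ENNReal.ofReal (2 * K) := by
    rw [ENNReal.ofReal_ofNat, ← Lp.enorm_def, ← ofReal_norm]
    exact ENNReal.ofReal_le_ofReal ((H1.norm_fn_le _).trans
      (norm_duhamelDiff_le (fun t => by simpa using huK t) _ _ _))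
  have hint := eLpNorm_le_rpow_mul_rpow (duhamelDiff u (fun _ => 0) t 0 b).fn (p₁ := r) (p₂ := 2)
    (q := energyExp d) (θ := θ) (by linarith) (by norm_num) hθ0 hθ1
    (by rw [hr, hθ, energyExp]; field_simp; ring)
  have htb : 0 < t - b := by linarith
  rw [← H1.ofReal_lpNorm (two_lt_energyExp hd) (decay_energyExp_lt hd)] at hint
  have h9 := hint.trans (mul_le_mul' (ENNReal.rpow_le_rpow hr_bound hθ0.le)
    (ENNReal.rpow_le_rpow h2_bound (show 0 ≤ 1 - θ by linarith)))
  rw [ENNReal.ofReal_rpow_of_nonneg (by positivity) hθ0.le,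
    ENNReal.ofReal_rpow_of_nonneg (by positivity) (by linarith), ← ENNReal.ofReal_mul (by positivity),
    ENNReal.ofReal_le_ofReal_iff (by positivity)] at h9
  refine h9.trans (le_of_eq ?_)
  rw [Real.mul_rpow (by positivity) (by positivity), ← Real.rpow_mul htb.le,
    show -(1 / 3 : ℝ) * θ = -((d : ℝ) / (4 * (d + 1))) by rw [hθ]; field_simp]
  ring

theorem lintegral_Ioi_sub_rpow {κ : ℝ} (hκ : 1 < κ) {b t₀ : ℝ} (hb : b < t₀) :
    ∫⁻ t in Set.Ioi t₀, ENNReal.ofReal ((t - b) ^ (-κ)) ≤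
      ENNReal.ofReal (2 / (κ - 1) * (t₀ - b) ^ (1 - κ)) := by
  rw [← lintegral_far_kernel hκ (sub_pos.2 hb), ← lintegral_indicator measurableSet_Ioi]
  refine le_trans ?_ (lintegral_sub_right_eq_self
    ({s : ℝ | t₀ - b < |s|}.indicator fun s => ENNReal.ofReal (|s| ^ (-κ))) b).le
  refine lintegral_mono fun t => ?_
  by_cases ht : t ∈ Set.Ioi t₀
  · have h1 : t₀ < t := ht
    have h2 : |t - b| = t - b := abs_of_pos (by linarith)
    have h3 : t - b ∈ {s : ℝ | t₀ - b < |s|} := by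
      show t₀ - b < |t - b|
      rw [h2]; linarith
    rw [Set.indicator_of_mem ht, Set.indicator_of_mem h3, h2]
  · rw [Set.indicator_of_notMem ht]; exact zero_le

/-- The pointwise rate d/(4(d+1)) multiplied by the critical exponent is d/(d-1) > 1, so the decay
is integrable beyond t₀ and leaves a negative power of the gap t₀ - b. -/
theorem exists_timeNorm_remote_le (hd : 3 ≤ d) (K : ℝ) (hK : 0 ≤ K) :
    ∃ C μ : ℝ, 0 ≤ C ∧ 0 < μ ∧ ∀ u : ℝ → H1 d, IsGlobalSolution u → (∀ t, ‖u t‖ ≤ K) →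
      ∀ b t₀ : ℝ, 0 ≤ b → b < t₀ → timeNorm (criticalExp d) (Set.Ioi t₀)
        (fun t => H1.enNorm (duhamelDiff u (fun _ => 0) t 0 b)) ≤
        ENNReal.ofReal (C * (t₀ - b) ^ (-μ)) := by
  have h3 := three_le_cast hd
  have h1' : (d : ℝ) - 1 ≠ 0 := by linarith
  have h1p : 0 < (d : ℝ) - 1 := by linarith
  have ha := criticalExp_pos hd
  have ha0 : 0 < criticalExp d := by linarith
  obtain ⟨C, hC, h⟩ := exists_enNorm_remote_le hd K hK
  refine ⟨C * (2 * (d - 1)) ^ (1 / criticalExp d), 1 / ((d - 1) * criticalExp d), by positivity,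
    by positivity, fun u hu huK b t₀ hb hbt => ?_⟩
  have htb : 0 < t₀ - b := by linarith
  have hκ : 1 < (d : ℝ) / (d - 1) := by rw [lt_div_iff₀ h1p]; linarith
  have hle : ∫⁻ t in Set.Ioi t₀, ENNReal.ofReal
      (H1.enNorm (duhamelDiff u (fun _ => 0) t 0 b)) ^ criticalExp d ≤
      ENNReal.ofReal (C ^ criticalExp d * ((2 * (d - 1)) * (t₀ - b) ^ (-(1 / ((d : ℝ) - 1))))) := by
    calc _ ≤ ∫⁻ t in Set.Ioi t₀, ENNReal.ofReal (C ^ criticalExp d) *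
          ENNReal.ofReal ((t - b) ^ (-((d : ℝ) / (d - 1)))) := by
          refine setLIntegral_mono' measurableSet_Ioi fun t ht => ?_
          have ht' : t₀ < t := ht
          have ht0 : 0 < t - b := by linarith
          rw [ENNReal.ofReal_rpow_of_nonneg (H1.lpNorm_nonneg _ _) ha0.le,
            ← ENNReal.ofReal_mul (by positivity)]
          refine ENNReal.ofReal_le_ofReal ?_
          refine (Real.rpow_le_rpow (H1.lpNorm_nonneg _ _) (h u hu huK b t hb (by linarith))
            ha0.le).trans (le_of_eq ?_)
          rw [Real.mul_rpow hC (by positivity), ← Real.rpow_mul ht0.le]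
          congr 2
          rw [criticalExp]; field_simp
      _ ≤ ENNReal.ofReal (C ^ criticalExp d) * ENNReal.ofReal
          (2 / ((d : ℝ) / (d - 1) - 1) * (t₀ - b) ^ (1 - (d : ℝ) / (d - 1))) := by
          rw [lintegral_const_mul' _ _ ENNReal.ofReal_ne_top]
          exact mul_le_mul_right (lintegral_Ioi_sub_rpow hκ hbt) _
      _ = _ := by
          rw [← ENNReal.ofReal_mul (by positivity)]
          have e1 : (d : ℝ) / (d - 1) - 1 = 1 / (d - 1) := by field_simp; ring
          have e2 : 1 - (d : ℝ) / (d - 1) = -(1 / (d - 1)) := by rw [← e1]; ring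
          rw [e2, e1]
          congr 3; field_simp
  refine (ENNReal.rpow_le_rpow hle (by positivity)).trans (le_of_eq ?_)
  rw [ENNReal.ofReal_rpow_of_nonneg (by positivity) (by positivity)]
  congr 1
  rw [Real.mul_rpow (by positivity) (by positivity), Real.mul_rpow (by positivity) (by positivity),
    ← Real.rpow_mul hC, mul_one_div_cancel ha0.ne', Real.rpow_one, ← Real.rpow_mul htb.le, mul_assoc]
  congr 3
  field_simp

/-- The critical norm is controlled by the scattering norm and the energy norm. -/
theorem exists_timeNorm_le_spacetimeNorm (hd : 3 ≤ d) (K : ℝ) (hK : 0 ≤ K) :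
    ∃ M θ : ℝ, 0 ≤ M ∧ 0 < θ ∧ ∀ u : ℝ → H1 d, (∀ t, ‖u t‖ ≤ K) → ∀ b t₀ : ℝ,
      timeNorm (criticalExp d) (Set.Ioc b t₀) (fun t => H1.enNorm (u t)) ≤
        spacetimeNorm (2 * ((d : ℝ) + 2) / ((d : ℝ) - 1)) (Set.Icc b t₀) u ^ θ *
          ENNReal.ofReal M := by
  have h3 := three_le_cast hd
  have h1' : (d : ℝ) - 1 ≠ 0 := by linarith
  have h1p : 0 < (d : ℝ) - 1 := by linarith
  have ha := criticalExp_pos hd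
  have ha0 : 0 < criticalExp d := by linarith
  obtain ⟨q, hq⟩ : ∃ q : ℝ, q = 2 * ((d : ℝ) + 2) / ((d : ℝ) - 1) := ⟨_, rfl⟩
  -- The Lebesgue exponent of the Sobolev embedding of order 1/2, well inside the H¹ range. The
  -- L^{p+2} norm is interpolated between L^q and this L^σ.
  obtain ⟨σ, hσ⟩ : ∃ σ : ℝ, σ = 2 * (d : ℝ) / ((d : ℝ) - 1) := ⟨_, rfl⟩
  have hq0 : 0 < q := by rw [hq]; positivity
  have hσ2 : 2 < σ := by rw [hσ, lt_div_iff₀ h1p]; linarith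
  have hσd : (d : ℝ) * (1 / 2 - 1 / σ) < 1 := by
    rw [hσ, show (d : ℝ) * (1 / 2 - 1 / (2 * (d : ℝ) / (d - 1))) = 1 / 2 by field_simp; ring]
    norm_num
  obtain ⟨C, hC, hsob, -⟩ := H1.exists_lpNorm_le d hσ2 hσd
  -- Fixed by θ a = q: after raising to the critical power the time integrand is exactly that of the
  -- L^q space-time norm. By scaling, the same θ is the spatial interpolation parameter.
  obtain ⟨θ, hθ⟩ : ∃ θ : ℝ, θ = ((d : ℝ) + 2) / (2 * (d + 1)) := ⟨_, rfl⟩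
  have hθ0 : 0 < θ := by rw [hθ]; positivity
  have hθ1 : θ < 1 := by rw [hθ, div_lt_one (by positivity)]; linarith
  have hθa : θ * criticalExp d = q := by rw [hθ, hq, criticalExp]; field_simp; ring
  refine ⟨(C * K) ^ (1 - θ), θ, by positivity, hθ0, fun u hu b t₀ => ?_⟩
  rw [← hq]
  have hpt : ∀ t, ENNReal.ofReal (H1.enNorm (u t)) ^ criticalExp d ≤
      (∫⁻ x, ‖(u t).fn x‖ₑ ^ q) * ENNReal.ofReal ((C * K) ^ (1 - θ)) ^ criticalExp d := by
    intro t
    rw [H1.ofReal_lpNorm (two_lt_energyExp hd) (decay_energyExp_lt hd)]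
    have h5 := eLpNorm_le_rpow_mul_rpow (u t).fn (p₁ := q) (p₂ := σ) (q := energyExp d) (θ := θ)
      hq0 (by linarith) hθ0 hθ1 (by rw [hθ, hq, hσ, energyExp]; field_simp; ring)
    refine (ENNReal.rpow_le_rpow h5 ha0.le).trans ?_
    rw [ENNReal.mul_rpow_of_nonneg _ _ ha0.le, eLpNorm_ofReal_eq hq0]
    refine mul_le_mul' (le_of_eq ?_) (ENNReal.rpow_le_rpow ?_ ha0.le)
    · rw [← ENNReal.rpow_mul, hθa, ← ENNReal.rpow_mul, one_div_mul_cancel hq0.ne', ENNReal.rpow_one]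
    · rw [← ENNReal.ofReal_rpow_of_nonneg (by positivity) (by linarith), ← H1.ofReal_lpNorm hσ2 hσd]
      refine ENNReal.rpow_le_rpow (ENNReal.ofReal_le_ofReal ?_) (by linarith)
      exact (hsob _).trans (by gcongr; exact hu t)
  have hle : ∫⁻ t in Set.Ioc b t₀, ENNReal.ofReal (H1.enNorm (u t)) ^ criticalExp d ≤
      (∫⁻ t in Set.Icc b t₀, ∫⁻ x, ‖(u t).fn x‖ₑ ^ q) *
        ENNReal.ofReal ((C * K) ^ (1 - θ)) ^ criticalExp d := by
    rw [← lintegral_mul_const' _ _ (ENNReal.rpow_ne_top_of_nonneg ha0.le ENNReal.ofReal_ne_top)]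
    exact (lintegral_mono_set Set.Ioc_subset_Icc_self).trans (lintegral_mono fun t => hpt t)
  refine (ENNReal.rpow_le_rpow hle (by positivity)).trans (le_of_eq ?_)
  rw [ENNReal.mul_rpow_of_nonneg _ _ (by positivity), ← ENNReal.rpow_mul, mul_one_div_cancel ha0.ne',
    ENNReal.rpow_one, spacetimeNorm, ← ENNReal.rpow_mul]
  congr 2
  rw [← hθa]; field_simp

theorem continuous_duhamelDiff_time (u v : ℝ → H1 d) (t₁ t₂ : ℝ) :
    Continuous fun t => duhamelDiff u v t t₁ t₂ :=
  (continuous_schrodingerH1_sub t₂ _).sub (continuous_schrodingerH1_sub t₁ _)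

/-- Fractional integration at b = a, where the output is measured on an arbitrary set of times J,
possibly beyond the interval of integration. The source needs only the critical norm over (b, t₀].
-/
theorem exists_timeNorm_recent_le (hd : 3 ≤ d) :
    ∃ C : ℝ, 0 < C ∧ ∀ u : ℝ → H1 d, IsGlobalSolution u → ∀ (b t₀ : ℝ) (J : Set ℝ), b ≤ t₀ →
      MeasurableSet J →
      timeNorm (criticalExp d) J (fun t => H1.enNorm (duhamelDiff u (fun _ => 0) t b t₀)) ≤
        ENNReal.ofReal C * (timeNorm (criticalExp d) (Set.Ioc b t₀) (fun t => H1.enNorm (u t)) ^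
          (4 / ((d : ℝ) - 1)) *
          timeNorm (criticalExp d) (Set.Ioc b t₀) (fun t => H1.enNorm (u t))) := by
  have h3 := three_le_cast hd
  have hp := power_pos hd
  have ha := criticalExp_pos hd
  obtain ⟨C₀, hC₀, h0⟩ := exists_enNorm_duhamelDiff_le hd
  obtain ⟨C, hC, h⟩ := exists_timeNorm_le_of_pointwise hd (b := criticalExp d)
    (c := 4 * ((d : ℝ) + 1) / ((d : ℝ) + 3)) (by linarith)
    (by rw [lt_div_iff₀ (by linarith)]; linarith)
    (by rw [criticalExp]; have h1 : (d : ℝ) - 1 ≠ 0 := by linarith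
        field_simp; ring) C₀ hC₀
  refine ⟨C, hC, fun u hu b t₀ J hbt hJ => ?_⟩
  have h1 := h u (fun _ => 0) hu.continuous continuous_const b t₀ J _ hJ
    (fun t _ => h0 u (fun _ => 0) hu isGlobalSolution_zero t b t₀ hbt)
  simp only [sub_zero] at h1
  rwa [timeNorm_enNorm_zero (by linarith), ENNReal.zero_rpow_of_pos hp, add_zero] at h1

/-- Under the hypotheses of the criterion, the linear evolution from some time has small critical
norm. -/
theorem exists_small_linear_evolution (hd : 3 ≤ d) {K C₂ η : ℝ} (hK : 0 ≤ K) (hC₂ : 0 < C₂)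
    (hη : 0 < η) :
    ∃ ε₀ : ℝ, 0 < ε₀ ∧ ∀ ε : ℝ, 0 < ε → ε ≤ ε₀ → ∃ Tmin : ℝ, 0 < Tmin ∧ ∀ T₀ : ℝ, Tmin ≤ T₀ →
      ∀ u : ℝ → H1 d, IsGlobalSolution u → (∀ t, ‖u t‖ ≤ K) →
      (∀ a : ℝ, ∃ t₀ ∈ Set.Ioo a (a + T₀),
        spacetimeNorm (2 * ((d : ℝ) + 2) / ((d : ℝ) - 1))
          (Set.Icc (t₀ - T₀ ^ (1 / 3 : ℝ)) t₀) u ≤ ENNReal.ofReal (C₂ * ε)) →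
      ∃ t₀ : ℝ, timeNorm (criticalExp d) (Set.Ioi t₀)
        (fun t => H1.enNorm (schrodingerH1 (t - t₀) (u t₀))) ≤ ENNReal.ofReal η := by
  have hp := power_pos hd
  have ha := criticalExp_pos hd
  obtain ⟨C, hC, hrec⟩ := exists_timeNorm_recent_le hd
  obtain ⟨M, θ, hM, hθ, hX⟩ := exists_timeNorm_le_spacetimeNorm hd K hK
  obtain ⟨D, μ, hD, hμ, hrem⟩ := exists_timeNorm_remote_le hd K hK
  obtain ⟨p, hpe⟩ : ∃ p : ℝ, p = 4 / ((d : ℝ) - 1) := ⟨_, rfl⟩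
  simp only [← hpe] at hp hrec
  have hη3 : 0 < η / 3 := by positivity
  obtain ⟨ε₀, hε₀, hε⟩ : ∃ ε₀ : ℝ, 0 < ε₀ ∧ ∀ ε : ℝ, 0 < ε → ε ≤ ε₀ →
      C * (((C₂ * ε) ^ θ * M) ^ p * ((C₂ * ε) ^ θ * M)) ≤ η / 3 := by
    have h1 : Continuous fun ε : ℝ => (C₂ * ε) ^ θ * M :=
      ((continuous_const.mul continuous_id).rpow_const fun _ => Or.inr hθ.le).mul continuous_const
    have h2 : Continuous fun ε : ℝ => C * (((C₂ * ε) ^ θ * M) ^ p * ((C₂ * ε) ^ θ * M)) :=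
      continuous_const.mul ((h1.rpow_const fun _ => Or.inr hp.le).mul h1)
    have ht := h2.tendsto 0
    rw [mul_zero, Real.zero_rpow hθ.ne', zero_mul, mul_zero, mul_zero] at ht
    obtain ⟨r, hr, hr'⟩ := Metric.eventually_nhds_iff.1 (ht.eventually (ge_mem_nhds hη3))
    refine ⟨r / 2, by positivity, fun ε h0 hε => hr' ?_⟩
    rw [Real.dist_eq, sub_zero, abs_of_pos h0]; linarith
  refine ⟨ε₀, hε₀, fun ε hε0 hεle => ?_⟩
  obtain ⟨Tmin, hTmin, hT⟩ : ∃ Tmin : ℝ, 0 < Tmin ∧ ∀ T₀, Tmin ≤ T₀ →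
      D * (T₀ ^ (1 / 3 : ℝ)) ^ (-μ) ≤ η / 3 := by
    have h1 : Tendsto (fun T : ℝ => D * (T ^ (1 / 3 : ℝ)) ^ (-μ)) atTop (𝓝 (D * 0)) :=
      ((tendsto_rpow_neg_atTop hμ).comp (tendsto_rpow_atTop (by norm_num))).const_mul D
    rw [mul_zero] at h1
    obtain ⟨T, hT⟩ := eventually_atTop.1 (h1.eventually (ge_mem_nhds hη3))
    exact ⟨max T 1, by positivity, fun T₀ h => hT T₀ ((le_max_left _ _).trans h)⟩
  refine ⟨Tmin, hTmin, fun T₀ hT₀ u hu huK hyp => ?_⟩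
  have hT0 : 0 < T₀ := hTmin.trans_le hT₀
  have hT3 : 0 < T₀ ^ (1 / 3 : ℝ) := by positivity
  -- A depends on u(0) and not only on its norm; this is harmless because the good times recur
  -- arbitrarily late.
  obtain ⟨A, hA⟩ : ∃ A, timeNorm (criticalExp d) (Set.Ioi A)
      (fun t => H1.enNorm (schrodingerH1 t (u 0))) ≤ ENNReal.ofReal (η / 3) :=
    ((tendsto_timeNorm_schrodingerH1 hd (u 0)).eventually
      (ge_mem_nhds (ENNReal.ofReal_pos.2 hη3))).exists
  -- Starting the window beyond both numbers ensures t₀ ≥ A for the free part and b ≥ 0 for the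
  -- remote part.
  obtain ⟨t₀, ht₀, hsm⟩ := hyp (max A (T₀ ^ (1 / 3 : ℝ)))
  have hAt : A ≤ t₀ := (le_max_left _ _).trans ht₀.1.le
  have hbt : T₀ ^ (1 / 3 : ℝ) ≤ t₀ := (le_max_right _ _).trans ht₀.1.le
  refine ⟨t₀, ?_⟩
  set b := t₀ - T₀ ^ (1 / 3 : ℝ) with hb
  have hn := continuous_enNorm (d := d) hd
  have c1 : Continuous fun t => H1.enNorm (schrodingerH1 t (u 0)) :=
    hn.comp (continuous_schrodingerH1_time _)
  have c2 : Continuous fun t => H1.enNorm (duhamelDiff u (fun _ => 0) t 0 b) :=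
    hn.comp (continuous_duhamelDiff_time _ _ _ _)
  have c3 : Continuous fun t => H1.enNorm (duhamelDiff u (fun _ => 0) t b t₀) :=
    hn.comp (continuous_duhamelDiff_time _ _ _ _)
  have hsum : ∀ t, H1.enNorm (schrodingerH1 (t - t₀) (u t₀)) ≤
      H1.enNorm (schrodingerH1 t (u 0)) + (H1.enNorm (duhamelDiff u (fun _ => 0) t 0 b) +
        H1.enNorm (duhamelDiff u (fun _ => 0) t b t₀)) := by
    intro t
    -- The two Duhamel terms are differences of evolved states and telescope.
    have e : schrodingerH1 (t - t₀) (u t₀) = schrodingerH1 t (u 0) +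
        (duhamelDiff u (fun _ => 0) t 0 b + duhamelDiff u (fun _ => 0) t b t₀) := by
      simp only [duhamelDiff, sub_zero]; abel
    rw [e]
    exact (enNorm_add_le hd _ _).trans (add_le_add le_rfl (enNorm_add_le hd _ _))
  have hfirst := (timeNorm_mono_set (by linarith) (Set.Ioi_subset_Ioi hAt) _).trans hA
  have hsecond : timeNorm (criticalExp d) (Set.Ioi t₀)
      (fun t => H1.enNorm (duhamelDiff u (fun _ => 0) t 0 b)) ≤ ENNReal.ofReal (η / 3) := by
    refine (hrem u hu huK b t₀ (by linarith) (by linarith)).trans (ENNReal.ofReal_le_ofReal ?_)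
    rw [show t₀ - b = T₀ ^ (1 / 3 : ℝ) by rw [hb]; ring]
    exact hT T₀ hT₀
  have hthird : timeNorm (criticalExp d) (Set.Ioi t₀)
      (fun t => H1.enNorm (duhamelDiff u (fun _ => 0) t b t₀)) ≤ ENNReal.ofReal (η / 3) := by
    have hXs : timeNorm (criticalExp d) (Set.Ioc b t₀) (fun t => H1.enNorm (u t)) ≤
        ENNReal.ofReal ((C₂ * ε) ^ θ * M) := by
      refine (hX u huK b t₀).trans ((mul_le_mul_left (ENNReal.rpow_le_rpow hsm hθ.le) _).trans
        (le_of_eq ?_))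
      rw [ENNReal.ofReal_rpow_of_pos (by positivity), ← ENNReal.ofReal_mul (by positivity)]
    refine (hrec u hu b t₀ _ (by linarith) measurableSet_Ioi).trans ?_
    refine (mul_le_mul_right (mul_le_mul' (ENNReal.rpow_le_rpow hXs hp.le) hXs) _).trans ?_
    rw [ENNReal.ofReal_rpow_of_nonneg (by positivity) hp.le, ← ENNReal.ofReal_mul (by positivity),
      ← ENNReal.ofReal_mul hC.le]
    exact ENNReal.ofReal_le_ofReal (hε ε hε0 hεle)
  refine (timeNorm_le_add ha.le measurableSet_Ioi c1.measurable (c2.add c3).measurable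
    (fun t _ => hsum t)).trans ?_
  refine (add_le_add hfirst ((timeNorm_le_add ha.le measurableSet_Ioi c2.measurable c3.measurable
    (fun t _ => le_rfl)).trans (add_le_add hsecond hthird))).trans (le_of_eq ?_)
  rw [← ENNReal.ofReal_add hη3.le hη3.le, ← ENNReal.ofReal_add hη3.le (by positivity)]
  congr 1; ring


/-! ### Translations and difference quotients. -/

/-- The symbol of the translation by `h`. -/
def translationSymbol (h ξ : Space d) : ℂ :=
  Complex.exp (((2 * π * inner ℝ h ξ : ℝ) : ℂ) * Complex.I)

theorem norm_translationSymbol (h ξ : Space d) : ‖translationSymbol h ξ‖ = 1 :=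
  Complex.norm_exp_ofReal_mul_I _

theorem continuous_translationSymbol (h : Space d) : Continuous (translationSymbol h) := by
  unfold translationSymbol; fun_prop

theorem memLp_translationSymbol (h : Space d) :
    MemLp (translationSymbol h) ∞ (volume : Measure (Space d)) :=
  memLp_top_of_bound (continuous_translationSymbol h).aestronglyMeasurable 1
    (ae_of_all _ fun ξ => (norm_translationSymbol h ξ).le)

/-- Translation on `L²`, as a Fourier multiplier. -/
def translateL2 (h : Space d) : L2 d →ₗᵢ[ℂ] L2 d where
  toFun := multiplierL2 (memLp_translationSymbol h)
  map_add' := multiplierL2_add _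
  map_smul' := multiplierL2_smul _
  norm_map' := norm_multiplierL2 _ (norm_translationSymbol h)

theorem fourier_translateL2 (h : Space d) (f : L2 d) :
    (𝓕 (translateL2 h f) : L2 d) =ᵐ[volume] fun ξ => translationSymbol h ξ * (𝓕 f : L2 d) ξ :=
  fourier_multiplierL2 _ f

theorem translateL2_schrodingerL2 (h : Space d) (t : ℝ) (f : L2 d) :
    translateL2 h (schrodingerL2 t f) = schrodingerL2 t (translateL2 h f) := by
  apply fourier_injective_ae
  filter_upwards [fourier_translateL2 h (schrodingerL2 t f), fourier_translateL2 h f,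
    fourier_multiplierL2 (memLp_symbol d t) f,
    fourier_multiplierL2 (memLp_symbol d t) (translateL2 h f)] with ξ h1 h2 h3 h4
  rw [h1, schrodingerL2_eq_multiplierL2, h3, schrodingerL2_eq_multiplierL2, h4, h2]
  ring

theorem fourier_compSubConst (h : Space d) (φ : 𝓢(Space d, ℂ)) (ξ : Space d) :
    (𝓕 (φ.compSubConstCLM ℂ (-h)) : 𝓢(Space d, ℂ)) ξ =
      translationSymbol h ξ * (𝓕 φ : 𝓢(Space d, ℂ)) ξ := by
  rw [SchwartzMap.fourier_coe, SchwartzMap.fourier_coe]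
  have e : (φ.compSubConstCLM ℂ (-h) : Space d → ℂ) = (φ : Space d → ℂ) ∘ fun x => x + h := by
    ext x
    simp
  rw [e]
  have := congrFun (VectorFourier.fourierIntegral_comp_add_right Real.fourierChar
    (volume : Measure (Space d)) (innerₗ (Space d)) (φ : Space d → ℂ) h) ξ
  refine this.trans ?_
  rw [Circle.smul_def, Real.fourierChar_apply, smul_eq_mul, innerₗ_apply_apply, translationSymbol]
  rfl

theorem measurePreserving_add (h : Space d) :
    MeasurePreserving (fun x : Space d => x + h) volume volume :=
  measurePreserving_add_right volume h

/-- As a multiplier, translation visibly commutes with the group and with derivatives, but the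
nonlinearity needs its pointwise form. Both sides are isometries, so agreement on the dense Schwartz
functions suffices. -/
theorem coeFn_translateL2 (h : Space d) (f : L2 d) :
    (translateL2 h f : Space d → ℂ) =ᵐ[volume] fun x => f (x + h) := by
  have key : translateL2 h f =
      Lp.compMeasurePreservingₗᵢ ℂ (fun x : Space d => x + h) (measurePreserving_add h) f := by
    refine (SchwartzMap.denseRange_toLpCLM (F := ℂ) (p := 2) (μ := (volume : Measure (Space d)))
      ENNReal.ofNat_ne_top).induction_on (p := fun f : L2 d => translateL2 h f =
        Lp.compMeasurePreservingₗᵢ ℂ (fun x : Space d => x + h) (measurePreserving_add h) f) f ?_ ?_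
    · exact isClosed_eq (translateL2 h).continuous (LinearIsometry.continuous _)
    · intro φ
      rw [SchwartzMap.toLpCLM_apply]
      have e : Lp.compMeasurePreservingₗᵢ ℂ (fun x : Space d => x + h) (measurePreserving_add h)
          (φ.toLp 2 volume) = (φ.compSubConstCLM ℂ (-h)).toLp 2 volume := by
        apply Lp.ext
        refine (Lp.coeFn_compMeasurePreserving _ (measurePreserving_add h)).trans ?_
        have h1 := (measurePreserving_add h).quasiMeasurePreserving.ae_eq_comp
          (φ.coeFn_toLp 2 (volume : Measure (Space d)))
        filter_upwards [h1, (φ.compSubConstCLM ℂ (-h)).coeFn_toLp 2 (volume : Measure (Space d))]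
          with x h2 h3
        rw [h2, h3]
        simp
      rw [e]
      apply fourier_injective_ae
      rw [SchwartzMap.toLp_fourier_eq]
      filter_upwards [fourier_translateL2 h (φ.toLp 2 volume),
        (𝓕 φ).coeFn_toLp 2 (volume : Measure (Space d)),
        (𝓕 (φ.compSubConstCLM ℂ (-h))).coeFn_toLp 2 (volume : Measure (Space d))] with ξ h1 h2 h3
      rw [h1, SchwartzMap.toLp_fourier_eq, h2, h3, fourier_compSubConst]
  rw [key]
  exact Lp.coeFn_compMeasurePreserving f (measurePreserving_add h)

theorem lineDeriv_translateL2 (h : Space d) {f g : L2 d} {m : Space d}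
    (hfg : ∂_{m} (f : 𝓢'(Space d, ℂ)) = (g : 𝓢'(Space d, ℂ))) :
    ∂_{m} (translateL2 h f : 𝓢'(Space d, ℂ)) = (translateL2 h g : 𝓢'(Space d, ℂ)) := by
  rw [lineDeriv_eq_iff_fourier] at hfg ⊢
  filter_upwards [hfg, fourier_translateL2 h f, fourier_translateL2 h g] with ξ h1 h2 h3
  rw [h3, h2, h1]; ring

/-- Translation on `H¹`. -/
def translateH1 (h : Space d) (f : H1 d) : H1 d :=
  H1.mk (translateL2 h f.fn) (fun j => translateL2 h (f.partialDeriv j))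
    fun j => lineDeriv_translateL2 h (f.lineDeriv_fn j)

theorem fn_translateH1 (h : Space d) (f : H1 d) : (translateH1 h f).fn = translateL2 h f.fn := rfl

theorem translateH1_sub (h : Space d) (f g : H1 d) :
    translateH1 h (f - g) = translateH1 h f - translateH1 h g := by
  apply H1.ext_fn
  rw [H1.fn_sub, fn_translateH1, H1.fn_sub, map_sub]; rfl

theorem norm_translateH1 (h : Space d) (f : H1 d) : ‖translateH1 h f‖ = ‖f‖ := by
  rw [← sq_eq_sq₀ (norm_nonneg _) (norm_nonneg _), H1.norm_sq, H1.norm_sq, fn_translateH1,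
    LinearIsometry.norm_map]
  congr 1
  refine Finset.sum_congr rfl fun j _ => ?_
  rw [translateH1, H1.partialDeriv_mk, LinearIsometry.norm_map]

theorem translateH1_schrodingerH1 (h : Space d) (t : ℝ) (f : H1 d) :
    translateH1 h (schrodingerH1 t f) = schrodingerH1 t (translateH1 h f) := by
  apply H1.ext_fn
  rw [fn_translateH1, fn_schrodingerH1, fn_schrodingerH1, fn_translateH1, translateL2_schrodingerL2]

theorem continuous_translateH1 (h : Space d) : Continuous (translateH1 h : H1 d → H1 d) := by
  refine (LipschitzWith.of_dist_le_mul (K := 1) fun f g => ?_).continuous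
  rw [dist_eq_norm, dist_eq_norm, ← translateH1_sub, norm_translateH1]; simp

theorem enNorm_translateH1 (h : Space d) (f : H1 d) : H1.enNorm (translateH1 h f) = H1.enNorm f := by
  simp only [H1.enNorm, H1.lpNorm]
  rw [fn_translateH1, eLpNorm_congr_ae (coeFn_translateL2 h f.fn)]
  congr 1
  exact eLpNorm_comp_measurePreserving (Lp.aestronglyMeasurable f.fn) (measurePreserving_add h)

theorem integral_translateL2_mul (h : Space d) (f : L2 d) (φ : 𝓢(Space d, ℂ)) :
    ∫ x, translateL2 h f x * φ x = ∫ x, f x * φ.compSubConstCLM ℂ h x := by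
  rw [← integral_add_right_eq_self (fun x => f x * φ.compSubConstCLM ℂ h x) h]
  refine integral_congr_ae ?_
  filter_upwards [coeFn_translateL2 h f] with x hx
  rw [hx, SchwartzMap.compSubConstCLM_apply, add_sub_cancel_right]

theorem schrodingerSchwartz_compSubConst (h : Space d) (t : ℝ) (φ : 𝓢(Space d, ℂ)) :
    (schrodingerSchwartz t (φ.compSubConstCLM ℂ h) : Space d → ℂ) =ᵐ[volume]
      fun x => schrodingerSchwartz t φ (x - h) := by
  have e : ∀ ψ : 𝓢(Space d, ℂ), translateL2 (-h) (schwartzL2 ψ) =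
      schwartzL2 (ψ.compSubConstCLM ℂ h) := by
    intro ψ
    apply Lp.ext
    have h1 := (measurePreserving_add (-h)).quasiMeasurePreserving.ae_eq_comp
      (ψ.coeFn_toLp 2 (volume : Measure (Space d)))
    filter_upwards [coeFn_translateL2 (-h) (schwartzL2 ψ), h1,
      (ψ.compSubConstCLM ℂ h).coeFn_toLp 2 (volume : Measure (Space d))] with x h2 h3 h4
    rw [h2, schwartzL2, schwartzL2, h4, SchwartzMap.compSubConstCLM_apply, sub_eq_add_neg]
    exact h3
  have e2 : ∀ ψ : 𝓢(Space d, ℂ), schrodingerL2 t (schwartzL2 ψ) =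
      schwartzL2 (schrodingerSchwartz t ψ) := schrodingerL2_toLp t
  have e3 : schwartzL2 (schrodingerSchwartz t (φ.compSubConstCLM ℂ h)) =
      schwartzL2 ((schrodingerSchwartz t φ).compSubConstCLM ℂ h) := by
    rw [← e, ← e2, ← e2, ← e, translateL2_schrodingerL2]
  have h5 := (schrodingerSchwartz t (φ.compSubConstCLM ℂ h)).coeFn_toLp 2
    (volume : Measure (Space d))
  have h6 := ((schrodingerSchwartz t φ).compSubConstCLM ℂ h).coeFn_toLp 2
    (volume : Measure (Space d))
  rw [schwartzL2, schwartzL2] at e3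
  rw [e3] at h5
  filter_upwards [h5, h6] with x h7 h8
  rw [← h7, h8, SchwartzMap.compSubConstCLM_apply]

/-- The nonlinearity acts pointwise and the group commutes with translations, so the shift can be
carried by the test function. -/
theorem IsGlobalSolution.translate {u : ℝ → H1 d} (hu : IsGlobalSolution u) (h : Space d) :
    IsGlobalSolution fun t => translateH1 h (u t) := by
  refine ⟨(continuous_translateH1 h).comp hu.continuous, fun t φ => ?_⟩
  have h1 := hu.duhamel t (φ.compSubConstCLM ℂ h)
  rw [← translateH1_schrodingerH1, fn_translateH1, fn_translateH1, integral_translateL2_mul,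
    integral_translateL2_mul, h1]
  congr 2
  refine intervalIntegral.integral_congr fun s _ => ?_
  rw [← integral_add_right_eq_self (fun x => nonlinearity d ((u s).fn x) *
    schrodingerSchwartz (t - s) (φ.compSubConstCLM ℂ h) x) h]
  refine integral_congr_ae ?_
  have h2 := (measurePreserving_add h).quasiMeasurePreserving.ae_eq_comp
    (schrodingerSchwartz_compSubConst h (t - s) φ)
  filter_upwards [coeFn_translateL2 h (u s).fn, h2] with x h3 h4
  rw [fn_translateH1, h3]
  have h5 : schrodingerSchwartz (t - s) (φ.compSubConstCLM ℂ h) (x + h) =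
    schrodingerSchwartz (t - s) φ (x + h - h) := h4
  rw [h5, add_sub_cancel_right]

theorem enorm_rpow_two_eq_lintegral_fourier (f : L2 d) :
    ‖f‖ₑ ^ (2 : ℝ) = ∫⁻ ξ, ‖(𝓕 f : L2 d) ξ‖ₑ ^ (2 : ℝ) := by
  rw [← norm_sq_eq_lintegral, Lp.norm_fourier_eq, ENNReal.ofReal_pow (norm_nonneg _), ofReal_norm,
    ← ENNReal.rpow_natCast]
  norm_num

theorem enorm_sub_translateL2 (h : Space d) (f : L2 d) :
    ‖f - translateL2 h f‖ₑ ^ (2 : ℝ) =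
      ∫⁻ ξ, (‖1 - translationSymbol h ξ‖ₑ * ‖(𝓕 f : L2 d) ξ‖ₑ) ^ (2 : ℝ) := by
  rw [enorm_rpow_two_eq_lintegral_fourier]
  refine lintegral_congr_ae ?_
  have e : (𝓕 (f - translateL2 h f) : L2 d) = 𝓕 f - 𝓕 (translateL2 h f) :=
    map_sub (Lp.fourierTransformₗᵢ (Space d) ℂ) _ _
  rw [e]
  filter_upwards [Lp.coeFn_sub (𝓕 f : L2 d) (𝓕 (translateL2 h f)), fourier_translateL2 h f]
    with ξ h1 h2
  rw [h1, Pi.sub_apply, h2, ← enorm_mul, sub_mul, one_mul]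

theorem enorm_partialDeriv (f : H1 d) (j : Fin d) :
    ‖f.partialDeriv j‖ₑ ^ (2 : ℝ) =
      ∫⁻ ξ, (ENNReal.ofReal (2 * π * |ξ j|) * ‖(𝓕 f.fn : L2 d) ξ‖ₑ) ^ (2 : ℝ) := by
  rw [enorm_rpow_two_eq_lintegral_fourier]
  refine lintegral_congr_ae ?_
  filter_upwards [(lineDeriv_eq_iff_fourier _ _ _).1 (f.lineDeriv_fn j)] with ξ h1
  rw [h1, enorm_mul]
  congr 2
  rw [← ofReal_norm]
  congr 1
  have e : inner ℝ ξ (EuclideanSpace.single j (1 : ℝ)) = ξ j := by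
    rw [EuclideanSpace.inner_single_right]; simp
  rw [e]
  simp [abs_of_pos Real.pi_pos]

theorem inner_smul_single (s : ℝ) (j : Fin d) (ξ : Space d) :
    inner ℝ (s • EuclideanSpace.single j (1 : ℝ) : Space d) ξ = s * ξ j := by
  rw [real_inner_smul_left, EuclideanSpace.inner_single_left]; simp

/-- By Plancherel, from the bound of |e^{iθ} - 1| by |θ|, where θ = 2π s ξ_j is s times the modulus
of the symbol of the derivative up to sign. -/
theorem enorm_sub_translateL2_le (f : H1 d) (j : Fin d) (s : ℝ) :
    ‖f.fn - translateL2 (s • EuclideanSpace.single j (1 : ℝ)) f.fn‖ₑ ≤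
      ENNReal.ofReal |s| * ‖f.partialDeriv j‖ₑ := by
  rw [← ENNReal.rpow_le_rpow_iff (show (0 : ℝ) < 2 by norm_num),
    ENNReal.mul_rpow_of_nonneg _ _ (by norm_num), enorm_sub_translateL2, enorm_partialDeriv,
    ← lintegral_const_mul' _ _ (ENNReal.rpow_ne_top_of_nonneg (by norm_num) ENNReal.ofReal_ne_top)]
  refine lintegral_mono fun ξ => ?_
  rw [← ENNReal.mul_rpow_of_nonneg _ _ (by norm_num), ← mul_assoc]
  refine ENNReal.rpow_le_rpow (mul_le_mul_left ?_ _) (by norm_num)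
  rw [← ENNReal.ofReal_mul (abs_nonneg _), ← ofReal_norm, translationSymbol, inner_smul_single,
    norm_sub_rev]
  have h1 := Real.norm_exp_I_mul_ofReal_sub_one_le (x := 2 * π * (s * ξ j))
  rw [mul_comm Complex.I] at h1
  refine ENNReal.ofReal_le_ofReal (h1.trans (le_of_eq ?_))
  rw [Real.norm_eq_abs, abs_mul, abs_mul, abs_mul, abs_of_pos Real.pi_pos, abs_two]
  ring

theorem tendsto_difference_quotient (j : Fin d) (ξ : Space d) :
    Tendsto (fun s : ℝ => ENNReal.ofReal |s|⁻¹ *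
      ‖1 - translationSymbol (s • EuclideanSpace.single j (1 : ℝ)) ξ‖ₑ) (𝓝[≠] 0)
      (𝓝 (ENNReal.ofReal (2 * π * |ξ j|))) := by
  have h1 : HasDerivAt (fun s : ℝ => Complex.exp (((2 * π * (s * ξ j) : ℝ) : ℂ) * Complex.I))
      (((2 * π * ξ j : ℝ) : ℂ) * Complex.I) 0 := by
    have h2 : HasDerivAt (fun s : ℝ => ((2 * π * (s * ξ j) : ℝ) : ℂ) * Complex.I)
        (((2 * π * ξ j : ℝ) : ℂ) * Complex.I) 0 := by
      have h3 : HasDerivAt (fun s : ℝ => 2 * π * (s * ξ j)) (2 * π * ξ j) 0 := by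
        simpa using ((hasDerivAt_id (0 : ℝ)).mul_const (ξ j)).const_mul (2 * π)
      exact h3.ofReal_comp.mul_const Complex.I
    simpa using h2.cexp
  have h4 := (hasDerivAt_iff_tendsto_slope.1 h1).norm
  have h5 := ENNReal.tendsto_ofReal h4
  have e : ‖((2 * π * ξ j : ℝ) : ℂ) * Complex.I‖ = 2 * π * |ξ j| := by
    rw [norm_mul, Complex.norm_I, mul_one, Complex.norm_real, Real.norm_eq_abs, abs_mul,
      abs_of_pos (by positivity)]
  rw [e] at h5
  refine h5.congr fun s => ?_
  rw [slope_def_module, norm_smul, norm_inv, sub_zero, Real.norm_eq_abs,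
    ENNReal.ofReal_mul (by positivity), ofReal_norm, translationSymbol, inner_smul_single,
    ← enorm_neg]
  simp

/-- A bound on difference quotients bounds the weak derivative. -/
theorem enorm_partialDeriv_le (f : H1 d) (j : Fin d) (A : ℝ≥0∞)
    (h : ∀ s : ℝ, ‖f.fn - translateL2 (s • EuclideanSpace.single j (1 : ℝ)) f.fn‖ₑ ≤
      ENNReal.ofReal |s| * A) : ‖f.partialDeriv j‖ₑ ≤ A := by
  rw [← ENNReal.rpow_le_rpow_iff (show (0 : ℝ) < 2 by norm_num), enorm_partialDeriv]
  have hs0 : ∀ n : ℕ, (0 : ℝ) < 1 / ((n : ℝ) + 1) := fun n => by positivity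
  have hs : Tendsto (fun n : ℕ => 1 / ((n : ℝ) + 1)) atTop (𝓝[≠] 0) :=
    tendsto_nhdsWithin_iff.2 ⟨tendsto_one_div_add_atTop_nhds_zero_nat,
      Eventually.of_forall fun n => (hs0 n).ne'⟩
  have hF : AEMeasurable (fun ξ => ‖(𝓕 f.fn : L2 d) ξ‖ₑ) volume :=
    (Lp.aestronglyMeasurable (𝓕 f.fn : L2 d)).enorm
  obtain ⟨G, hG⟩ : ∃ G : ℕ → Space d → ℝ≥0∞, G = fun (n : ℕ) ξ => ENNReal.ofReal |1 / ((n : ℝ) + 1)|⁻¹ *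
      ‖1 - translationSymbol ((1 / ((n : ℝ) + 1)) • EuclideanSpace.single j (1 : ℝ)) ξ‖ₑ :=
    ⟨_, rfl⟩
  have hGm : ∀ n, Measurable (G n) := fun n => by
    rw [hG]
    exact (measurable_const.sub (continuous_translationSymbol _).measurable).enorm.const_mul _
  have hlim : ∀ ξ, Tendsto (fun n => (G n ξ * ‖(𝓕 f.fn : L2 d) ξ‖ₑ) ^ (2 : ℝ)) atTop
      (𝓝 ((ENNReal.ofReal (2 * π * |ξ j|) * ‖(𝓕 f.fn : L2 d) ξ‖ₑ) ^ (2 : ℝ))) := by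
    intro ξ
    refine Tendsto.ennrpow_const 2 (ENNReal.Tendsto.mul_const ?_ (Or.inr enorm_ne_top))
    rw [hG]
    exact (tendsto_difference_quotient j ξ).comp hs
  -- Fatou along shifts 1/(n+1): the difference-quotient symbols converge pointwise to 2π|ξ_j|.
  calc _ = ∫⁻ ξ, liminf (fun n => (G n ξ * ‖(𝓕 f.fn : L2 d) ξ‖ₑ) ^ (2 : ℝ)) atTop :=
        lintegral_congr fun ξ => (hlim ξ).liminf_eq.symm
    _ ≤ liminf (fun n => ∫⁻ ξ, (G n ξ * ‖(𝓕 f.fn : L2 d) ξ‖ₑ) ^ (2 : ℝ)) atTop :=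
        lintegral_liminf_le' fun n => ((hGm n).aemeasurable.mul hF).pow_const 2
    _ ≤ liminf (fun _ : ℕ => A ^ (2 : ℝ)) atTop := by
        refine liminf_le_liminf (Eventually.of_forall fun n => ?_)
        have h1 := h (1 / ((n : ℝ) + 1))
        have hpos : 0 < |1 / ((n : ℝ) + 1)| := abs_pos.2 (hs0 n).ne'
        have e : ∫⁻ ξ, (G n ξ * ‖(𝓕 f.fn : L2 d) ξ‖ₑ) ^ (2 : ℝ) =
            (ENNReal.ofReal |1 / ((n : ℝ) + 1)|⁻¹ * ‖f.fn - translateL2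
              ((1 / ((n : ℝ) + 1)) • EuclideanSpace.single j (1 : ℝ)) f.fn‖ₑ) ^ (2 : ℝ) := by
          rw [ENNReal.mul_rpow_of_nonneg _ _ (by norm_num), enorm_sub_translateL2,
            ← lintegral_const_mul' _ _
              (ENNReal.rpow_ne_top_of_nonneg (by norm_num) ENNReal.ofReal_ne_top)]
          refine lintegral_congr fun ξ => ?_
          rw [← ENNReal.mul_rpow_of_nonneg _ _ (by norm_num), ← mul_assoc, hG]
        rw [e]
        refine ENNReal.rpow_le_rpow ((mul_le_mul_right h1 _).trans (le_of_eq ?_)) (by norm_num)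
        rw [← mul_assoc, ← ENNReal.ofReal_mul (by positivity), inv_mul_cancel₀ hpos.ne',
          ENNReal.ofReal_one, one_mul]
    _ = A ^ (2 : ℝ) := liminf_const _


/-! ### Convergence of the profile in H¹ and scattering. -/

/-- The graph condition is an equality of continuous maps into tempered distributions. Completeness
of H¹ follows, and with it the existence of the scattering state. -/
theorem isClosed_sobolevH1 (d : ℕ) : IsClosed (sobolevH1 d :
    Set (WithLp 2 (L2 d × PiLp 2 (fun _ : Fin d => L2 d)))) := by
  have e : (sobolevH1 d : Set (WithLp 2 (L2 d × PiLp 2 (fun _ : Fin d => L2 d)))) =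
      ⋂ j : Fin d, {w | LineDeriv.lineDerivOpCLM ℂ 𝓢'(Space d, ℂ) (EuclideanSpace.single j (1 : ℝ))
        (Lp.toTemperedDistributionCLM ℂ volume 2 w.fst) =
        Lp.toTemperedDistributionCLM ℂ volume 2 (w.snd j)} := by
    ext w
    rw [Set.mem_iInter]
    exact Iff.rfl
  rw [e]
  refine isClosed_iInter fun j => isClosed_eq ?_ ?_
  · exact (ContinuousLinearMap.continuous _).comp ((ContinuousLinearMap.continuous _).comp
      (WithLp.continuous_fst 2 _ _))
  · exact (ContinuousLinearMap.continuous _).comp ((PiLp.continuous_apply 2 _ j).comp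
      (WithLp.continuous_snd 2 _ _))

instance completeSpace_H1 : CompleteSpace (H1 d) := (isClosed_sobolevH1 d).completeSpace_coe

theorem H1.norm_le_of_components {f : H1 d} {A : ℝ} (hA : 0 ≤ A) (h0 : ‖f.fn‖ ≤ A)
    (hj : ∀ j, ‖f.partialDeriv j‖ ≤ A) : ‖f‖ ≤ (d + 1) * A := by
  refine le_of_sq_le_sq ?_ (by positivity)
  rw [H1.norm_sq]
  calc ‖f.fn‖ ^ 2 + ∑ j, ‖f.partialDeriv j‖ ^ 2 ≤ A ^ 2 + ∑ _j : Fin d, A ^ 2 := by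
        refine add_le_add (by gcongr) (Finset.sum_le_sum fun j _ => ?_)
        have := hj j
        gcongr
    _ = (d + 1) * A ^ 2 := by
        rw [Finset.sum_const, Finset.card_univ, Fintype.card_fin, nsmul_eq_mul]; ring
    _ ≤ ((d + 1) * A) ^ 2 := by
        have : (0 : ℝ) ≤ d := by positivity
        nlinarith [mul_nonneg this (sq_nonneg A), mul_nonneg (mul_nonneg this this) (sq_nonneg A)]

/-- The asymptotic profile is Cauchy in `H¹` for a bounded solution of small critical norm. -/
theorem exists_profile_lipschitz (hd : 3 ≤ d) :
    ∃ κ C : ℝ, 0 < κ ∧ 0 < C ∧ ∀ u : ℝ → H1 d, IsGlobalSolution u → ∀ K : ℝ, (∀ t, ‖u t‖ ≤ K) →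
      ∀ t₀ : ℝ,
      timeNorm (criticalExp d) (Set.Ioi t₀) (fun t => H1.enNorm (u t)) ≤ ENNReal.ofReal κ →
      ∀ t₁ t₂ : ℝ, t₀ ≤ t₁ → t₁ ≤ t₂ → ENNReal.ofReal
        ‖schrodingerH1 (-t₂) (u t₂) - schrodingerH1 (-t₁) (u t₁)‖ ≤
        ENNReal.ofReal (C * K) * timeNorm (criticalExp d) (Set.Ioi t₁)
          (fun s => H1.enNorm (u s)) ^ (4 / ((d : ℝ) - 1)) := by
  have h3 := three_le_cast hd
  have hp := power_pos hd
  have ha := criticalExp_pos hd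
  obtain ⟨κ, C, hκ, hC, hlip⟩ := exists_lipschitz hd
  refine ⟨κ, (d + 1) * (C * 2), hκ, by positivity,
    fun u hu K hK t₀ hX t₁ t₂ h01 h12 => ?_⟩
  have hK0 : 0 ≤ K := (norm_nonneg _).trans (hK 0)
  obtain ⟨Y, hY⟩ : ∃ Y, Y = timeNorm (criticalExp d) (Set.Ioi t₁) (fun s => H1.enNorm (u s)) ^
    (4 / ((d : ℝ) - 1)) := ⟨_, rfl⟩
  obtain ⟨G, hG⟩ : ∃ G : H1 d, G = schrodingerH1 (-t₂) (u t₂) - schrodingerH1 (-t₁) (u t₁) :=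
    ⟨_, rfl⟩
  rw [← hY, ← hG]
  have hYfin : Y ≠ ⊤ := by
    rw [hY]
    exact ENNReal.rpow_ne_top_of_nonneg hp.le (ne_top_of_le_ne_top ENNReal.ofReal_ne_top
      ((timeNorm_mono_set (by linarith) (Set.Ioi_subset_Ioi h01) _).trans hX))
  obtain ⟨y, hy0, hy⟩ : ∃ y : ℝ, 0 ≤ y ∧ Y = ENNReal.ofReal y :=
    ⟨Y.toReal, ENNReal.toReal_nonneg, (ENNReal.ofReal_toReal hYfin).symm⟩
  have h0 : ‖G.fn‖ ≤ C * 2 * y * K := by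
    have h := hlip u (fun _ => 0) hu isGlobalSolution_zero t₀ hX
      (by rw [timeNorm_enNorm_zero (by linarith)]; exact zero_le) t₁ t₂ h01 h12
    have e : duhamelDiff u (fun _ => 0) 0 t₁ t₂ = G := by
      rw [hG]; simp only [duhamelDiff, sub_zero, zero_sub]
    rw [e, timeNorm_enNorm_zero (by linarith), ENNReal.zero_rpow_of_pos hp, add_zero, ← hY, hy,
      sub_zero, ← ofReal_norm, ← ofReal_norm, ← ENNReal.ofReal_mul hC.le,
      ← ENNReal.ofReal_mul (by positivity), ENNReal.ofReal_le_ofReal_iff (by positivity)] at h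
    have h4 := (H1.norm_fn_le (u t₀)).trans (hK t₀)
    calc _ ≤ _ := h
      _ ≤ C * y * K := by gcongr
      _ ≤ _ := by nlinarith [mul_nonneg (mul_nonneg hC.le hy0) hK0]
  have hj : ∀ j, ‖G.partialDeriv j‖ ≤ C * 2 * y * K := by
    intro j
    -- The solution is compared with its translate by s e_j. The difference of their profiles is G
    -- minus its translate, and the data at t₀ differ by at most |s| times the L² norm of ∂_j u(t₀).
    -- The critical norm is translation invariant, which accounts for y + y.
    have hA := enorm_partialDeriv_le G j (ENNReal.ofReal (C * 2 * y) * ‖(u t₀).partialDeriv j‖ₑ)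
      fun s => by
        obtain ⟨h, hh⟩ : ∃ h : Space d, h = s • EuclideanSpace.single j (1 : ℝ) := ⟨_, rfl⟩
        have h1 := hlip u (fun t => translateH1 h (u t)) hu (hu.translate h) t₀ hX
          (by simp_rw [enNorm_translateH1]; exact hX) t₁ t₂ h01 h12
        have e : (duhamelDiff u (fun t => translateH1 h (u t)) 0 t₁ t₂).fn =
            G.fn - translateL2 h G.fn := by
          rw [← fn_translateH1, ← H1.fn_sub, hG, translateH1_sub, translateH1_schrodingerH1,
            translateH1_schrodingerH1]
          simp only [duhamelDiff, zero_sub, schrodingerH1_sub]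
          congr 1
          abel
        simp_rw [enNorm_translateH1] at h1
        rw [e, ← hY, hy, ← ENNReal.ofReal_add hy0 hy0, ← ENNReal.ofReal_mul hC.le, H1.fn_sub,
          fn_translateH1] at h1
        rw [← hh]
        refine h1.trans ((mul_le_mul_right (hh ▸ enorm_sub_translateL2_le (u t₀) j s) _).trans
          (le_of_eq ?_))
        rw [show C * 2 * y = C * (y + y) by ring]
        ring
    have h5 : ‖(u t₀).partialDeriv j‖ ≤ K := by
      refine le_trans (le_of_sq_le_sq ?_ (norm_nonneg (u t₀))) (hK t₀)
      rw [H1.norm_sq]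
      have := Finset.single_le_sum (f := fun j => ‖(u t₀).partialDeriv j‖ ^ 2)
        (fun j _ => sq_nonneg _) (Finset.mem_univ j)
      nlinarith [sq_nonneg ‖(u t₀).fn‖]
    rw [← ofReal_norm, ← ofReal_norm, ← ENNReal.ofReal_mul (by positivity),
      ENNReal.ofReal_le_ofReal_iff (by positivity)] at hA
    exact hA.trans (by gcongr)
  rw [hy, ← ENNReal.ofReal_mul (by positivity)]
  refine ENNReal.ofReal_le_ofReal ((H1.norm_le_of_components (by positivity) h0 hj).trans
    (le_of_eq ?_))
  ring

/-- A bounded solution with small critical norm near infinity scatters. -/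
theorem exists_scattersForward (hd : 3 ≤ d) :
    ∃ κ : ℝ, 0 < κ ∧ ∀ u : ℝ → H1 d, IsGlobalSolution u → ∀ K : ℝ, (∀ t, ‖u t‖ ≤ K) → ∀ t₀ : ℝ,
      timeNorm (criticalExp d) (Set.Ioi t₀) (fun t => H1.enNorm (u t)) ≤ ENNReal.ofReal κ →
      ScattersForward u := by
  have hp := power_pos hd
  have ha := criticalExp_pos hd
  obtain ⟨κ, C, hκ, hC, hlip⟩ := exists_profile_lipschitz hd
  refine ⟨κ, hκ, fun u hu K hK t₀ hX => ?_⟩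
  have hcont : Continuous fun t => H1.enNorm (u t) := (continuous_enNorm hd).comp hu.continuous
  have htail := tendsto_timeNorm_Ioi (by linarith) hcont.measurable
    (ne_top_of_le_ne_top ENNReal.ofReal_ne_top hX)
  have hlim : Tendsto (fun t₁ => ENNReal.ofReal (C * K) * timeNorm (criticalExp d) (Set.Ioi t₁)
      (fun s => H1.enNorm (u s)) ^ (4 / ((d : ℝ) - 1))) atTop (𝓝 0) := by
    have h1 := htail.ennrpow_const (4 / ((d : ℝ) - 1))
    rw [ENNReal.zero_rpow_of_pos hp] at h1
    have h2 := ENNReal.Tendsto.const_mul (a := ENNReal.ofReal (C * K)) h1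
      (Or.inr ENNReal.ofReal_ne_top)
    rwa [mul_zero] at h2
  have hcauchy : CauchySeq fun t => schrodingerH1 (-t) (u t) := by
    rw [Metric.cauchySeq_iff']
    intro ε hε
    have hev := (hlim.eventually (gt_mem_nhds (ENNReal.ofReal_pos.2 hε))).and
      (eventually_ge_atTop t₀)
    obtain ⟨N, hN, hN0⟩ := hev.exists
    refine ⟨N, fun t ht => ?_⟩
    have h1 := (hlip u hu K hK t₀ hX N t hN0 ht).trans_lt hN
    rw [dist_eq_norm]
    exact (ENNReal.ofReal_lt_ofReal_iff hε).1 h1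
  obtain ⟨f, hf⟩ := cauchySeq_tendsto_of_complete hcauchy
  refine ⟨f, ?_⟩
  rw [tendsto_iff_norm_sub_tendsto_zero] at hf
  refine hf.congr fun t => ?_
  rw [← norm_schrodingerH1 t, schrodingerH1_sub, schrodingerH1_schrodingerH1, add_neg_cancel,
    schrodingerH1_zero]

theorem timeNorm_Ioi_le {b : ℝ} (hb : 0 < b) {f : ℝ → ℝ} {t₀ : ℝ} {A : ℝ≥0∞}
    (h : ∀ T, t₀ ≤ T → timeNorm b (Set.Ioc t₀ T) f ≤ A) : timeNorm b (Set.Ioi t₀) f ≤ A := by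
  have hmono : Monotone fun n : ℕ => Set.Ioc t₀ (t₀ + n) := fun m n hmn => by
    have : (m : ℝ) ≤ n := by exact_mod_cast hmn
    exact Set.Ioc_subset_Ioc_right (by linarith)
  have hU : ⋃ n : ℕ, Set.Ioc t₀ (t₀ + n) = Set.Ioi t₀ := by
    ext t
    simp only [Set.mem_iUnion, Set.mem_Ioc, Set.mem_Ioi]
    refine ⟨fun ⟨n, hn⟩ => hn.1, fun ht => ?_⟩
    obtain ⟨n, hn⟩ := exists_nat_ge (t - t₀)
    exact ⟨n, ht, by linarith⟩
  rw [timeNorm, ← hU, setLIntegral_iUnion_of_directed _ hmono.directed_le, one_div,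
    ENNReal.rpow_inv_le_iff hb]
  refine iSup_le fun n => ?_
  rw [← ENNReal.rpow_inv_le_iff hb, ← one_div]
  exact h _ (by have : (0 : ℝ) ≤ n := by positivity
                linarith)

/-- The bootstrap makes the critical norm of u finite on (t₀, ∞). Its tail then tends to zero, so a
later starting time meets the stricter smallness needed for convergence of the profile. -/
theorem exists_scattering_threshold (hd : 3 ≤ d) :
    ∃ η : ℝ, 0 < η ∧ ∀ u : ℝ → H1 d, IsGlobalSolution u → ∀ K : ℝ, (∀ t, ‖u t‖ ≤ K) → ∀ t₀ : ℝ,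
      timeNorm (criticalExp d) (Set.Ioi t₀) (fun t => H1.enNorm (schrodingerH1 (t - t₀) (u t₀))) ≤
        ENNReal.ofReal η → ScattersForward u := by
  have ha := criticalExp_pos hd
  obtain ⟨η, hη, hboot⟩ := exists_bootstrap hd
  obtain ⟨κ, hκ, hsc⟩ := exists_scattersForward hd
  refine ⟨η, hη, fun u hu K hK t₀ hlin => ?_⟩
  have hX := timeNorm_Ioi_le (by linarith) (hboot u hu t₀ hlin)
  have hcont : Continuous fun t => H1.enNorm (u t) := (continuous_enNorm hd).comp hu.continuous
  have htail := tendsto_timeNorm_Ioi (by linarith) hcont.measurable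
    (ne_top_of_le_ne_top ENNReal.ofReal_ne_top hX)
  obtain ⟨t₁, ht₁⟩ := (htail.eventually (ge_mem_nhds (ENNReal.ofReal_pos.2 hκ))).exists
  exact hsc u hu K hK t₁ ht₁

end NLS

end

theorem theorem3p1 (d : ℕ) (hd : 3 ≤ d) (E₀ C₁ C₂ : ℝ) (hC₁ : 0 < C₁) (hC₂ : 0 < C₂) :
    ∃ ε₀ : ℝ, 0 < ε₀ ∧ ∀ ε : ℝ, 0 < ε → ε ≤ ε₀ →
      ∃ Tmin : ℝ, 0 < Tmin ∧ ∀ T₀ : ℝ, Tmin ≤ T₀ →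
        ∀ u : ℝ → NLS.H1 d, NLS.IsGlobalSolution u →
          NLS.mass (u 0) = E₀ → NLS.energy (u 0) = E₀ →
          (∀ t : ℝ, ‖u t‖ ^ 2 ≤ C₁ * E₀) →
          (∀ a : ℝ, ∃ t₀ ∈ Set.Ioo a (a + T₀),
            NLS.spacetimeNorm (2 * ((d : ℝ) + 2) / ((d : ℝ) - 1))
              (Set.Icc (t₀ - T₀ ^ (1 / 3 : ℝ)) t₀) u ≤ ENNReal.ofReal (C₂ * ε)) →
          NLS.ScattersForward u := by
  -- When C₁E₀ < 0 the uniform H¹ bound is contradictory and any constants serve. Otherwise K =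
  -- √(C₁E₀) bounds the solution, and ε₀ and Tmin depend on the data only through it.
  by_cases hE : 0 ≤ C₁ * E₀
  · obtain ⟨η, hη, hsc⟩ := NLS.exists_scattering_threshold hd
    obtain ⟨ε₀, hε₀, h⟩ := NLS.exists_small_linear_evolution hd (Real.sqrt_nonneg (C₁ * E₀)) hC₂ hη
    refine ⟨ε₀, hε₀, fun ε hε hε' => ?_⟩
    obtain ⟨Tmin, hT, h'⟩ := h ε hε hε'
    refine ⟨Tmin, hT, fun T₀ hT₀ u hu _ _ hbound hyp => ?_⟩
    have hK : ∀ t, ‖u t‖ ≤ √(C₁ * E₀) := fun t => Real.le_sqrt_of_sq_le (hbound t)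
    obtain ⟨t₀, ht₀⟩ := h' T₀ hT₀ u hu hK hyp
    exact hsc u hu _ hK t₀ ht₀
  · exact ⟨1, one_pos, fun ε _ _ => ⟨1, one_pos, fun T₀ _ u _ _ _ hbound _ =>
      absurd ((sq_nonneg _).trans (hbound 0)) hE⟩⟩
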